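/- **Setting.** Let $(\Omega,\mathcal G,P)$ be a probability space with a filtration $\mathbb F=(\mathcal F_t)_{t\ge0}$, $\mathcal F_\infty=\bigvee_t\mathcal F_t$, and let $n\ge1$. Policy $i=1,\dots,n$ has an accident time $\tau^i_0\in(0,\infty]$ a.s., a finite reporting delay $\theta^i\ge0$, a first payment $X^i_1\ge0$, and a marked point process $(\tilde\tau^i_j,\tilde X^i_j)_{j\ge1}$ of later developments with payments $\tilde X^i_j\ge0$, where a.s. $\tilde\tau^i_j$ is nondecreasing in $j$, strictly increasing as long as it is finite, and tends to $\infty$. Put $\tau^i_1=\tau^i_0+\theta^i$, $\tau^i_{j+1}=\tau^i_1+\tilde\tau^i_j$, $X^i_{j+1}=\tilde X^i_j$, with marks $\Theta^i_1=(\theta^i,X^i_1)$, $\Theta^i_{j+1}=(0,X^i_{j+1})$. Let $\mathcal H_t=\sigma\big(\sum_j 1_{\{\tau^i_j\le s\}}1_{\{\Theta^i_j\in B\}}:\ i\le n,\ s\le t,\ B\in\mathcal B(\mathbb R_+^2)\big)$ and $\mathcal G_t=\mathcal F_t\vee\mathcal H_t$. Assume: 1. for $t\in[0,\infty]$ and finite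 $s\le t$, $P(\tau^i_0>s\mid\mathcal F_t)=P(\tau^i_0>s\mid\mathcal F_s)$; the accident times are conditionally independent: $P(\tau^1_0>r_1,\dots,\tau^n_0>r_n\mid\mathcal F_t)=\prod_iP(\tau^i_0>r_i\mid\mathcal F_t)$ for all finite $r_1,\dots,r_n\le t$; and there is an $\mathbb F$-progressive, pathwise locally integrable process $\mu$, common to all policies, with $P(\tau^i_0\le t\mid\mathcal F_t)=1-e^{-\Gamma_t}$, $\Gamma_t=\int_0^t\mu_s\,ds$, for all $t\ge 0$; 2. $X^1_1,\dots,X^n_1$ are mutually independent and jointly independent of $\mathcal F_\infty\vee\sigma(\tau^k_0:k\le n)$; the delays are mutually independent and jointly independent of $\mathcal F_\infty\vee\sigma(\tau^k_0,X^k_1:k\le n)$; the $n$ developments are mutually independent and jointly independent of $\mathcal F_\infty\vee\sigma(\tau^k_1,\theta^k,X^k_1:k\le n)$; 3. all delays have distribution function $G(x)=\alpha_0+\int_0^xg(y)\,dy$, $x\ge0$, with $g\ge 0$ integrable on $(0,\infty)$; write $\bar G=1-G$; 4. the $X^i_1$ are integrable with a common mean $m_1=E[X^i_1]$; 5. the developments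 are compound Poisson on $[0,T]$: for each $i$ the counting process $\tilde{\mathbf N}^i_t=\sum_j1_{\{\tilde\tau^i_j\le t\}}$, $t\in[0,T]$, is a Poisson process with parameter $\lambda\ge0$, the $\tilde X^i_j$ are i.i.d. and integrable with mean $m$ (same law for all $i$), and $(\tilde X^i_j)_j$ is independent of $\tilde{\mathbf N}^i$; 6. on $[0,T]$, the inflation index $I\ge0$, the nominal prices $S^1,\dots,S^d$ of the primary assets and the benchmark $S^*>0$ are continuous and $\mathbb F$-adapted, and every $S^k/S^*$ is an $\mathbb F$-local martingale (no further property of the benchmark portfolio is needed); 7. $\sup_{u\le T}I_u/S^*_u$ is dominated by an integrable random variable (for instance, $I/S^*$ is bounded). Let $A_t=\sum_{i=1}^n\sum_{j\ge1}1_{\{\tau^i_j\le t\}}\frac{I_{\tau^i_j}}{S^*_{\tau^i_j}}X^i_j$ be the nominal benchmarked cumulative payment, $V_t=\frac{S^*_t}{I_t}E[A_T-A_t\mid\mathcal G_t]$ the real-world price (where $I_t>0$), and $R_t=\sum_i1_{\{\tau^i_1\le t\}}$ the number of reported claims. **Conclusion.** The conditional distribution functions $u\mapsto P(\tau^i_1\le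 u\mid\mathcal F_u)$ have a version with nondecreasing right-continuous paths, the same for all $i$ and denoted $P(\tau_1\le u\mid\mathcal F_u)$, and a.s., for all $u\ge0$, $$P(\tau_1\le u\mid\mathcal F_u)=\int_0^u\Big(\alpha_0e^{-\Gamma_s}\mu_s+\int_0^sg(s-v)e^{-\Gamma_v}\mu_v\,dv\Big)ds .$$ For every $t\in[0,T]$, $A_T-A_t$ is integrable, the denominator below is a.s. positive, and with $$Q_t=\frac{E\Big[\int_t^T\Big(m_1\frac{I_u}{S^*_u}+\lambda m\int_u^T\frac{I_v}{S^*_v}\,dv\Big)\,dP(\tau_1\le u\mid\mathcal F_u)\,\Big|\,\mathcal F_t\Big]}{e^{-\Gamma_t}+\int_0^t\bar G(t-u)e^{-\Gamma_u}\mu_u\,du}$$ one has a.s. $$E[A_T-A_t\mid\mathcal G_t]=\lambda m\,R_t\,E\Big[\int_t^T\frac{I_u}{S^*_u}\,du\,\Big|\,\mathcal F_t\Big]+(n-R_t)\,Q_t .$$ If moreover the inflation-linked bond is a primary asset in the sense that one real unit, with nominal price $I$, is traded, i.e. a.s. $S^k=I$ on $[0,T]$ for some $k$, then a.s. $$E[A_T-A_t\mid\mathcal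 G_t]=\lambda m\,R_t\,(T-t)\,\frac{I_t}{S^*_t}+(n-R_t)\,Q_t ,$$ and $V_t\,I_t/S^*_t$ equals this right-hand side a.s. on $\{I_t\ne0\}$. -/

import Mathlib

open MeasureTheory ProbabilityTheory Filter Topology
open scoped NNReal ENNReal

noncomputable section

namespace NonLife

variable {Ω : Type*} {mΩ : MeasurableSpace Ω} {n : ℕ}

/-- The random objects describing `n` policies. Time is `[0, ∞]` for event times, the value `∞`
meaning that the event never happens. Developments are numbered from `0`, so `devTime i j` and
`devMark i j` are the `(j+1)`-st development time (counted from the first reporting) and its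
payment. -/
structure Portfolio (Ω : Type*) [MeasurableSpace Ω] (n : ℕ) where
  /-- accident time -/
  accidentTime : Fin n → Ω → ℝ≥0∞
  /-- reporting delay -/
  delay : Fin n → Ω → ℝ≥0
  /-- payment at the first reporting -/
  firstMark : Fin n → Ω → ℝ≥0
  /-- times of the developments, counted from the first reporting -/
  devTime : Fin n → ℕ → Ω → ℝ≥0∞
  /-- payments of the developments -/
  devMark : Fin n → ℕ → Ω → ℝ≥0
  measurable_accidentTime : ∀ i, Measurable (accidentTime i)
  measurable_delay : ∀ i, Measurable (delay i)
  measurable_firstMark : ∀ i, Measurable (firstMark i)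
  measurable_devTime : ∀ i j, Measurable (devTime i j)
  measurable_devMark : ∀ i j, Measurable (devMark i j)

namespace Portfolio

variable (C : Portfolio Ω n)

/-- Event times of policy `i`, numbered from `0`: `eventTime i 0` is the first reporting time
(accident time plus delay), and `eventTime i (j + 1)` is the time of development `j`. -/
def eventTime (i : Fin n) : ℕ → Ω → ℝ≥0∞
  | 0 => fun ω => C.accidentTime i ω + C.delay i ω
  | j + 1 => fun ω => C.accidentTime i ω + C.delay i ω + C.devTime i j ω

/-- Two-dimensional marks (delay, payment); only the first event has a nonzero delay component. -/
def mark (i : Fin n) : ℕ → Ω → ℝ≥0 × ℝ≥0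
  | 0 => fun ω => (C.delay i ω, C.firstMark i ω)
  | j + 1 => fun ω => (0, C.devMark i j ω)

/-- The marked cumulative process: the number of events of policy `i` up to time `t` with mark
in `B`. -/
def markedCount (i : Fin n) (t : ℝ≥0) (B : Set (ℝ≥0 × ℝ≥0)) (ω : Ω) : ℝ≥0∞ :=
  ∑' j, Set.indicator {ω | C.eventTime i j ω ≤ t ∧ C.mark i j ω ∈ B} (fun _ => (1 : ℝ≥0∞)) ω

/-- The internal information of the insurance company at time `t`, generated by the marked
cumulative processes of all policies up to time `t`. -/
def internalInfo (t : ℝ≥0) : MeasurableSpace Ω :=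
  ⨆ (i : Fin n) (s : ℝ≥0) (_ : s ≤ t) (B : Set (ℝ≥0 × ℝ≥0)) (_ : MeasurableSet B),
    MeasurableSpace.comap (C.markedCount i s B) inferInstance

/-- The global information at time `t`: the join of reference and internal information. -/
def globalInfo (𝓕 : Filtration ℝ≥0 mΩ) (t : ℝ≥0) : MeasurableSpace Ω :=
  𝓕 t ⊔ C.internalInfo t

/-- The ground process of the developments of policy `i`: the number of developments up to time
`t` after the first reporting. -/
def devCount (i : Fin n) (t : ℝ≥0) (ω : Ω) : ℕ :=
  {j : ℕ | C.devTime i j ω ≤ t}.ncard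

/-- The number of claims reported up to time `t`. -/
def reported (t : ℝ≥0) (ω : Ω) : ℝ :=
  ∑ i, Set.indicator {ω | C.eventTime i 0 ω ≤ t} (fun _ => (1 : ℝ)) ω

/-- The nominal benchmarked cumulative payment
`A_t = ∑ i, ∑ j, 1_{τ_j ≤ t} (I / S*)_{τ_j} X_j`, where `I` is the inflation index and `Sstar` the
benchmark. -/
def payment (I Sstar : ℝ≥0 → Ω → ℝ) (t : ℝ≥0) (ω : Ω) : ℝ :=
  ∑ i, ∑' j, Set.indicator {ω | C.eventTime i j ω ≤ t}
    (fun ω => I (C.eventTime i j ω).toNNReal ω / Sstar (C.eventTime i j ω).toNNReal ω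
      * ((C.mark i j ω).2 : ℝ)) ω

/-- The real world pricing formula `V_t = (S*_t / I_t) E[A_T - A_t | 𝓖_t]`. -/
def realWorldPrice (P : Measure Ω) (𝓕 : Filtration ℝ≥0 mΩ) (I Sstar : ℝ≥0 → Ω → ℝ)
    (T t : ℝ≥0) (ω : Ω) : ℝ :=
  Sstar t ω / I t ω
    * (P[fun ω => C.payment I Sstar T ω - C.payment I Sstar t ω | C.globalInfo 𝓕 t]) ω

end Portfolio

/-- The `σ`-algebra `𝓕_t` for `t ∈ [0, ∞]`, with `𝓕_∞` generated by all `𝓕_s`, `s < ∞`. -/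
def sigmaAt (𝓕 : Filtration ℝ≥0 mΩ) (t : ℝ≥0∞) : MeasurableSpace Ω :=
  ⨆ (s : ℝ≥0) (_ : (s : ℝ≥0∞) ≤ t), 𝓕 s

theorem sigmaAt_coe (𝓕 : Filtration ℝ≥0 mΩ) (t : ℝ≥0) : sigmaAt 𝓕 t = 𝓕 t := by
  refine le_antisymm (iSup₂_le fun s hs => 𝓕.mono (by exact_mod_cast hs)) ?_
  exact le_iSup₂_of_le t le_rfl le_rfl

/-- The conditional probability `P(A | m)`. -/
def condProb (P : Measure Ω) (A : Set Ω) (m : MeasurableSpace Ω) : Ω → ℝ :=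
  P[A.indicator (fun _ => (1 : ℝ)) | m]

/-- The hazard process `Γ_t = ∫_0^t μ_s ds`. -/
def hazard (μ : ℝ≥0 → Ω → ℝ) (t : ℝ) (ω : Ω) : ℝ :=
  ∫ s in (0 : ℝ)..t, μ s.toNNReal ω

/-- The distribution function `G(x) = α₀ + ∫_0^x g(y) dy` of the delays, for `x ≥ 0`. -/
def delayCDF (α₀ : ℝ) (g : ℝ → ℝ) (x : ℝ) : ℝ :=
  α₀ + ∫ y in (0 : ℝ)..x, g y

/-- `α₀ exp(-Γ_s) μ_s + ∫_0^s g(s - u) exp(-Γ_u) μ_u du`. -/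
def reportDensity (α₀ : ℝ) (g : ℝ → ℝ) (μ : ℝ≥0 → Ω → ℝ) (s : ℝ) (ω : Ω) : ℝ :=
  α₀ * Real.exp (-hazard μ s ω) * μ s.toNNReal ω
    + ∫ u in (0 : ℝ)..s, g (s - u) * (Real.exp (-hazard μ u ω) * μ u.toNNReal ω)

/-- `exp(-Γ_t) + ∫_0^t (1 - G(t - u)) exp(-Γ_u) μ_u du`. -/
def notReported (α₀ : ℝ) (g : ℝ → ℝ) (μ : ℝ≥0 → Ω → ℝ) (t : ℝ) (ω : Ω) : ℝ :=
  Real.exp (-hazard μ t ω)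
    + ∫ u in (0 : ℝ)..t, (1 - delayCDF α₀ g (t - u)) * (Real.exp (-hazard μ u ω) * μ u.toNNReal ω)

/-- The standing assumptions on the joint law of the portfolio and the reference filtration:
conditional independence of the accident times with common intensity `μ`, and independence of
first marks, delays and developments. -/
structure IsReducedForm (P : Measure Ω) (𝓕 : Filtration ℝ≥0 mΩ) (C : Portfolio Ω n)
    (μ : ℝ≥0 → Ω → ℝ) : Prop where
  accident_pos : ∀ i, ∀ᵐ ω ∂P, 0 < C.accidentTime i ω
  dev_mono : ∀ i, ∀ᵐ ω ∂P, Monotone fun j => C.devTime i j ω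
  dev_strict : ∀ i, ∀ᵐ ω ∂P, ∀ j, C.devTime i j ω < ∞ → C.devTime i j ω < C.devTime i (j + 1) ω
  dev_tendsto : ∀ i, ∀ᵐ ω ∂P, Tendsto (fun j => C.devTime i j ω) atTop (𝓝 ∞)
  /-- `P(τ₀ > s | 𝓕_t) = P(τ₀ > s | 𝓕_s)` for `t ∈ [0, ∞]` and finite `s ≤ t`. -/
  accident_condProb : ∀ (i : Fin n) (t : ℝ≥0∞) (s : ℝ≥0), (s : ℝ≥0∞) ≤ t →
    condProb P {ω | (s : ℝ≥0∞) < C.accidentTime i ω} (sigmaAt 𝓕 t)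
      =ᵐ[P] condProb P {ω | (s : ℝ≥0∞) < C.accidentTime i ω} (𝓕 s)
  /-- The accident times are conditionally independent given `𝓕_t`, for `t ∈ [0, ∞]`. -/
  accident_condIndep : ∀ (t : ℝ≥0∞) (r : Fin n → ℝ≥0), (∀ i, (r i : ℝ≥0∞) ≤ t) →
    condProb P {ω | ∀ i, (r i : ℝ≥0∞) < C.accidentTime i ω} (sigmaAt 𝓕 t)
      =ᵐ[P] fun ω => ∏ i, condProb P {ω | (r i : ℝ≥0∞) < C.accidentTime i ω} (sigmaAt 𝓕 t) ω
  intensity_progressive : IsStronglyProgressive 𝓕 μ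
  intensity_integrable : ∀ᵐ ω ∂P, ∀ t : ℝ≥0,
    IntervalIntegrable (fun s : ℝ => μ s.toNNReal ω) volume 0 t
  /-- `exp(-Γ_t) = 1 - P(τ₀ ≤ t | 𝓕_t)`. -/
  accident_intensity : ∀ (i : Fin n) (t : ℝ≥0),
    (fun ω => Real.exp (-hazard μ t ω))
      =ᵐ[P] fun ω => 1 - condProb P {ω | C.accidentTime i ω ≤ t} (𝓕 t) ω
  firstMark_iIndep : iIndepFun C.firstMark P
  firstMark_indep : Indep (⨆ i, MeasurableSpace.comap (C.firstMark i) inferInstance)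
    (sigmaAt 𝓕 ∞ ⊔ ⨆ i, MeasurableSpace.comap (C.accidentTime i) inferInstance) P
  delay_iIndep : iIndepFun C.delay P
  delay_indep : Indep (⨆ i, MeasurableSpace.comap (C.delay i) inferInstance)
    (sigmaAt 𝓕 ∞ ⊔ ⨆ i, MeasurableSpace.comap
      (fun ω => (C.accidentTime i ω, C.firstMark i ω)) inferInstance) P
  dev_iIndep : iIndepFun (fun i ω (j : ℕ) => (C.devTime i j ω, C.devMark i j ω)) P
  dev_indep : Indep
    (⨆ i, MeasurableSpace.comap
      (fun ω (j : ℕ) => (C.devTime i j ω, C.devMark i j ω)) inferInstance)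
    (sigmaAt 𝓕 ∞ ⊔ ⨆ i, MeasurableSpace.comap
      (fun ω => (C.eventTime i 0 ω, C.delay i ω, C.firstMark i ω)) inferInstance) P

/-- All delays have the distribution function `G(x) = α₀ + ∫_0^x g(y) dy`, `x ≥ 0`: an atom `α₀`
at `0` and a density `g` on `(0, ∞)`. -/
structure HasDelayLaw (P : Measure Ω) (C : Portfolio Ω n) (α₀ : ℝ) (g : ℝ → ℝ) : Prop where
  density_nonneg : ∀ x, 0 < x → 0 ≤ g x
  density_integrable : IntegrableOn g (Set.Ioi 0)
  cdf_eq : ∀ (i : Fin n) (x : ℝ≥0), P.real {ω | C.delay i ω ≤ x} = delayCDF α₀ g x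

/-- `N` is, on the time interval `[0, T]`, a Poisson process with parameter `rate`. -/
structure IsPoissonUpTo (P : Measure Ω) (N : ℝ≥0 → Ω → ℕ) (rate T : ℝ≥0) : Prop where
  zero : ∀ᵐ ω ∂P, N 0 ω = 0
  indep : HasIndepIncrements (fun t => N (min t T)) P
  law : ∀ s t : ℝ≥0, s ≤ t → t ≤ T →
    HasLaw (fun ω => N t ω - N s ω) (poissonMeasure (rate * (t - s))) P

/-- The cumulative development payments of the policies are, on `[0, T]`, compound Poisson
processes with common jump rate `rate` and i.i.d. integrable jumps of mean `m`. -/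
structure IsCompoundPoissonDev (P : Measure Ω) (C : Portfolio Ω n) (rate T : ℝ≥0) (m : ℝ) :
    Prop where
  poisson : ∀ i, IsPoissonUpTo P (C.devCount i) rate T
  iIndep : ∀ i, iIndepFun (C.devMark i) P
  identDistrib : ∀ i i' j j', IdentDistrib (C.devMark i j) (C.devMark i' j') P P
  indep : ∀ i, IndepFun (fun ω (j : ℕ) => C.devMark i j ω)
    (fun ω (t : Set.Iic T) => C.devCount i t ω) P
  integrable : ∀ i j, Integrable (fun ω => (C.devMark i j ω : ℝ)) P
  mean : ∀ i j, ∫ ω, (C.devMark i j ω : ℝ) ∂P = m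

/-- `X` restricted to `[0, T]` is a local martingale. -/
def IsLocalMartingaleUpTo (P : Measure Ω) (𝓕 : Filtration ℝ≥0 mΩ) (X : ℝ≥0 → Ω → ℝ) (T : ℝ≥0) :
    Prop :=
  Locally (fun Y => Martingale Y 𝓕 P) 𝓕 (fun t => X (min t T)) P

/-- The financial market on `[0, T]`: the inflation index `I`, the price processes `S` of the
primary assets and the benchmark `Sstar` are continuous and adapted to the reference filtration,
`I` is nonnegative, `Sstar` is positive, and the benchmarked primary assets are local martingales
for the reference filtration. That `Sstar` is moreover the value process of a self-financing
portfolio with supermartingale benchmarked portfolios is not required. -/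
structure IsMarket (P : Measure Ω) (𝓕 : Filtration ℝ≥0 mΩ) {d : ℕ} (I Sstar : ℝ≥0 → Ω → ℝ)
    (S : Fin d → ℝ≥0 → Ω → ℝ) (T : ℝ≥0) : Prop where
  index_adapted : ∀ t ≤ T, Measurable[𝓕 t] (I t)
  index_continuous : ∀ ω, ContinuousOn (fun t => I t ω) (Set.Iic T)
  index_nonneg : ∀ ω, ∀ t ≤ T, 0 ≤ I t ω
  benchmark_adapted : ∀ t ≤ T, Measurable[𝓕 t] (Sstar t)
  benchmark_continuous : ∀ ω, ContinuousOn (fun t => Sstar t ω) (Set.Iic T)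
  benchmark_pos : ∀ ω, ∀ t ≤ T, 0 < Sstar t ω
  asset_adapted : ∀ k, ∀ t ≤ T, Measurable[𝓕 t] (S k t)
  asset_continuous : ∀ k ω, ContinuousOn (fun t => S k t ω) (Set.Iic T)
  benchmarked_local : ∀ k, IsLocalMartingaleUpTo P 𝓕 (fun t ω => S k t ω / Sstar t ω) T

/-- The conditional expectation
`E[∫_]t,T] (m₁ Z_u + c ∫_u^T Z_v dv) dp_u | 𝓕_t]` for paths `p ω` of a conditional distribution
function. -/
def unreportedNumerator (P : Measure Ω) (𝓕 : Filtration ℝ≥0 mΩ) (p : Ω → StieltjesFunction ℝ)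
    (m₁ c : ℝ) (Z : ℝ≥0 → Ω → ℝ) (T t : ℝ≥0) : Ω → ℝ :=
  P[fun ω => ∫ u in Set.Ioc (t : ℝ) T,
      (m₁ * Z u.toNNReal ω + c * ∫ v in u..(T : ℝ), Z v.toNNReal ω) ∂(p ω).measure | 𝓕 t]

end NonLife

end

/-! ### Preliminaries: Poisson mean, independence of joins, equality of integrals on generators -/

noncomputable section
namespace NonLife

/-! The payment is a sum over policies, so it suffices to value one policy `i` given `otherInfo`:
the reference information up to time ∞ together with everything about the other policies. Marks,
delays and developments are independent of all that precedes them, and the accident times are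
conditionally independent, so even under this large conditioning the survival probability of the
accident time is `exp (-Γ)` (`IsReducedForm.measure_accident_otherInfo`). Convolution with the delay
law gives the conditional law of the report time. Its density and tail come from the fundamental
theorem of calculus for the absolutely continuous function `exp (-Γ)` and from Tonelli
(`IsSumLaw.integral_reportRate`, `IsSumLaw.measureReal_Ioi`).

Now let the policy's own observations up to time `t` be known as well. If the claim is reported,
independent increments and independent marks show that the later developments pay at mean rate `λ m`
per unit of time, whatever has been observed; this is Campbell's formula relative to the past
(`IsMarkedPoisson.setLIntegral_tsum`). If the claim is not reported, all its counts vanish, so the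
policy reveals only the event that its report time exceeds `t`, and the value is the quotient of the
expected payment on this event by its conditional probability (`setLIntegral_payAfter`).

These values depend on the whole future of the reference information. The return to `𝓕 t` is an
immersion property: past accidents and all claim data tell no more about `𝓕_∞` than `𝓕 t` does
(`IsReducedForm.setLIntegral_condLExp_pastInfo`). Dually, the probability of not being reported at
`t` is the same given `𝓕_∞` and given `𝓕 t`, so the denominator leaves the conditional expectation
(`IsReportModel.condLExp_pendingValue`).

If the index itself is traded, domination turns the local martingale `I / S*` into a martingale, and
Fubini evaluates the conditional expectation of its time integral.

Almost everything is done with `[0, ∞]`-valued integrals, where no integrability has to be carried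
along; real-valued conditional expectations enter only at the end. -/

theorem lintegral_natCast_poissonMeasure (r : ℝ≥0) :
    ∫⁻ n, (n : ℝ≥0∞) ∂poissonMeasure r = r := by
  -- The weights satisfy `(k + 1) p_{k+1} = r p_k`, so after an index shift the mean is `r` times
  -- the total mass.
  have h : ∀ k : ℕ, ENNReal.ofReal (Real.exp (-r) * r ^ (k + 1) / (k + 1).factorial) * (k + 1 : ℕ)
      = r * ENNReal.ofReal (Real.exp (-r) * r ^ k / k.factorial) := by
    intro k
    rw [← ENNReal.ofReal_natCast, ← ENNReal.ofReal_coe_nnreal, ← ENNReal.ofReal_mul (by positivity),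
      ← ENNReal.ofReal_mul (by positivity)]
    congr 1
    rw [Nat.factorial_succ]
    push_cast
    field_simp
    ring
  have h1 : ∑' k : ℕ, ENNReal.ofReal (Real.exp (-r) * r ^ k / k.factorial) = 1 := by
    have hs := hasSum_one_poissonMeasure r
    rw [← ENNReal.ofReal_tsum_of_nonneg (fun _ => by positivity) hs.summable, hs.tsum_eq]
    simp
  rw [poissonMeasure, lintegral_sum_measure]
  simp only [lintegral_smul_measure, lintegral_dirac, smul_eq_mul]
  rw [tsum_eq_zero_add' ENNReal.summable]
  simp_rw [h]
  rw [ENNReal.tsum_mul_left, h1]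
  simp

variable {Ω : Type*} {mΩ : MeasurableSpace Ω} {P : Measure Ω}

theorem isPiSystem_image2_inter {S T : Set (Set Ω)} (hS : IsPiSystem S) (hT : IsPiSystem T) :
    IsPiSystem (Set.image2 (· ∩ ·) S T) := by
  rintro _ ⟨a, ha, b, hb, rfl⟩ _ ⟨c, hc, d, hd, rfl⟩ hne
  have he : a ∩ b ∩ (c ∩ d) = (a ∩ c) ∩ (b ∩ d) := Set.inter_inter_inter_comm a b c d
  simp only at hne ⊢
  rw [he] at hne ⊢
  exact ⟨_, hS a ha c hc hne.left, _, hT b hb d hd hne.right, rfl⟩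

theorem generateFrom_image2_inter {S T : Set (Set Ω)} (hS : Set.univ ∈ S) (hT : Set.univ ∈ T) :
    MeasurableSpace.generateFrom (Set.image2 (· ∩ ·) S T)
      = MeasurableSpace.generateFrom S ⊔ MeasurableSpace.generateFrom T := by
  apply le_antisymm
  · refine MeasurableSpace.generateFrom_le ?_
    rintro _ ⟨a, ha, b, hb, rfl⟩
    refine MeasurableSet.inter ?_ ?_
    · exact (le_sup_left : _ ≤ MeasurableSpace.generateFrom S ⊔ MeasurableSpace.generateFrom T) _
        (MeasurableSpace.measurableSet_generateFrom ha)
    · exact (le_sup_right : _ ≤ MeasurableSpace.generateFrom S ⊔ MeasurableSpace.generateFrom T) _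
        (MeasurableSpace.measurableSet_generateFrom hb)
  · refine sup_le (MeasurableSpace.generateFrom_mono ?_) (MeasurableSpace.generateFrom_mono ?_)
    · exact fun a ha => ⟨a, ha, _, hT, Set.inter_univ a⟩
    · exact fun a ha => ⟨_, hS, a, ha, Set.univ_inter a⟩

theorem generateFrom_measurableSet_image2_inter (m₁ m₂ : MeasurableSpace Ω) :
    m₁ ⊔ m₂ = MeasurableSpace.generateFrom
      (Set.image2 (· ∩ ·) {s | MeasurableSet[m₁] s} {s | MeasurableSet[m₂] s}) := by
  rw [generateFrom_image2_inter (S := {s | MeasurableSet[m₁] s}) (T := {s | MeasurableSet[m₂] s})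
    (@MeasurableSet.univ _ m₁) (@MeasurableSet.univ _ m₂),
    @MeasurableSpace.generateFrom_measurableSet _ m₁,
    @MeasurableSpace.generateFrom_measurableSet _ m₂]

/-- On generators, `P(a ∩ b ∩ d) = P(a ∩ b) P(d) = P(a) P(b) P(d) = P(a) P(b ∩ d)`. The model
assumes independence of each new layer from all earlier ones; repeated use of this rule turns that
into independence of any one ingredient from all the others. -/
theorem _root_.ProbabilityTheory.Indep.sup_right [IsZeroOrProbabilityMeasure P]
    {A B D : MeasurableSpace Ω} (hA : A ≤ mΩ) (hB : B ≤ mΩ) (hD : D ≤ mΩ)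
    (h₁ : Indep A B P) (h₂ : Indep (A ⊔ B) D P) : Indep A (B ⊔ D) P := by
  refine IndepSets.indep hA (sup_le hB hD) (@MeasurableSpace.isPiSystem_measurableSet _ A)
    (isPiSystem_image2_inter (@MeasurableSpace.isPiSystem_measurableSet _ B)
      (@MeasurableSpace.isPiSystem_measurableSet _ D))
    (@MeasurableSpace.generateFrom_measurableSet _ A).symm
    (generateFrom_measurableSet_image2_inter B D) ?_
  rw [IndepSets_iff]
  rintro a _ ha ⟨b, hb, d, hd, rfl⟩
  rw [Indep_iff] at h₁ h₂
  have ha' : MeasurableSet[A ⊔ B] a := le_sup_left (a := A) _ ha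
  have hb' : MeasurableSet[A ⊔ B] b := le_sup_right (a := A) _ hb
  simp only [← Set.inter_assoc]
  rw [h₂ _ _ (ha'.inter hb') hd, h₂ _ _ hb' hd, h₁ _ _ ha hb, mul_assoc]

theorem _root_.ProbabilityTheory.IndepFun.prodMk_right [IsProbabilityMeasure P]
    {α β γ : Type*} [MeasurableSpace α] [MeasurableSpace β] [MeasurableSpace γ]
    {X : Ω → α} {Y : Ω → β} {Z : Ω → γ} (hX : Measurable X) (hY : Measurable Y) (hZ : Measurable Z)
    (h₁ : IndepFun X Y P) (h₂ : IndepFun (fun ω => (X ω, Y ω)) Z P) :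
    IndepFun X (fun ω => (Y ω, Z ω)) P := by
  rw [IndepFun_iff_Indep] at *
  have e : MeasurableSpace.comap (fun ω => (X ω, Y ω)) inferInstance
      = MeasurableSpace.comap X inferInstance ⊔ MeasurableSpace.comap Y inferInstance :=
    MeasurableSpace.comap_prodMk X Y
  have e' : MeasurableSpace.comap (fun ω => (Y ω, Z ω)) inferInstance
      = MeasurableSpace.comap Y inferInstance ⊔ MeasurableSpace.comap Z inferInstance :=
    MeasurableSpace.comap_prodMk Y Z
  erw [e] at h₂
  erw [e']
  exact Indep.sup_right hX.comap_le hY.comap_le hZ.comap_le h₁ h₂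

theorem _root_.ProbabilityTheory.IndepFun.lintegral_comp [IsProbabilityMeasure P]
    {α β : Type*} [MeasurableSpace α] [MeasurableSpace β]
    {X : Ω → α} {Y : Ω → β} (hX : Measurable X) (hY : Measurable Y) (h : IndepFun X Y P)
    {F : α × β → ℝ≥0∞} (hF : Measurable F) :
    ∫⁻ ω, F (X ω, Y ω) ∂P = ∫⁻ ω, ∫⁻ ω', F (X ω, Y ω') ∂P ∂P := by
  have hm := (indepFun_iff_map_prod_eq_prod_map_map hX.aemeasurable hY.aemeasurable).1 h
  have : IsProbabilityMeasure (P.map Y) := Measure.isProbabilityMeasure_map hY.aemeasurable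
  rw [← lintegral_map hF (hX.prodMk hY), hm, lintegral_prod _ hF.aemeasurable,
    lintegral_map hF.lintegral_prod_right' hX]
  refine lintegral_congr fun ω => ?_
  have hFω : Measurable fun y => F (X ω, y) := hF.comp measurable_prodMk_left
  rw [lintegral_map hFω hY]

/-- Both integrals are measures in `A`, the one of `W` being finite, and they agree on a π-system
generating `m₁ ⊔ m₂`. Candidate values are checked through this lemma, with one generator for the
other information and one for the policy at hand. -/
theorem setLIntegral_eq_of_generateFrom_inter {S T : Set (Set Ω)} {m₁ m₂ : MeasurableSpace Ω}
    (hm₁ : m₁ = MeasurableSpace.generateFrom S) (hm₂ : m₂ = MeasurableSpace.generateFrom T)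
    (h₁ : m₁ ≤ mΩ) (h₂ : m₂ ≤ mΩ)
    (hS : IsPiSystem S) (hT : IsPiSystem T) (huS : Set.univ ∈ S) (huT : Set.univ ∈ T)
    {W V : Ω → ℝ≥0∞} (hW : ∫⁻ ω, W ω ∂P ≠ ∞)
    (h : ∀ s ∈ S, ∀ t ∈ T, ∫⁻ ω in s ∩ t, W ω ∂P = ∫⁻ ω in s ∩ t, V ω ∂P)
    {A : Set Ω} (hA : MeasurableSet[m₁ ⊔ m₂] A) :
    ∫⁻ ω in A, W ω ∂P = ∫⁻ ω in A, V ω ∂P := by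
  have hle : m₁ ⊔ m₂ ≤ mΩ := sup_le h₁ h₂
  have hval : ∀ (U : Ω → ℝ≥0∞) (B : Set Ω), MeasurableSet[m₁ ⊔ m₂] B →
      ((P.withDensity U).trim hle) B = ∫⁻ ω in B, U ω ∂P := fun U B hB => by
    rw [trim_measurableSet_eq hle hB, withDensity_apply _ (hle _ hB)]
  have hfin : IsFiniteMeasure (P.withDensity W) := isFiniteMeasure_withDensity hW
  have hmem : ∀ s ∈ Set.image2 (· ∩ ·) S T, MeasurableSet[m₁ ⊔ m₂] s := by
    intro s hs
    rw [hm₁, hm₂, ← generateFrom_image2_inter huS huT]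
    exact MeasurableSpace.measurableSet_generateFrom hs
  have key : (P.withDensity W).trim hle = (P.withDensity V).trim hle := by
    refine ext_of_generate_finite (m0 := m₁ ⊔ m₂) (Set.image2 (· ∩ ·) S T) ?_
      (isPiSystem_image2_inter hS hT) ?_ ?_
    · rw [hm₁, hm₂, generateFrom_image2_inter huS huT]
    · intro s hs
      rw [hval _ _ (hmem s hs), hval _ _ (hmem s hs)]
      obtain ⟨a, ha, b, hb, rfl⟩ := hs
      exact h a ha b hb
    · rw [hval _ _ (@MeasurableSet.univ _ (m₁ ⊔ m₂)), hval _ _ (@MeasurableSet.univ _ (m₁ ⊔ m₂))]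
      simpa using h _ huS _ huT
  rw [← hval W A hA, ← hval V A hA, key]

end NonLife
end

/-! ### Marked Poisson processes: times expressed through counts -/

noncomputable section
namespace NonLife

variable {Ω : Type*} {mΩ : MeasurableSpace Ω} {P : Measure Ω}

/-- The points `σ j` with marks `Y j` form, on `[0, T]`, a marked Poisson process with i.i.d.
marks of mean `M`. -/
structure IsMarkedPoisson (P : Measure Ω) (σ : ℕ → Ω → ℝ≥0∞) (Y : ℕ → Ω → ℝ≥0) (rate T : ℝ≥0)
    (M : ℝ≥0∞) : Prop where
  measurable_time : ∀ j, Measurable (σ j)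
  measurable_mark : ∀ j, Measurable (Y j)
  mono : ∀ᵐ ω ∂P, Monotone fun j => σ j ω
  tendsto : ∀ᵐ ω ∂P, Tendsto (fun j => σ j ω) atTop (𝓝 ∞)
  poisson : IsPoissonUpTo P (fun t ω => {j : ℕ | σ j ω ≤ t}.ncard) rate T
  mark_iIndep : iIndepFun Y P
  indep : IndepFun (fun ω j => Y j ω)
    (fun ω (t : Set.Iic T) => {j : ℕ | σ j ω ≤ (t : ℝ≥0)}.ncard) P
  mean : ∀ j, ∫⁻ ω, (Y j ω : ℝ≥0∞) ∂P = M

/-- The number of points up to time `t`, with values in `[0, ∞]`. -/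
def pointCount (σ : ℕ → Ω → ℝ≥0∞) (t : ℝ≥0) (ω : Ω) : ℝ≥0∞ :=
  ∑' j, {ω | σ j ω ≤ t}.indicator (fun _ => (1 : ℝ≥0∞)) ω

/-- The number of points up to time `t` with mark in `B`, with values in `[0, ∞]`. -/
def markCount (σ : ℕ → Ω → ℝ≥0∞) (Y : ℕ → Ω → ℝ≥0) (t : ℝ≥0) (B : Set ℝ≥0) (ω : Ω) : ℝ≥0∞ :=
  ∑' j, {ω | σ j ω ≤ t ∧ Y j ω ∈ B}.indicator (fun _ => (1 : ℝ≥0∞)) ω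

/-- A finite lower set is an initial segment. Applied to `{j | σ j ≤ t}` it reads `σ j ≤ t ↔ j < N
t`, so events about the times become events about the counts, which is what the Poisson and
independence assumptions speak of. Finiteness matters because `ncard` of an infinite set is `0`. -/
theorem mem_iff_lt_ncard {S : Set ℕ} (hf : S.Finite) (hS : IsLowerSet S) (j : ℕ) :
    j ∈ S ↔ j < S.ncard := by
  classical
  have hex : ∃ k, k ∉ S := by
    by_contra! h
    exact Set.infinite_univ (hf.subset fun x _ => h x)
  have hSk : S = Set.Iio (Nat.find hex) := by
    ext i
    refine ⟨fun hi => ?_, fun hi => by simpa using Nat.find_min hex hi⟩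
    by_contra hlt
    exact Nat.find_spec hex (hS (not_lt.1 hlt) hi)
  rw [hSk]
  simp

theorem tsum_ite_lt_natCast (N : ℕ) : ∑' j : ℕ, (if j < N then (1 : ℝ≥0∞) else 0) = N := by
  rw [tsum_eq_sum (s := Finset.range N) (fun b hb => by simpa using hb)]
  rw [Finset.sum_congr rfl (g := fun _ => (1 : ℝ≥0∞)) (fun x hx => by simpa using hx)]
  simp

/-- Independent increments are available along monotone sequences of times. Finitely many past times
are therefore threaded into one such sequence, which starts at `0` and has `(a, b]` as the step
after index `K`. -/
theorem exists_monotone_enumeration (F : Finset ℝ≥0) {a b : ℝ≥0} (hF : ∀ x ∈ F, x ≤ a)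
    (hab : a ≤ b) : ∃ (t : ℕ → ℝ≥0) (K : ℕ), Monotone t ∧ t 0 = 0 ∧ t K = a ∧ t (K + 1) = b ∧
      ∀ x ∈ F, ∃ k ≤ K, t k = x := by
  classical
  induction F using Finset.induction_on_max generalizing a b with
  | empty =>
    refine ⟨fun k => if k = 0 then 0 else if k = 1 then a else b, 1, ?_, by simp, by simp, by simp,
      by simp⟩
    intro i j hij
    dsimp only
    split_ifs <;> first | omega | simp
  | insert x F hx ih =>
    -- The inductive sequence stands at the maximum `x` at index `K`; its values from `K + 1` on are
    -- then replaced by `a`, followed by `b`.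
    obtain ⟨t, K, ht, h0, hK, -, hmem⟩ := ih (a := x) (b := x) (fun y hy => (hx y hy).le) le_rfl
    refine ⟨fun k => if k ≤ K then t k else if k = K + 1 then a else b, K + 1, ?_, by simp [h0],
      by simp, by simp, ?_⟩
    · have hxa : x ≤ a := hF x (by simp)
      intro i j hij
      dsimp only
      split_ifs with h1 h2 h3 h4 h5 <;> first
        | omega | exact ht hij | exact ((ht h1).trans hK.le).trans hxa
        | exact (((ht h1).trans hK.le).trans hxa).trans hab | exact hab | exact le_rfl
    · intro y hy
      rcases Finset.mem_insert.1 hy with rfl | hy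
      · exact ⟨K, by omega, by simp [hK]⟩
      · obtain ⟨k, hk, rfl⟩ := hmem y hy
        exact ⟨k, by omega, by simp [hk]⟩

namespace IsMarkedPoisson

variable {σ : ℕ → Ω → ℝ≥0∞} {Y : ℕ → Ω → ℝ≥0} {rate T : ℝ≥0} {M : ℝ≥0∞}

theorem ae_le_iff (h : IsMarkedPoisson P σ Y rate T M) :
    ∀ᵐ ω ∂P, ∀ (t : ℝ≥0) (j : ℕ), σ j ω ≤ t ↔ j < {j : ℕ | σ j ω ≤ t}.ncard := by
  filter_upwards [h.mono, h.tendsto] with ω hm ht t j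
  refine mem_iff_lt_ncard (S := {j : ℕ | σ j ω ≤ t}) ?_ (fun i k hik hi => (hm hik).trans hi) j
  have hev : ∀ᶠ j in atTop, (t : ℝ≥0∞) < σ j ω := ht.eventually (lt_mem_nhds ENNReal.coe_lt_top)
  obtain ⟨k, hk⟩ := eventually_atTop.1 hev
  refine (Set.finite_Iio k).subset fun i hi => ?_
  by_contra hki
  exact absurd (hk i (not_lt.1 hki)) (not_lt.2 hi)

theorem ae_pointCount_eq (h : IsMarkedPoisson P σ Y rate T M) :
    ∀ᵐ ω ∂P, ∀ t : ℝ≥0, pointCount σ t ω = ({j : ℕ | σ j ω ≤ t}.ncard : ℝ≥0∞) := by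
  filter_upwards [h.ae_le_iff] with ω hω t
  rw [← tsum_ite_lt_natCast]
  refine tsum_congr fun j => ?_
  by_cases hj : σ j ω ≤ t
  · rw [Set.indicator_of_mem (show ω ∈ {ω | σ j ω ≤ t} from hj), if_pos ((hω t j).1 hj)]
  · rw [Set.indicator_of_notMem (show ω ∉ {ω | σ j ω ≤ t} from hj),
      if_neg (fun hlt => hj ((hω t j).2 hlt))]

theorem ae_le_iff_pointCount (h : IsMarkedPoisson P σ Y rate T M) :
    ∀ᵐ ω ∂P, ∀ (t : ℝ≥0) (j : ℕ), σ j ω ≤ t ↔ (j : ℝ≥0∞) < pointCount σ t ω := by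
  filter_upwards [h.ae_le_iff, h.ae_pointCount_eq] with ω h1 h2 t j
  rw [h1, h2, Nat.cast_lt]

theorem measurable_pointCount (h : IsMarkedPoisson P σ Y rate T M) (t : ℝ≥0) :
    Measurable (pointCount σ t) :=
  Measurable.tsum fun j =>
    measurable_const.indicator (measurableSet_le (h.measurable_time j) measurable_const)

theorem measurable_markCount (h : IsMarkedPoisson P σ Y rate T M) (t : ℝ≥0) {B : Set ℝ≥0}
    (hB : MeasurableSet B) : Measurable (markCount σ Y t B) :=
  Measurable.tsum fun j => measurable_const.indicator
    ((measurableSet_le (h.measurable_time j) measurable_const).inter (h.measurable_mark j hB))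

theorem indepFun_mark_pointCount (h : IsMarkedPoisson P σ Y rate T M) {κ : Type*} {u : κ → ℝ≥0}
    (hu : ∀ k, u k ≤ T) : IndepFun (fun ω j => Y j ω) (fun ω k => pointCount σ (u k) ω) P := by
  have h1 := h.indep.comp (φ := id)
    (ψ := fun (x : Set.Iic T → ℕ) (k : κ) => ((x ⟨u k, hu k⟩ : ℕ) : ℝ≥0∞)) measurable_id
    (measurable_pi_lambda _ fun k =>
      (Measurable.of_discrete (f := fun n : ℕ => (n : ℝ≥0∞))).comp (measurable_pi_apply _))
  refine h1.congr (ae_eq_refl _) ?_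
  filter_upwards [h.ae_pointCount_eq] with ω hω
  funext k
  simp [hω]

/-- Each past count is a sum of increments along the enumeration with indices below `K`, and the
increment over `(a, b]` is the one with index `K`. -/
theorem indepFun_pointCount_sub (h : IsMarkedPoisson P σ Y rate T M) {ι : Type*} [Fintype ι]
    {s : ι → ℝ≥0} {a b : ℝ≥0} (hs : ∀ l, s l ≤ a) (hab : a ≤ b) (hb : b ≤ T) :
    IndepFun (fun ω l => pointCount σ (s l) ω)
      (fun ω => pointCount σ b ω - pointCount σ a ω) P := by
  classical
  obtain ⟨t, K, ht, h0, hK, hK1, hmem⟩ :=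
    exists_monotone_enumeration (Finset.univ.image s) (a := a) (b := b) (by simpa using hs) hab
  have hmem' : ∀ l, ∃ k ≤ K, t k = s l := fun l => hmem _ (by simp)
  choose k hkK hk using hmem'
  set N : ℝ≥0 → Ω → ℕ := fun t ω => {j : ℕ | σ j ω ≤ t}.ncard with hN
  have hle : ∀ i ≤ K + 1, t i ≤ T := fun i hi => ((ht hi).trans hK1.le).trans hb
  have hind := h.poisson.indep.nat ht
  have hfin : IndepFun
      (fun ω (i : Finset.range K) => N (min (t (i + 1)) T) ω - N (min (t i) T) ω)
      (fun ω (i : ({K} : Finset ℕ)) => N (min (t (i + 1)) T) ω - N (min (t i) T) ω) P := by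
    refine hind.indepFun_finset₀ _ _ (by simp) fun i => ?_
    have hl := (h.poisson.law (min (t i) T) (min (t (i + 1)) T)
      (min_le_min_right _ (ht (Nat.le_succ i))) (min_le_right _ _)).aemeasurable
    exact hl
  have h2 := hfin.comp
    (φ := fun x l => ∑ i : Finset.range K, if (i : ℕ) < k l then ((x i : ℕ) : ℝ≥0∞) else 0)
    (ψ := fun x : ({K} : Finset ℕ) → ℕ =>
      ((x ⟨K, Finset.mem_singleton_self K⟩ : ℕ) : ℝ≥0∞))
    (by
      refine measurable_pi_lambda _ fun l => Finset.measurable_sum _ fun i _ => ?_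
      by_cases hi : (i : ℕ) < k l
      · simp only [hi, if_true]
        exact (Measurable.of_discrete (f := fun n : ℕ => (n : ℝ≥0∞))).comp (measurable_pi_apply i)
      · simp only [hi, if_false]; fun_prop)
    ((Measurable.of_discrete (f := fun n : ℕ => (n : ℝ≥0∞))).comp (measurable_pi_apply
      (⟨K, Finset.mem_singleton_self K⟩ : ({K} : Finset ℕ))))
  -- The increments are truncated differences in `ℕ`, so the telescoping below needs monotone
  -- counts.
  have hNmono : ∀ᵐ ω ∂P, Monotone fun t => N t ω := by
    filter_upwards [h.ae_le_iff] with ω hω u v huv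
    by_contra hlt
    have hlt : N v ω < N u ω := not_le.1 hlt
    have h3 : σ (N v ω) ω ≤ u := (hω u _).2 hlt
    have h4 := (hω v _).1 (h3.trans (by exact_mod_cast huv))
    exact lt_irrefl _ h4
  refine h2.congr ?_ ?_
  · filter_upwards [h.ae_pointCount_eq, hNmono, h.poisson.zero] with ω hω hm hz
    funext l
    simp only [Function.comp]
    rw [Finset.sum_coe_sort (Finset.range K) (fun i => if i < k l then
      ((N (min (t (i + 1)) T) ω - N (min (t i) T) ω : ℕ) : ℝ≥0∞) else 0), ← Finset.sum_filter]
    have hfil : (Finset.range K).filter (· < k l) = Finset.range (k l) := by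
      ext i; have := hkK l; simp; omega
    rw [hfil, hω, ← hk l]
    rw [← Nat.cast_sum]
    congr 1
    rw [Finset.sum_congr rfl (g := fun i => N (t (i + 1)) ω - N (t i) ω)]
    · rw [Finset.sum_range_tsub (f := fun i => N (t i) ω) (fun i j hij => hm (ht hij)), h0]
      simp only [hN] at hz ⊢
      rw [hz, Nat.sub_zero]
    · intro i hi
      have := hkK l
      have hi' := Finset.mem_range.1 hi
      rw [min_eq_left (hle (i + 1) (by omega)), min_eq_left (hle i (by omega))]
  · filter_upwards [h.ae_pointCount_eq] with ω hω
    simp only [Function.comp]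
    rw [hω, hω, ← ENNReal.natCast_sub, min_eq_left (hle (K + 1) le_rfl), min_eq_left
        (hle K (by omega)),
      hK, hK1]

theorem lintegral_pointCount_sub (h : IsMarkedPoisson P σ Y rate T M) {a b : ℝ≥0} (hab : a ≤ b)
    (hb : b ≤ T) : ∫⁻ ω, (pointCount σ b ω - pointCount σ a ω) ∂P = rate * (b - a : ℝ≥0) := by
  have hl := h.poisson.law a b hab hb
  rw [← ENNReal.coe_mul, ← lintegral_natCast_poissonMeasure, ← hl.map_eq,
    lintegral_map' (by fun_prop) hl.aemeasurable]
  refine lintegral_congr_ae ?_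
  filter_upwards [h.ae_pointCount_eq] with ω hω
  rw [hω, hω, ENNReal.natCast_sub]

end IsMarkedPoisson
end NonLife
end

/-! ### Campbell's formula relative to the past -/

noncomputable section
namespace NonLife

variable {Ω : Type*} {mΩ : MeasurableSpace Ω} {P : Measure Ω}

namespace IsMarkedPoisson

variable {σ : ℕ → Ω → ℝ≥0∞} {Y : ℕ → Ω → ℝ≥0} {rate T : ℝ≥0} {M : ℝ≥0∞}

/-- The mark counts are functionals of the point counts and the mark sequence, two objects that are
independent of each other. -/
theorem ae_markCount_eq (h : IsMarkedPoisson P σ Y rate T M) :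
    ∀ᵐ ω ∂P, ∀ (t : ℝ≥0) (B : Set ℝ≥0), markCount σ Y t B ω
      = ∑' j : ℕ, if (j : ℝ≥0∞) < pointCount σ t ω then B.indicator (fun _ => 1) (Y j ω) else 0 :=
          by
  classical
  filter_upwards [h.ae_le_iff_pointCount] with ω hω t B
  refine tsum_congr fun j => ?_
  simp only [Set.indicator_apply]
  have : (ω ∈ {ω | σ j ω ≤ t ∧ Y j ω ∈ B}) ↔ (j : ℝ≥0∞) < pointCount σ t ω ∧ Y j ω ∈ B := by
    rw [← hω]; rfl
  simp only [this]
  split_ifs <;> tauto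

theorem ae_tsum_indicator_Ioc (h : IsMarkedPoisson P σ Y rate T M) {a b : ℝ≥0} (hab : a ≤ b) :
    ∀ᵐ ω ∂P, ∑' j, {ω | (a : ℝ≥0∞) < σ j ω ∧ σ j ω ≤ b}.indicator (fun _ => (1 : ℝ≥0∞)) ω
      = pointCount σ b ω - pointCount σ a ω := by
  classical
  filter_upwards [h.ae_pointCount_eq] with ω hω
  refine (ENNReal.sub_eq_of_eq_add_rev (by rw [hω]; exact ENNReal.natCast_ne_top _) ?_).symm
  rw [pointCount, pointCount, ← ENNReal.tsum_add]
  refine tsum_congr fun j => ?_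
  have hab' : (a : ℝ≥0∞) ≤ b := by exact_mod_cast hab
  have e1 : (ω ∈ {ω | σ j ω ≤ b}) ↔ σ j ω ≤ b := Iff.rfl
  have e2 : (ω ∈ {ω | σ j ω ≤ a}) ↔ σ j ω ≤ a := Iff.rfl
  have e3 : (ω ∈ {ω | (a : ℝ≥0∞) < σ j ω ∧ σ j ω ≤ b}) ↔ a < σ j ω ∧ σ j ω ≤ b := Iff.rfl
  simp only [Set.indicator_apply, e1, e2, e3]
  rcases le_or_gt (σ j ω) a with h1 | h1
  · simp [h1, h1.trans hab', not_lt.2 h1]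
  · simp [h1, not_le.2 h1]

variable [IsProbabilityMeasure P] {ι : Type*}

/-- The event `a < σ j ≤ b` is `N a ≤ j < N b`, and on it the mark counts up to times at most `a`
involve only the marks before the `j`-th. So the integration set together with this event is
determined by earlier marks and counts, which are jointly independent of `Y j`, and the mark may be
replaced by its mean. -/
theorem setLIntegral_mark (h : IsMarkedPoisson P σ Y rate T M)
    {s : ι → ℝ≥0} {B : ι → Set ℝ≥0} (hB : ∀ l, MeasurableSet (B l)) {E : Set (ι → ℝ≥0∞)}
    (hE : MeasurableSet E) {a b : ℝ≥0} (hs : ∀ l, s l ≤ a) (hab : a ≤ b) (hb : b ≤ T) (j : ℕ) :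
    ∫⁻ ω in {ω | (fun l => markCount σ Y (s l) (B l) ω) ∈ E},
        {ω | (a : ℝ≥0∞) < σ j ω ∧ σ j ω ≤ b}.indicator (fun _ => (1 : ℝ≥0∞)) ω * Y j ω ∂P
      = M * ∫⁻ ω in {ω | (fun l => markCount σ Y (s l) (B l) ω) ∈ E},
        {ω | (a : ℝ≥0∞) < σ j ω ∧ σ j ω ≤ b}.indicator (fun _ => (1 : ℝ≥0∞)) ω ∂P := by
  classical
  let H : Set Ω := {ω | (fun l => markCount σ Y (s l) (B l) ω) ∈ E}
  have hH : MeasurableSet H :=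
    (measurable_pi_lambda _ fun l => h.measurable_markCount (s l) (hB l)) hE
  let u : ι ⊕ Bool → ℝ≥0 := Sum.elim s fun c => if c then b else a
  have hu : ∀ k, u k ≤ T := by
    rintro (l | c)
    · exact ((hs l).trans hab).trans hb
    · rcases c with - | -
      · exact hab.trans hb
      · exact hb
  -- a functional of the earlier marks and the counts
  let G : (Finset.range j → ℝ≥0) × (ι ⊕ Bool → ℝ≥0∞) → ι → ℝ≥0∞ := fun x l =>
    ∑ i : Finset.range j, if ((i : ℕ) : ℝ≥0∞) < x.2 (Sum.inl l) then
      (B l).indicator (fun _ => 1) (x.1 i) else 0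
  have hG : Measurable G := by
    refine measurable_pi_lambda _ fun l => Finset.measurable_sum _ fun i _ => ?_
    refine Measurable.ite (measurableSet_lt measurable_const (by fun_prop)) ?_ measurable_const
    exact (measurable_const.indicator (hB l)).comp ((measurable_pi_apply i).comp measurable_fst)
  let Φ : (Finset.range j → ℝ≥0) × (ι ⊕ Bool → ℝ≥0∞) → ℝ≥0∞ :=
    {x | x.2 (Sum.inr false) ≤ (j : ℝ≥0∞) ∧ (j : ℝ≥0∞) < x.2 (Sum.inr true) ∧ G x ∈ E}.indicator 1
  have hΦ : Measurable Φ := by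
    refine measurable_one.indicator ?_
    refine MeasurableSet.inter (measurableSet_le ((measurable_pi_apply _).comp measurable_snd)
      measurable_const) ?_
    exact MeasurableSet.inter (measurableSet_lt measurable_const
      ((measurable_pi_apply _).comp measurable_snd)) (hG hE)
  let L : Ω → (Finset.range j → ℝ≥0) × (ι ⊕ Bool → ℝ≥0∞) := fun ω =>
    (fun i => Y i ω, fun k => pointCount σ (u k) ω)
  have hL1 : Measurable fun ω => (fun i : Finset.range j => Y i ω) :=
    measurable_pi_lambda _ fun i => h.measurable_mark i
  have hL2 : Measurable fun ω => (fun k => pointCount σ (u k) ω) :=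
    measurable_pi_lambda _ fun k => h.measurable_pointCount (u k)
  have hL : Measurable L := hL1.prodMk hL2
  have hY : Measurable fun ω => (Y j ω : ℝ≥0∞) := (h.measurable_mark j).coe_nnreal_ennreal
  have hind : IndepFun (fun ω => Y j ω) L P := by
    refine IndepFun.prodMk_right (h.measurable_mark j) hL1 hL2 ?_ ?_
    · have := h.mark_iIndep.indepFun_finset {j} (Finset.range j) (by simp) h.measurable_mark
      exact this.comp (φ := fun x : ({j} : Finset ℕ) → ℝ≥0 => x ⟨j, Finset.mem_singleton_self j⟩)
        (measurable_pi_apply _) measurable_id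
    · exact (h.indepFun_mark_pointCount hu).comp
        (φ := fun y : ℕ → ℝ≥0 => (y j, fun i : Finset.range j => y i)) (by fun_prop) measurable_id
  have hkey : ∀ᵐ ω ∂P, H.indicator
      ({ω | (a : ℝ≥0∞) < σ j ω ∧ σ j ω ≤ b}.indicator (fun _ => (1 : ℝ≥0∞))) ω = Φ (L ω) := by
    have hab' : (a : ℝ≥0∞) ≤ b := by exact_mod_cast hab
    filter_upwards [h.ae_le_iff_pointCount, h.ae_markCount_eq] with ω h1 h2
    have hmem : (ω ∈ H ∩ {ω | (a : ℝ≥0∞) < σ j ω ∧ σ j ω ≤ b}) ↔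
        L ω ∈ {x | x.2 (Sum.inr false) ≤ (j : ℝ≥0∞) ∧ (j : ℝ≥0∞) < x.2 (Sum.inr true) ∧ G x ∈ E} :=
            by
      -- If point `j` comes after `a`, no point with index at least `j` has occurred by `s l ≤ a`,
      -- so the series stops before `j`.
      have hGE : (a : ℝ≥0∞) < σ j ω → (fun l => markCount σ Y (s l) (B l) ω) = G (L ω) := by
        intro haj
        funext l
        rw [h2]
        have hz : ∀ i ∉ Finset.range j, (if (i : ℝ≥0∞) < pointCount σ (s l) ω then
            (B l).indicator (fun _ => (1 : ℝ≥0∞)) (Y i ω) else 0) = 0 := by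
          intro i hi
          refine if_neg fun hlt => ?_
          have h3 : σ i ω ≤ s l := (h1 _ _).2 hlt
          have h4 : (j : ℝ≥0∞) < pointCount σ a ω := by
            refine lt_of_le_of_lt (b := (i : ℝ≥0∞)) ?_ ((h1 _ _).1 (h3.trans ?_))
            · exact_mod_cast not_lt.1 (fun hij => hi (Finset.mem_range.2 hij))
            · exact_mod_cast hs l
          exact absurd ((h1 _ _).2 h4) (not_le.2 haj)
        rw [tsum_eq_sum hz, ← Finset.sum_coe_sort]
        rfl
      constructor
      · rintro ⟨hωH, haj, hjb⟩
        refine ⟨?_, (h1 b j).1 hjb, ?_⟩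
        · exact not_lt.1 fun hlt => absurd ((h1 a j).2 hlt) (not_le.2 haj)
        · rw [← hGE haj]; exact hωH
      · rintro ⟨hja, hjb, hωE⟩
        have haj : (a : ℝ≥0∞) < σ j ω := not_le.1 fun hle => absurd ((h1 a j).1 hle) (not_lt.2 hja)
        refine ⟨?_, haj, (h1 b j).2 hjb⟩
        change (fun l => markCount σ Y (s l) (B l) ω) ∈ E
        rw [hGE haj]; exact hωE
    rw [Set.indicator_indicator]
    by_cases hm : ω ∈ H ∩ {ω | (a : ℝ≥0∞) < σ j ω ∧ σ j ω ≤ b}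
    · rw [Set.indicator_of_mem hm]
      exact (Set.indicator_of_mem (hmem.1 hm) 1).symm
    · rw [Set.indicator_of_notMem hm]
      exact (Set.indicator_of_notMem (fun hL => hm (hmem.2 hL)) 1).symm
  have hI : ∀ f : Ω → ℝ≥0∞, ∫⁻ ω in H, {ω | (a : ℝ≥0∞) < σ j ω ∧ σ j ω ≤ b}.indicator
      (fun _ => (1 : ℝ≥0∞)) ω * f ω ∂P = ∫⁻ ω, Φ (L ω) * f ω ∂P := by
    intro f
    rw [← lintegral_indicator hH]
    refine lintegral_congr_ae ?_
    filter_upwards [hkey] with ω hω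
    rw [← hω]
    by_cases hm : ω ∈ H <;> simp [hm]
  have hI1 := hI fun _ => 1
  simp only [mul_one] at hI1
  rw [hI, hI1, ← h.mean j, mul_comm]
  exact lintegral_mul_eq_lintegral_mul_lintegral_of_indepFun (hΦ.comp hL) hY
    (hind.comp measurable_coe_nnreal_ennreal hΦ).symm

/-- Once the marks are replaced by their mean, the number of points in `(a, b]` remains. It is
independent of the conditioning event, and its mean is the rate times the length. -/
theorem setLIntegral_tsum_mark [Fintype ι] (h : IsMarkedPoisson P σ Y rate T M)
    {s : ι → ℝ≥0} {B : ι → Set ℝ≥0} (hB : ∀ l, MeasurableSet (B l)) {E : Set (ι → ℝ≥0∞)}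
    (hE : MeasurableSet E) {a b : ℝ≥0} (hs : ∀ l, s l ≤ a) (hab : a ≤ b) (hb : b ≤ T) :
    ∫⁻ ω in {ω | (fun l => markCount σ Y (s l) (B l) ω) ∈ E},
        ∑' j, {ω | (a : ℝ≥0∞) < σ j ω ∧ σ j ω ≤ b}.indicator (fun _ => (1 : ℝ≥0∞)) ω * Y j ω ∂P
      = P {ω | (fun l => markCount σ Y (s l) (B l) ω) ∈ E} * (M * rate * (b - a : ℝ≥0)) := by
  classical
  set H : Set Ω := {ω | (fun l => markCount σ Y (s l) (B l) ω) ∈ E} with hHdef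
  have hH : MeasurableSet H :=
    (measurable_pi_lambda _ fun l => h.measurable_markCount (s l) (hB l)) hE
  have hmeas : ∀ j, Measurable ({ω | (a : ℝ≥0∞) < σ j ω ∧ σ j ω ≤ b}.indicator
      (fun _ => (1 : ℝ≥0∞))) := fun j => measurable_const.indicator
    ((measurableSet_lt measurable_const (h.measurable_time j)).inter
      (measurableSet_le (h.measurable_time j) measurable_const))
  have hmeasY : ∀ j, Measurable fun ω => {ω | (a : ℝ≥0∞) < σ j ω ∧ σ j ω ≤ b}.indicator
      (fun _ => (1 : ℝ≥0∞)) ω * Y j ω :=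
    fun j => (hmeas j).mul (h.measurable_mark j).coe_nnreal_ennreal
  rw [lintegral_tsum fun j => (hmeasY j).aemeasurable]
  rw [tsum_congr fun j => h.setLIntegral_mark hB hE hs hab hb j, ENNReal.tsum_mul_left,
    ← lintegral_tsum fun j => (hmeas j).aemeasurable]
  have hsub : Measurable fun ω => pointCount σ b ω - pointCount σ a ω :=
    (h.measurable_pointCount b).sub (h.measurable_pointCount a)
  -- the event `H` as a functional of the marks and the counts
  let G : (ι → ℝ≥0∞) × (ℕ → ℝ≥0) → ι → ℝ≥0∞ := fun x l =>
    ∑' i : ℕ, if (i : ℝ≥0∞) < x.1 l then (B l).indicator (fun _ => 1) (x.2 i) else 0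
  have hG : Measurable G := by
    refine measurable_pi_lambda _ fun l => Measurable.tsum fun i => ?_
    refine Measurable.ite (measurableSet_lt measurable_const (by fun_prop)) ?_ measurable_const
    exact (measurable_const.indicator (hB l)).comp (by fun_prop)
  let L : Ω → (ι → ℝ≥0∞) × (ℕ → ℝ≥0) := fun ω =>
    (fun l => pointCount σ (s l) ω, fun i => Y i ω)
  have hL1 : Measurable fun ω => (fun l => pointCount σ (s l) ω) :=
    measurable_pi_lambda _ fun l => h.measurable_pointCount (s l)
  have hL2 : Measurable fun ω => (fun i => Y i ω) :=
    measurable_pi_lambda _ fun i => h.measurable_mark i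
  have hL : Measurable L := hL1.prodMk hL2
  -- The increment is independent of the past counts, and increment and past counts together are
  -- independent of the marks.
  have hind : IndepFun (fun ω => pointCount σ b ω - pointCount σ a ω) L P := by
    refine IndepFun.prodMk_right hsub hL1 hL2 (h.indepFun_pointCount_sub hs hab hb).symm ?_
    let u : ι ⊕ Bool → ℝ≥0 := Sum.elim s fun c => if c then b else a
    have hu : ∀ k, u k ≤ T := by
      rintro (l | c)
      · exact ((hs l).trans hab).trans hb
      · rcases c with - | -
        · exact hab.trans hb
        · exact hb
    exact (h.indepFun_mark_pointCount hu).symm.comp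
      (φ := fun x : ι ⊕ Bool → ℝ≥0∞ =>
        (x (Sum.inr true) - x (Sum.inr false), fun l => x (Sum.inl l)))
      (by fun_prop) measurable_id
  have hkey : ∀ᵐ ω ∂P, H.indicator (fun _ => (1 : ℝ≥0∞)) ω
      = (G ⁻¹' E).indicator (fun _ => (1 : ℝ≥0∞)) (L ω) := by
    filter_upwards [h.ae_markCount_eq] with ω h2
    have : (ω ∈ H) ↔ L ω ∈ G ⁻¹' E := by
      have e : (fun l => markCount σ Y (s l) (B l) ω) = G (L ω) := by
        funext l
        rw [h2]
      rw [Set.mem_preimage, ← e]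
      rfl
    simp only [Set.indicator_apply, this]
  have hEm : Measurable ((G ⁻¹' E).indicator (fun _ => (1 : ℝ≥0∞))) :=
    measurable_const.indicator (hG hE)
  have e1 : ∫⁻ ω in H, ∑' j, {ω | (a : ℝ≥0∞) < σ j ω ∧ σ j ω ≤ b}.indicator
      (fun _ => (1 : ℝ≥0∞)) ω ∂P = ∫⁻ ω, (G ⁻¹' E).indicator (fun _ => (1 : ℝ≥0∞)) (L ω)
        * (pointCount σ b ω - pointCount σ a ω) ∂P := by
    rw [← lintegral_indicator hH]
    refine lintegral_congr_ae ?_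
    filter_upwards [hkey, h.ae_tsum_indicator_Ioc hab] with ω h3 h4
    rw [← h3, ← h4]
    by_cases hm : ω ∈ H <;> simp [hm]
  have e2 : ∫⁻ ω, (G ⁻¹' E).indicator (fun _ => (1 : ℝ≥0∞)) (L ω)
      * (pointCount σ b ω - pointCount σ a ω) ∂P
      = (∫⁻ ω, (G ⁻¹' E).indicator (fun _ => (1 : ℝ≥0∞)) (L ω) ∂P)
        * ∫⁻ ω, (pointCount σ b ω - pointCount σ a ω) ∂P :=
    lintegral_mul_eq_lintegral_mul_lintegral_of_indepFun (hEm.comp hL) hsub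
      (hind.comp measurable_id hEm).symm
  have e3 : ∫⁻ ω, (G ⁻¹' E).indicator (fun _ => (1 : ℝ≥0∞)) (L ω) ∂P = P H := by
    rw [← lintegral_congr_ae hkey, lintegral_indicator hH, setLIntegral_one]
  rw [e1, e2, e3, h.lintegral_pointCount_sub hab hb]
  ring

/-- Campbell's formula for the points in `(a, b]`, given the past up to time `a`. -/
theorem setLIntegral_tsum [Fintype ι] (h : IsMarkedPoisson P σ Y rate T M) (hM : M ≠ ∞)
    {s : ι → ℝ≥0} {B : ι → Set ℝ≥0} (hB : ∀ l, MeasurableSet (B l)) {E : Set (ι → ℝ≥0∞)}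
    (hE : MeasurableSet E) {a b : ℝ≥0} (hs : ∀ l, s l ≤ a) (hab : a ≤ b) (hb : b ≤ T)
    {φ : ℝ → ℝ≥0∞} (hφ : Measurable φ) :
    ∫⁻ ω in {ω | (fun l => markCount σ Y (s l) (B l) ω) ∈ E},
        ∑' j, {ω | (a : ℝ≥0∞) < σ j ω ∧ σ j ω ≤ b}.indicator (fun _ => (1 : ℝ≥0∞)) ω
          * Y j ω * φ (σ j ω).toReal ∂P
      = P {ω | (fun l => markCount σ Y (s l) (B l) ω) ∈ E}
        * (M * rate * ∫⁻ u in Set.Ioc (a : ℝ) b, φ u) := by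
  classical
  set H : Set Ω := {ω | (fun l => markCount σ Y (s l) (B l) ω) ∈ E} with hHdef
  let w : ℕ → Ω → ℝ≥0∞ := fun j ω =>
    {ω | (a : ℝ≥0∞) < σ j ω ∧ σ j ω ≤ b}.indicator (fun _ => (1 : ℝ≥0∞)) ω * Y j ω
  have hw : ∀ j, Measurable (w j) := fun j => (measurable_const.indicator
    ((measurableSet_lt measurable_const (h.measurable_time j)).inter
      (measurableSet_le (h.measurable_time j) measurable_const))).mul
        (h.measurable_mark j).coe_nnreal_ennreal
  have hσ : ∀ j, Measurable fun ω => (σ j ω).toReal := fun j => (h.measurable_time j).ennreal_toReal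
  -- As a functional of `φ` the left side is integration against `ν`. It is enough to know `ν` on
  -- half-lines, and there the formula for constant discounting on `(a, min b x]` applies.
  let ν : Measure ℝ := Measure.sum fun j =>
    ((P.restrict H).withDensity (w j)).map fun ω => (σ j ω).toReal
  have hν : ∀ f : ℝ → ℝ≥0∞, Measurable f →
      ∫⁻ x, f x ∂ν = ∫⁻ ω in H, ∑' j, w j ω * f (σ j ω).toReal ∂P := by
    intro f hf
    have hwf : ∀ j, Measurable fun ω => w j ω * f (σ j ω).toReal :=
      fun j => (hw j).mul (hf.comp (hσ j))
    rw [lintegral_tsum fun j => (hwf j).aemeasurable, lintegral_sum_measure]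
    refine tsum_congr fun j => ?_
    rw [lintegral_map hf (hσ j)]
    exact lintegral_withDensity_eq_lintegral_mul _ (hw j) (hf.comp (hσ j))
  have hνIic : ∀ x : ℝ, ν (Set.Iic x)
      = (P H * (M * rate)) • (volume.restrict (Set.Ioc (a : ℝ) b)) (Set.Iic x) := by
    intro x
    rw [← lintegral_indicator_one measurableSet_Iic, hν _
        (measurable_one.indicator measurableSet_Iic),
      Measure.restrict_apply measurableSet_Iic, Set.inter_comm, Set.Ioc_inter_Iic, Real.volume_Ioc]
    rcases le_or_gt (a : ℝ) x with hax | hax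
    · lift x to ℝ≥0 using a.coe_nonneg.trans hax
      have hax' : a ≤ x := by exact_mod_cast hax
      have := h.setLIntegral_tsum_mark hB hE hs (le_min hab hax') ((min_le_left _ _).trans hb)
      have e : ∀ ω j, w j ω * (Set.Iic (x : ℝ)).indicator 1 (σ j ω).toReal
          = {ω | (a : ℝ≥0∞) < σ j ω ∧ σ j ω ≤ (min b x : ℝ≥0)}.indicator
            (fun _ => (1 : ℝ≥0∞)) ω * Y j ω := by
        intro ω j
        simp only [w]
        by_cases hj : (a : ℝ≥0∞) < σ j ω ∧ σ j ω ≤ b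
        · have hfin : σ j ω ≠ ∞ := (hj.2.trans_lt ENNReal.coe_lt_top).ne
          have hx : (σ j ω).toReal ≤ x ↔ σ j ω ≤ x := by
            rw [← ENNReal.coe_toReal, ENNReal.toReal_le_toReal hfin ENNReal.coe_ne_top]
          by_cases hjx : σ j ω ≤ x
          · rw [Set.indicator_of_mem (show ω ∈ {ω | (a : ℝ≥0∞) < σ j ω ∧ σ j ω ≤ b} from hj),
              Set.indicator_of_mem (show (σ j ω).toReal ∈ Set.Iic (x : ℝ) from hx.2 hjx),
              Set.indicator_of_mem]
            · simp
            · exact ⟨hj.1, by rw [ENNReal.coe_min]; exact le_min hj.2 hjx⟩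
          · rw [Set.indicator_of_notMem (show (σ j ω).toReal ∉ Set.Iic (x : ℝ) from
                fun hh => hjx (hx.1 hh)), Set.indicator_of_notMem (s :=
                {ω | (a : ℝ≥0∞) < σ j ω ∧ σ j ω ≤ (min b x : ℝ≥0)})]
            · simp
            · rintro ⟨-, hh⟩
              rw [ENNReal.coe_min] at hh
              exact hjx (hh.trans (min_le_right _ _))
        · rw [Set.indicator_of_notMem (show ω ∉ {ω | (a : ℝ≥0∞) < σ j ω ∧ σ j ω ≤ b} from hj),
            Set.indicator_of_notMem (s :=
                {ω | (a : ℝ≥0∞) < σ j ω ∧ σ j ω ≤ (min b x : ℝ≥0)})]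
          · simp
          · rintro ⟨h3, h4⟩
            rw [ENNReal.coe_min] at h4
            exact hj ⟨h3, h4.trans (min_le_left _ _)⟩
      simp only [e]
      rw [this, smul_eq_mul, mul_assoc, mul_assoc, mul_assoc]
      congr 3
    · have hz : ∀ ω j, w j ω * (Set.Iic x).indicator 1 (σ j ω).toReal = 0 := by
        intro ω j
        simp only [w]
        by_cases hj : (a : ℝ≥0∞) < σ j ω ∧ σ j ω ≤ b
        · have hfin : σ j ω ≠ ∞ := (hj.2.trans_lt ENNReal.coe_lt_top).ne
          have : (a : ℝ) < (σ j ω).toReal := by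
            rw [← ENNReal.coe_toReal]
            exact (ENNReal.toReal_lt_toReal ENNReal.coe_ne_top hfin).2 hj.1
          rw [Set.indicator_of_notMem (show (σ j ω).toReal ∉ Set.Iic x from
            not_le.2 (hax.trans this)), mul_zero]
        · rw [Set.indicator_of_notMem (show ω ∉ {ω | (a : ℝ≥0∞) < σ j ω ∧ σ j ω ≤ b} from hj)]
          simp
      simp only [hz, tsum_zero, lintegral_zero]
      rw [ENNReal.ofReal_of_nonpos (by have := min_le_right (b : ℝ) x; linarith), smul_zero]
  have hc : P H * (M * rate) ≠ ∞ :=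
    ENNReal.mul_ne_top (measure_ne_top _ _) (ENNReal.mul_ne_top hM ENNReal.coe_ne_top)
  -- Finiteness, needed for uniqueness on half-lines, follows from the same formula on `(-∞, k]` as
  -- `k → ∞`.
  have hνfin : IsFiniteMeasure ν := by
    refine ⟨?_⟩
    have hmono : Monotone fun k : ℕ => Set.Iic (k : ℝ) := fun i j hij =>
      Set.Iic_subset_Iic.2 (by exact_mod_cast hij)
    have hun : ⋃ k : ℕ, Set.Iic (k : ℝ) = Set.univ := by
      ext x; simpa using exists_nat_ge x
    have hle : ν Set.univ ≤ P H * (M * rate) * (volume.restrict (Set.Ioc (a : ℝ) b)) Set.univ := by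
      rw [← hun, hmono.measure_iUnion]
      refine iSup_le fun k => ?_
      rw [hνIic, smul_eq_mul]
      gcongr
      exact Set.subset_iUnion (fun k : ℕ => Set.Iic (k : ℝ)) k
    exact hle.trans_lt (ENNReal.mul_lt_top hc.lt_top (measure_lt_top _ _))
  have hνeq : ν = (P H * (M * rate)) • volume.restrict (Set.Ioc (a : ℝ) b) :=
    Measure.ext_of_Iic _ _ fun x => by rw [hνIic]; rfl
  rw [← hν φ hφ, hνeq, lintegral_smul_measure, smul_eq_mul, mul_assoc]

end IsMarkedPoisson
end NonLife
end

/-! ### Payments and observations of one claim as functionals of report and developments -/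

noncomputable section
namespace NonLife

variable {Ω : Type*} {mΩ : MeasurableSpace Ω} {P : Measure Ω}

/-- Payments in `(t, T]` for the developments `d` of a claim reported at time `r`, discounted
with `z`. -/
def devSum (z : ℝ → ℝ≥0∞) (t T : ℝ≥0) (r : ℝ≥0∞) (d : ℕ → ℝ≥0∞ × ℝ≥0) : ℝ≥0∞ :=
  ∑' j, if (t : ℝ≥0∞) < r + (d j).1 ∧ r + (d j).1 ≤ T then
    ((d j).2 : ℝ≥0∞) * z (r + (d j).1).toReal else 0

/-- Payments in `(t, T]` for a claim with report time, delay and first payment `x` and developments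
`d`. -/
def payAfter (z : ℝ → ℝ≥0∞) (t T : ℝ≥0) (x : ℝ≥0∞ × ℝ≥0 × ℝ≥0) (d : ℕ → ℝ≥0∞ × ℝ≥0) : ℝ≥0∞ :=
  (if (t : ℝ≥0∞) < x.1 ∧ x.1 ≤ T then (x.2.2 : ℝ≥0∞) * z x.1.toReal else 0) + devSum z t T x.1 d

/-- The number of events up to time `s` with mark in `B`. -/
def totalCount (s : ℝ≥0) (B : Set (ℝ≥0 × ℝ≥0)) (x : ℝ≥0∞ × ℝ≥0 × ℝ≥0) (d : ℕ → ℝ≥0∞ × ℝ≥0) :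
    ℝ≥0∞ :=
  {x : ℝ≥0∞ × ℝ≥0 × ℝ≥0 | x.1 ≤ s ∧ x.2 ∈ B}.indicator 1 x
    + ∑' j, {q : ℝ≥0∞ × ℝ≥0 | x.1 + q.1 ≤ s ∧ ((0 : ℝ≥0), q.2) ∈ B}.indicator 1 (d j)

theorem measurable_devSum {β : Type*} [MeasurableSpace β] {Z : β × ℝ → ℝ≥0∞} (hZ : Measurable Z)
    (t T : ℝ≥0) : Measurable fun q : β × ℝ≥0∞ × (ℕ → ℝ≥0∞ × ℝ≥0) =>
      devSum (fun u => Z (q.1, u)) t T q.2.1 q.2.2 := by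
  refine Measurable.tsum fun j => ?_
  have hr : Measurable fun q : β × ℝ≥0∞ × (ℕ → ℝ≥0∞ × ℝ≥0) => q.2.1 + (q.2.2 j).1 := by fun_prop
  refine Measurable.ite (MeasurableSet.inter (measurableSet_lt measurable_const hr)
    (measurableSet_le hr measurable_const)) (Measurable.mul (by fun_prop) ?_) measurable_const
  exact hZ.comp (measurable_fst.prodMk hr.ennreal_toReal)

theorem measurable_payAfter {β : Type*} [MeasurableSpace β] {Z : β × ℝ → ℝ≥0∞} (hZ : Measurable Z)
    (t T : ℝ≥0) : Measurable fun q : (β × ℝ≥0∞ × ℝ≥0 × ℝ≥0) × (ℕ → ℝ≥0∞ × ℝ≥0) =>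
      payAfter (fun u => Z (q.1.1, u)) t T q.1.2 q.2 := by
  refine Measurable.add ?_ ((measurable_devSum hZ t T).comp
    (measurable_fst.fst.prodMk (measurable_fst.snd.fst.prodMk measurable_snd)))
  have hr : Measurable fun q : (β × ℝ≥0∞ × ℝ≥0 × ℝ≥0) × (ℕ → ℝ≥0∞ × ℝ≥0) => q.1.2.1 := by fun_prop
  refine Measurable.ite (MeasurableSet.inter (measurableSet_lt measurable_const hr)
    (measurableSet_le hr measurable_const)) (Measurable.mul (by fun_prop) ?_) measurable_const
  exact hZ.comp (measurable_fst.fst.prodMk hr.ennreal_toReal)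

theorem measurable_totalCount (s : ℝ≥0) {B : Set (ℝ≥0 × ℝ≥0)} (hB : MeasurableSet B) :
    Measurable fun q : (ℝ≥0∞ × ℝ≥0 × ℝ≥0) × (ℕ → ℝ≥0∞ × ℝ≥0) => totalCount s B q.1 q.2 := by
  classical
  have h0 : MeasurableSet {y : ℝ≥0 | ((0 : ℝ≥0), y) ∈ B} := measurable_prodMk_left hB
  refine Measurable.add ?_ (Measurable.tsum fun j => ?_)
  · refine (measurable_one.indicator (MeasurableSet.inter
      (measurableSet_le measurable_fst measurable_const) (measurable_snd hB))).comp measurable_fst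
  · simp only [Set.indicator_apply]
    have hr : Measurable fun q : (ℝ≥0∞ × ℝ≥0 × ℝ≥0) × (ℕ → ℝ≥0∞ × ℝ≥0) => q.1.1 + (q.2 j).1 := by
      fun_prop
    refine Measurable.ite (MeasurableSet.inter (measurableSet_le hr measurable_const) ?_)
      measurable_const measurable_const
    exact (measurable_snd.comp ((measurable_pi_apply j).comp measurable_snd)) h0

/-- No event precedes the report. This is why an unreported policy reveals nothing but the fact that
it is unreported. -/
theorem totalCount_of_lt {s : ℝ≥0} {B : Set (ℝ≥0 × ℝ≥0)} {x : ℝ≥0∞ × ℝ≥0 × ℝ≥0}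
    (d : ℕ → ℝ≥0∞ × ℝ≥0) (h : (s : ℝ≥0∞) < x.1) : totalCount s B x d = 0 := by
  classical
  have h1 : ∀ j, ¬ (x.1 + (d j).1 ≤ s) := fun j hj => absurd (le_self_add.trans hj) (not_le.2 h)
  simp [totalCount, not_le.2 h, h1]

theorem measurable_lintegral_Ioc {β : Type*} [MeasurableSpace β] {Z : β × ℝ → ℝ≥0∞}
    (hZ : Measurable Z) (T : ℝ) :
    Measurable fun q : β × ℝ => ∫⁻ v in Set.Ioc q.2 T, Z (q.1, v) := by
  simp_rw [← lintegral_indicator measurableSet_Ioc]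
  refine Measurable.lintegral_prod_right'
    (f := fun q : (β × ℝ) × ℝ => (Set.Ioc q.1.2 T).indicator (fun v => Z (q.1.1, v)) q.2) ?_
  have : (fun q : (β × ℝ) × ℝ => (Set.Ioc q.1.2 T).indicator (fun v => Z (q.1.1, v)) q.2)
      = {q : (β × ℝ) × ℝ | q.1.2 < q.2 ∧ q.2 ≤ T}.indicator fun q => Z (q.1.1, q.2) := by
    funext q; rfl
  rw [this]
  refine (hZ.comp (measurable_fst.fst.prodMk measurable_snd)).indicator ?_
  exact MeasurableSet.inter (measurableSet_lt measurable_fst.snd measurable_snd)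
    (measurableSet_le measurable_snd measurable_const)

namespace IsMarkedPoisson

variable {σ : ℕ → Ω → ℝ≥0∞} {Y : ℕ → Ω → ℝ≥0} {rate T : ℝ≥0} {M : ℝ≥0∞}

/-- The count at time `0` vanishes, so no development coincides with the report. The window open at
`0` in Campbell's formula therefore misses nothing. -/
theorem ae_pos (h : IsMarkedPoisson P σ Y rate T M) : ∀ᵐ ω ∂P, ∀ j, 0 < σ j ω := by
  filter_upwards [h.ae_le_iff, h.poisson.zero] with ω h1 h2 j
  by_contra hj
  have := (h1 0 j).1 (by simpa using not_lt.1 hj)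
  rw [h2] at this
  exact Nat.not_lt_zero _ this

/-- The report comes after `t`, hence so does every development. The time window is thus `(0, T -
r]` on the clock started at the report. -/
theorem lintegral_devSum [IsProbabilityMeasure P] (h : IsMarkedPoisson P σ Y rate T M) (hM : M ≠ ∞)
    {z : ℝ → ℝ≥0∞}
    (hz : Measurable z) {t r : ℝ≥0} (htr : t < r) (hrT : r ≤ T) :
    ∫⁻ ω, devSum z t T r (fun j => (σ j ω, Y j ω)) ∂P
      = M * rate * ∫⁻ v in Set.Ioc (r : ℝ) T, z v := by
  classical
  have hφ : Measurable fun u : ℝ => z (r + u) := hz.comp (by fun_prop)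
  -- The empty family of counts makes the conditioning event the whole space.
  have key := h.setLIntegral_tsum hM (ι := Empty) (s := fun _ => 0) (B := fun _ => Set.univ)
    (by simp) (E := Set.univ) MeasurableSet.univ (a := 0) (b := T - r) (by simp) zero_le
    tsub_le_self hφ
  simp only [Set.mem_univ, Set.ofPred_true, Measure.restrict_univ, measure_univ, one_mul] at key
  have e1 : ∫⁻ v in Set.Ioc (r : ℝ) T, z v = ∫⁻ u in Set.Ioc ((0 : ℝ≥0) : ℝ) (T - r : ℝ≥0),
      z (r + u) := by
    have := (measurePreserving_add_left volume (r : ℝ)).setLIntegral_comp_preimage_emb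
      (MeasurableEquiv.addLeft (r : ℝ)).measurableEmbedding z (Set.Ioc (r : ℝ) T)
    rw [← this]
    simp [NNReal.coe_sub hrT]
  rw [e1, ← key]
  refine lintegral_congr_ae ?_
  filter_upwards [h.ae_pos] with ω hpos
  refine tsum_congr fun j => ?_
  have hiff : ((t : ℝ≥0∞) < r + σ j ω ∧ r + σ j ω ≤ T) ↔
      ω ∈ {ω | ((0 : ℝ≥0) : ℝ≥0∞) < σ j ω ∧ σ j ω ≤ (T - r : ℝ≥0)} := by
    have h1 : (t : ℝ≥0∞) < r + σ j ω :=
      lt_of_lt_of_le (by exact_mod_cast htr) le_self_add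
    have h2 : r + σ j ω ≤ T ↔ σ j ω ≤ (T - r : ℝ≥0) := by
      rw [ENNReal.coe_sub, ENNReal.le_sub_iff_add_le_left ENNReal.coe_ne_top
          (by exact_mod_cast hrT)]
    simp only [Set.mem_ofPred_eq, h1, h2, true_and, ENNReal.coe_zero, hpos j]
  by_cases hj : (t : ℝ≥0∞) < r + σ j ω ∧ r + σ j ω ≤ T
  · rw [if_pos hj, Set.indicator_of_mem (hiff.1 hj), one_mul, ENNReal.toReal_add (by simp)
      (lt_of_le_of_lt (le_add_self.trans hj.2) ENNReal.coe_lt_top).ne, ENNReal.coe_toReal]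
  · rw [if_neg hj, Set.indicator_of_notMem (fun hh => hj (hiff.2 hh)), zero_mul, zero_mul]

/-- For a claim reported at `r ≤ t`, the counts seen by `t` are determined by the development counts
up to `t - r`. Campbell's formula on `(t - r, T - r]` applies given these, followed by a translation
by `r`. -/
theorem setLIntegral_devSum [IsProbabilityMeasure P] (h : IsMarkedPoisson P σ Y rate T M)
    (hM : M ≠ ∞) {z : ℝ → ℝ≥0∞}
    (hz : Measurable z) {t r : ℝ≥0} (hrt : r ≤ t) (htT : t ≤ T) {ι : Type*} [Fintype ι]
    {s : ι → ℝ≥0} (hs : ∀ l, s l ≤ t) {B : ι → Set (ℝ≥0 × ℝ≥0)} (hB : ∀ l, MeasurableSet (B l))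
    {E : Set (ι → ℝ≥0∞)} (hE : MeasurableSet E) (x : ℝ≥0 × ℝ≥0) :
    ∫⁻ ω in {ω | (fun l => totalCount (s l) (B l) (r, x) (fun j => (σ j ω, Y j ω))) ∈ E},
      devSum z t T r (fun j => (σ j ω, Y j ω)) ∂P
      = ∫⁻ _ in {ω | (fun l => totalCount (s l) (B l) (r, x) (fun j => (σ j ω, Y j ω))) ∈ E},
        (M * rate * ∫⁻ v in Set.Ioc (t : ℝ) T, z v) ∂P := by
  classical
  have hφ : Measurable fun u : ℝ => z (r + u) := hz.comp (by fun_prop)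
  let B' : ι → Set ℝ≥0 := fun l => {y : ℝ≥0 | ((0 : ℝ≥0), y) ∈ B l}
  have hB' : ∀ l, MeasurableSet (B' l) := fun l => measurable_prodMk_left (hB l)
  -- The first term is the report itself, constant here. The test `r ≤ s l` is needed because the
  -- truncated difference `s l - r` is `0` when the claim is reported only after `s l`, where
  -- nothing must be counted.
  let f : (ι → ℝ≥0∞) → ι → ℝ≥0∞ := fun y l =>
    {x : ℝ≥0∞ × ℝ≥0 × ℝ≥0 | x.1 ≤ s l ∧ x.2 ∈ B l}.indicator 1 ((r : ℝ≥0∞), x)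
      + if r ≤ s l then y l else 0
  have hf : Measurable f := by
    refine measurable_pi_lambda _ fun l => Measurable.add measurable_const ?_
    by_cases hl : r ≤ s l
    · simp only [hl, if_true]; fun_prop
    · simp only [hl, if_false]; fun_prop
  have hcount : ∀ ω l, totalCount (s l) (B l) (r, x) (fun j => (σ j ω, Y j ω))
      = f (fun l => markCount σ Y (s l - r) (B' l) ω) l := by
    intro ω l
    simp only [totalCount, f]
    congr 1
    split_ifs with hl
    · refine tsum_congr fun j => ?_
      have : ((σ j ω, Y j ω) ∈ {q : ℝ≥0∞ × ℝ≥0 | (r : ℝ≥0∞) + q.1 ≤ s l ∧ ((0 : ℝ≥0), q.2) ∈ B l})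
          ↔ ω ∈ {ω | σ j ω ≤ (s l - r : ℝ≥0) ∧ Y j ω ∈ B' l} := by
        have h2 : r + σ j ω ≤ s l ↔ σ j ω ≤ (s l - r : ℝ≥0) := by
          rw [ENNReal.coe_sub,
            ENNReal.le_sub_iff_add_le_left ENNReal.coe_ne_top (by exact_mod_cast hl)]
        exact and_congr h2 Iff.rfl
      simp only [Set.indicator_apply, this, Pi.one_apply]
    · rw [ENNReal.tsum_eq_zero]
      intro j
      refine Set.indicator_of_notMem (fun hh => hl ?_) _
      have : (r : ℝ≥0∞) ≤ s l := le_self_add.trans hh.1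
      exact_mod_cast this
  have hset : {ω | (fun l => totalCount (s l) (B l) (r, x) (fun j => (σ j ω, Y j ω))) ∈ E}
      = {ω | (fun l => markCount σ Y (s l - r) (B' l) ω) ∈ f ⁻¹' E} := by
    ext ω
    have : (fun l => totalCount (s l) (B l) (r, x) (fun j => (σ j ω, Y j ω)))
        = f (fun l => markCount σ Y (s l - r) (B' l) ω) := funext (hcount ω)
    change _ ∈ E ↔ f _ ∈ E
    rw [this]
  rw [hset, lintegral_const, Measure.restrict_apply_univ]
  have key := h.setLIntegral_tsum hM (s := fun l => s l - r) hB' (hf hE) (a := t - r)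
    (b := T - r) (fun l => tsub_le_tsub_right (hs l) r) (tsub_le_tsub_right htT r) tsub_le_self hφ
  have e1 : ∫⁻ v in Set.Ioc (t : ℝ) T, z v
      = ∫⁻ u in Set.Ioc ((t - r : ℝ≥0) : ℝ) (T - r : ℝ≥0), z (r + u) := by
    have := (measurePreserving_add_left volume (r : ℝ)).setLIntegral_comp_preimage_emb
      (MeasurableEquiv.addLeft (r : ℝ)).measurableEmbedding z (Set.Ioc (t : ℝ) T)
    rw [← this]
    simp [NNReal.coe_sub hrt, NNReal.coe_sub (hrt.trans htT)]
  rw [e1, mul_comm, ← key]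
  refine lintegral_congr fun ω => tsum_congr fun j => ?_
  have hiff : ((t : ℝ≥0∞) < r + σ j ω ∧ r + σ j ω ≤ T) ↔
      ω ∈ {ω | ((t - r : ℝ≥0) : ℝ≥0∞) < σ j ω ∧ σ j ω ≤ (T - r : ℝ≥0)} := by
    have h1 : (t : ℝ≥0∞) < r + σ j ω ↔ ((t - r : ℝ≥0) : ℝ≥0∞) < σ j ω := by
      rw [ENNReal.coe_sub, ← not_le, ← not_le,
        ENNReal.le_sub_iff_add_le_left ENNReal.coe_ne_top (by exact_mod_cast hrt)]
    have h2 : r + σ j ω ≤ T ↔ σ j ω ≤ (T - r : ℝ≥0) := by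
      rw [ENNReal.coe_sub, ENNReal.le_sub_iff_add_le_left ENNReal.coe_ne_top
        (by exact_mod_cast hrt.trans htT)]
    exact and_congr h1 h2
  by_cases hj : (t : ℝ≥0∞) < r + σ j ω ∧ r + σ j ω ≤ T
  · rw [if_pos hj, Set.indicator_of_mem (hiff.1 hj), one_mul, ENNReal.toReal_add (by simp)
      (lt_of_le_of_lt (le_add_self.trans hj.2) ENNReal.coe_lt_top).ne, ENNReal.coe_toReal]
  · rw [if_neg hj, Set.indicator_of_notMem (fun hh => hj (hiff.2 hh)), zero_mul, zero_mul]

end IsMarkedPoisson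
end NonLife
end

/-! ### Valuation of a single policy given outside information `X` -/

noncomputable section
namespace NonLife

variable {Ω : Type*} {mΩ : MeasurableSpace Ω} {P : Measure Ω}

/-- The conditional law of the report time, given the conditional law `κ` of the accident time and
the law `ρ` of the delay. -/
def reportKernel {β : Type*} [MeasurableSpace β] (κ : Kernel β ℝ≥0∞) (ρ : Measure ℝ≥0) :
    Kernel β ℝ≥0∞ :=
  (κ ×ₖ Kernel.const β ρ).map fun q => q.1 + (q.2 : ℝ≥0∞)

theorem lintegral_reportKernel {β : Type*} [MeasurableSpace β] (κ : Kernel β ℝ≥0∞)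
    [IsSFiniteKernel κ] (ρ : Measure ℝ≥0) [SFinite ρ] (b : β) {f : ℝ≥0∞ → ℝ≥0∞}
    (hf : Measurable f) :
    ∫⁻ u, f u ∂reportKernel κ ρ b = ∫⁻ x, ∫⁻ y, f (x + (y : ℝ≥0∞)) ∂ρ ∂κ b := by
  have hadd : Measurable fun q : ℝ≥0∞ × ℝ≥0 => q.1 + (q.2 : ℝ≥0∞) := by fun_prop
  rw [reportKernel, Kernel.map_apply _ hadd, lintegral_map hf hadd, Kernel.prod_apply]
  have hfa : Measurable fun q : ℝ≥0∞ × ℝ≥0 => f (q.1 + (q.2 : ℝ≥0∞)) := hf.comp hadd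
  rw [Kernel.const_apply, lintegral_prod _ hfa.aemeasurable]

instance instIsMarkovKernelReport {β : Type*} [MeasurableSpace β] (κ : Kernel β ℝ≥0∞)
    [IsMarkovKernel κ]
    (ρ : Measure ℝ≥0) [IsProbabilityMeasure ρ] : IsMarkovKernel (reportKernel κ ρ) :=
  Kernel.IsMarkovKernel.map _ (by fun_prop)

/-- The delay is independent of the outside information and the accident time jointly, so
conditionally on `X` the report time is a sum of independent variables. -/
theorem lintegral_comp_reportKernel [IsProbabilityMeasure P] {β : Type*} [MeasurableSpace β]
    {X : Ω → β} (hX : Measurable X) {τ : Ω → ℝ≥0∞} (hτ : Measurable τ) {θ : Ω → ℝ≥0}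
    (hθ : Measurable θ) {κ : Kernel β ℝ≥0∞} [IsMarkovKernel κ]
    (hκ : ∀ F : β × ℝ≥0∞ → ℝ≥0∞, Measurable F →
      ∫⁻ ω, F (X ω, τ ω) ∂P = ∫⁻ ω, ∫⁻ x, F (X ω, x) ∂κ (X ω) ∂P)
    (hind : IndepFun (fun ω => (X ω, τ ω)) θ P) {F : β × ℝ≥0∞ → ℝ≥0∞} (hF : Measurable F) :
    ∫⁻ ω, F (X ω, τ ω + θ ω) ∂P
      = ∫⁻ ω, ∫⁻ u, F (X ω, u) ∂reportKernel κ (P.map θ) (X ω) ∂P := by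
  have : IsProbabilityMeasure (P.map θ) := Measure.isProbabilityMeasure_map hθ.aemeasurable
  have hadd : Measurable fun q : (β × ℝ≥0∞) × ℝ≥0 => F (q.1.1, q.1.2 + (q.2 : ℝ≥0∞)) :=
    hF.comp (by fun_prop)
  rw [IndepFun.lintegral_comp (hX.prodMk hτ) hθ hind hadd]
  have h1 : ∀ q : β × ℝ≥0∞, ∫⁻ ω', F (q.1, q.2 + (θ ω' : ℝ≥0∞)) ∂P
      = ∫⁻ y, F (q.1, q.2 + (y : ℝ≥0∞)) ∂(P.map θ) := fun q => by
    rw [lintegral_map (f := fun y : ℝ≥0 => F (q.1, q.2 + (y : ℝ≥0∞))) (hF.comp (by fun_prop)) hθ]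
  rw [lintegral_congr fun ω => h1 (X ω, τ ω),
    hκ (fun q => ∫⁻ y, F (q.1, q.2 + (y : ℝ≥0∞)) ∂(P.map θ)) hadd.lintegral_prod_right']
  refine lintegral_congr fun ω => ?_
  rw [lintegral_reportKernel _ _ _ (f := fun u => F (X ω, u)) (hF.comp (by fun_prop))]

/-- The value at `b` of the payments of a claim that is not yet reported at time `t`, on the event
that it is not reported, when `κ` is the conditional law of the report time. -/
def unreportedValue {β : Type*} [MeasurableSpace β] (κ : Kernel β ℝ≥0∞) (Z : β × ℝ → ℝ≥0∞)
    (M₁ c : ℝ≥0∞) (t T : ℝ≥0) (b : β) : ℝ≥0∞ :=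
  ∫⁻ u in {u : ℝ≥0∞ | (t : ℝ≥0∞) < u ∧ u ≤ T},
    (M₁ * Z (b, u.toReal) + c * ∫⁻ v in Set.Ioc u.toReal T, Z (b, v)) ∂κ b

theorem measurable_unreportedIntegrand {β : Type*} [MeasurableSpace β] {Z : β × ℝ → ℝ≥0∞}
    (hZ : Measurable Z) (M₁ c : ℝ≥0∞) (T : ℝ≥0) :
    Measurable fun q : β × ℝ≥0∞ =>
      M₁ * Z (q.1, q.2.toReal) + c * ∫⁻ v in Set.Ioc q.2.toReal T, Z (q.1, v) := by
  have h1 : Measurable fun q : β × ℝ≥0∞ => (q.1, q.2.toReal) :=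
    measurable_fst.prodMk measurable_snd.ennreal_toReal
  exact ((hZ.comp h1).const_mul _).add
    (((measurable_lintegral_Ioc hZ (T : ℝ)).comp h1).const_mul _)

theorem measurableSet_window (t T : ℝ≥0) : MeasurableSet {u : ℝ≥0∞ | (t : ℝ≥0∞) < u ∧ u ≤ T} :=
  (measurableSet_lt measurable_const measurable_id).inter
    (measurableSet_le measurable_id measurable_const)

theorem measurable_unreportedValue {β : Type*} [MeasurableSpace β] (κ : Kernel β ℝ≥0∞)
    [IsSFiniteKernel κ] {Z : β × ℝ → ℝ≥0∞} (hZ : Measurable Z) (M₁ c : ℝ≥0∞) (t T : ℝ≥0) :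
    Measurable (unreportedValue κ Z M₁ c t T) := by
  unfold unreportedValue
  simp_rw [← lintegral_indicator (measurableSet_window t T)]
  refine Measurable.lintegral_kernel_prod_right' (f := fun q : β × ℝ≥0∞ =>
    {u : ℝ≥0∞ | (t : ℝ≥0∞) < u ∧ u ≤ T}.indicator (fun u => M₁ * Z (q.1, u.toReal)
      + c * ∫⁻ v in Set.Ioc u.toReal T, Z (q.1, v)) q.2) ?_
  exact (measurable_unreportedIntegrand hZ M₁ c T).indicator
      (measurable_snd (measurableSet_window t T))

section SinglePolicy

variable [IsProbabilityMeasure P] {β : Type*} [MeasurableSpace β] {X : Ω → β}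
  {x : Ω → ℝ≥0∞ × ℝ≥0 × ℝ≥0} {σ : ℕ → Ω → ℝ≥0∞} {Y : ℕ → Ω → ℝ≥0} {rate T : ℝ≥0} {M M₁ : ℝ≥0∞}
  {κ : Kernel β ℝ≥0∞} [IsMarkovKernel κ] {Z : β × ℝ → ℝ≥0∞} {t : ℝ≥0}

/-- The first payment is independent of `X` and the report time, and contributes its mean. For a
fixed report time in the window the developments are averaged by `lintegral_devSum`; a report after
`T` pays nothing. What remains depends only on `X` and the report time, which is then averaged with
`κ`. -/
theorem lintegral_payAfter_unreported (hX : Measurable X) (hx : Measurable x)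
    (hσ : IsMarkedPoisson P σ Y rate T M) (hM : M ≠ ∞)
    (hD : IndepFun (fun ω => (X ω, x ω)) (fun ω j => (σ j ω, Y j ω)) P)
    (hm : IndepFun (fun ω => (X ω, (x ω).1)) (fun ω => (x ω).2.2) P)
    (hmean : ∫⁻ ω, ((x ω).2.2 : ℝ≥0∞) ∂P = M₁)
    (hκ : ∀ F : β × ℝ≥0∞ → ℝ≥0∞, Measurable F →
      ∫⁻ ω, F (X ω, (x ω).1) ∂P = ∫⁻ ω, ∫⁻ u, F (X ω, u) ∂κ (X ω) ∂P)
    (hZ : Measurable Z) {B : Set β} (hB : MeasurableSet B) :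
    ∫⁻ ω in {ω | X ω ∈ B ∧ (t : ℝ≥0∞) < (x ω).1},
        payAfter (fun u => Z (X ω, u)) t T (x ω) (fun j => (σ j ω, Y j ω)) ∂P
      = ∫⁻ ω in {ω | X ω ∈ B}, unreportedValue κ Z M₁ (M * rate) t T (X ω) ∂P := by
  classical
  have hDm : Measurable fun ω j => (σ j ω, Y j ω) := measurable_pi_lambda _ fun j =>
    (hσ.measurable_time j).prodMk (hσ.measurable_mark j)
  have hL : Measurable fun ω => (X ω, x ω) := hX.prodMk hx
  have hS : MeasurableSet {ω | X ω ∈ B ∧ (t : ℝ≥0∞) < (x ω).1} :=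
    (hX hB).inter (measurableSet_lt measurable_const hx.fst)
  have hS2 : MeasurableSet {q : β × ℝ≥0∞ | q.1 ∈ B ∧ (t : ℝ≥0∞) < q.2 ∧ q.2 ≤ T} :=
    (measurable_fst hB).inter (measurable_snd (measurableSet_window t T))
  have hS3 : MeasurableSet {q : β × ℝ≥0∞ × ℝ≥0 × ℝ≥0 | q.1 ∈ B ∧ (t : ℝ≥0∞) < q.2.1} :=
    (measurable_fst hB).inter (measurableSet_lt measurable_const measurable_snd.fst)
  -- first payments
  have e1 : ∫⁻ ω in {ω | X ω ∈ B ∧ (t : ℝ≥0∞) < (x ω).1},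
      (if (t : ℝ≥0∞) < (x ω).1 ∧ (x ω).1 ≤ T then
        ((x ω).2.2 : ℝ≥0∞) * Z (X ω, (x ω).1.toReal) else 0) ∂P
      = ∫⁻ ω, {q : β × ℝ≥0∞ | q.1 ∈ B ∧ (t : ℝ≥0∞) < q.2 ∧ q.2 ≤ T}.indicator
          (fun q => M₁ * Z (q.1, q.2.toReal)) (X ω, (x ω).1) ∂P := by
    rw [← lintegral_indicator hS]
    have hg : Measurable ({q : β × ℝ≥0∞ | q.1 ∈ B ∧ (t : ℝ≥0∞) < q.2 ∧ q.2 ≤ T}.indicator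
        fun q => Z (q.1, q.2.toReal)) :=
      (hZ.comp (measurable_fst.prodMk measurable_snd.ennreal_toReal)).indicator hS2
    have h1 := lintegral_mul_eq_lintegral_mul_lintegral_of_indepFun (μ := P)
      (hg.comp (hX.prodMk hx.fst)) (hx.snd.snd.coe_nnreal_ennreal)
      (hm.comp hg measurable_coe_nnreal_ennreal)
    calc _ = ∫⁻ ω, {q : β × ℝ≥0∞ | q.1 ∈ B ∧ (t : ℝ≥0∞) < q.2 ∧ q.2 ≤ T}.indicator
          (fun q => Z (q.1, q.2.toReal)) (X ω, (x ω).1) * ((x ω).2.2 : ℝ≥0∞) ∂P := by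
          refine lintegral_congr fun ω => ?_
          simp only [Set.indicator_apply, Set.mem_ofPred_eq]
          split_ifs <;> first | tauto | simp [mul_comm]
      _ = _ := h1
      _ = _ := by
          rw [hmean, ← lintegral_mul_const _ (hg.comp (hX.prodMk hx.fst))]
          refine lintegral_congr fun ω => ?_
          simp only [Set.indicator_apply, Function.comp]
          split_ifs <;> simp [mul_comm]
  -- developments
  have e2 : ∫⁻ ω in {ω | X ω ∈ B ∧ (t : ℝ≥0∞) < (x ω).1},
      devSum (fun u => Z (X ω, u)) t T (x ω).1 (fun j => (σ j ω, Y j ω)) ∂P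
      = ∫⁻ ω, {q : β × ℝ≥0∞ | q.1 ∈ B ∧ (t : ℝ≥0∞) < q.2 ∧ q.2 ≤ T}.indicator
          (fun q => M * rate * ∫⁻ v in Set.Ioc q.2.toReal T, Z (q.1, v)) (X ω, (x ω).1) ∂P := by
    rw [← lintegral_indicator hS]
    have hF : Measurable fun p : (β × ℝ≥0∞ × ℝ≥0 × ℝ≥0) × (ℕ → ℝ≥0∞ × ℝ≥0) =>
        {q : β × ℝ≥0∞ × ℝ≥0 × ℝ≥0 | q.1 ∈ B ∧ (t : ℝ≥0∞) < q.2.1}.indicator (fun _ => (1 : ℝ≥0∞))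
            p.1
          * devSum (fun u => Z (p.1.1, u)) t T p.1.2.1 p.2 :=
      ((measurable_const.indicator hS3).comp measurable_fst).mul ((measurable_devSum hZ t T).comp
        (measurable_fst.fst.prodMk (measurable_fst.snd.fst.prodMk measurable_snd)))
    have h1 := IndepFun.lintegral_comp hL hDm hD hF
    simp only at h1
    calc _ = ∫⁻ ω, {q : β × ℝ≥0∞ × ℝ≥0 × ℝ≥0 | q.1 ∈ B ∧ (t : ℝ≥0∞) < q.2.1}.indicator
          (fun _ => (1 : ℝ≥0∞)) (X ω, x ω)
          * devSum (fun u => Z (X ω, u)) t T (x ω).1 (fun j => (σ j ω, Y j ω)) ∂P := by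
          refine lintegral_congr fun ω => ?_
          simp only [Set.indicator_apply, Set.mem_ofPred_eq]
          split_ifs <;> simp
      _ = _ := h1
      _ = _ := by
          refine lintegral_congr fun ω => ?_
          by_cases hω : X ω ∈ B ∧ (t : ℝ≥0∞) < (x ω).1
          · rw [Set.indicator_of_mem (show (X ω, x ω) ∈ {q : β × ℝ≥0∞ × ℝ≥0 × ℝ≥0 |
              q.1 ∈ B ∧ (t : ℝ≥0∞) < q.2.1} from hω)]
            simp only [one_mul]
            by_cases hT : (x ω).1 ≤ T
            · rw [Set.indicator_of_mem (show (X ω, (x ω).1) ∈ {q : β × ℝ≥0∞ |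
                q.1 ∈ B ∧ (t : ℝ≥0∞) < q.2 ∧ q.2 ≤ T} from ⟨hω.1, hω.2, hT⟩)]
              obtain ⟨r, hr⟩ : ∃ r : ℝ≥0, (r : ℝ≥0∞) = (x ω).1 :=
                ⟨_, ENNReal.coe_toNNReal (hT.trans_lt ENNReal.coe_lt_top).ne⟩
              rw [← hr] at hω hT ⊢
              exact hσ.lintegral_devSum hM (z := fun u => Z (X ω, u)) (hZ.comp (by fun_prop))
                (by exact_mod_cast hω.2) (by exact_mod_cast hT)
            · rw [Set.indicator_of_notMem (show (X ω, (x ω).1) ∉ {q : β × ℝ≥0∞ |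
                q.1 ∈ B ∧ (t : ℝ≥0∞) < q.2 ∧ q.2 ≤ T} from fun h => hT h.2.2)]
              rw [lintegral_eq_zero_iff' (by
                exact ((measurable_devSum hZ t T).comp (measurable_const.prodMk
                  (measurable_const.prodMk hDm))).aemeasurable)]
              refine ae_of_all _ fun ω' => ?_
              refine ENNReal.tsum_eq_zero.2 fun j => if_neg fun h => hT (le_self_add.trans h.2)
          · rw [Set.indicator_of_notMem (show (X ω, x ω) ∉ {q : β × ℝ≥0∞ × ℝ≥0 × ℝ≥0 |
              q.1 ∈ B ∧ (t : ℝ≥0∞) < q.2.1} from hω),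
              Set.indicator_of_notMem (show (X ω, (x ω).1) ∉ {q : β × ℝ≥0∞ |
                q.1 ∈ B ∧ (t : ℝ≥0∞) < q.2 ∧ q.2 ≤ T} from fun h => hω ⟨h.1, h.2.1⟩)]
            simp
  have hfirst : Measurable fun ω => (if (t : ℝ≥0∞) < (x ω).1 ∧ (x ω).1 ≤ T then
        ((x ω).2.2 : ℝ≥0∞) * Z (X ω, (x ω).1.toReal) else 0) :=
    Measurable.ite (hx.fst (measurableSet_window t T)) (hx.snd.snd.coe_nnreal_ennreal.mul
      (hZ.comp (hX.prodMk hx.fst.ennreal_toReal))) measurable_const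
  have hA : Measurable ({q : β × ℝ≥0∞ | q.1 ∈ B ∧ (t : ℝ≥0∞) < q.2 ∧ q.2 ≤ T}.indicator
      (fun q => M₁ * Z (q.1, q.2.toReal))) := Measurable.indicator
    ((hZ.comp (measurable_fst.prodMk measurable_snd.ennreal_toReal)).const_mul _) hS2
  have hAω : Measurable fun ω => {q : β × ℝ≥0∞ | q.1 ∈ B ∧ (t : ℝ≥0∞) < q.2 ∧ q.2 ≤ T}.indicator
      (fun q => M₁ * Z (q.1, q.2.toReal)) (X ω, (x ω).1) := hA.comp (hX.prodMk hx.fst)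
  simp only [payAfter]
  rw [lintegral_add_left hfirst, e1, e2, ← lintegral_add_left hAω]
  have e3 : ∀ q : β × ℝ≥0∞,
      {q : β × ℝ≥0∞ | q.1 ∈ B ∧ (t : ℝ≥0∞) < q.2 ∧ q.2 ≤ T}.indicator
          (fun q => M₁ * Z (q.1, q.2.toReal)) q
        + {q : β × ℝ≥0∞ | q.1 ∈ B ∧ (t : ℝ≥0∞) < q.2 ∧ q.2 ≤ T}.indicator
          (fun q => M * rate * ∫⁻ v in Set.Ioc q.2.toReal T, Z (q.1, v)) q
      = {q : β × ℝ≥0∞ | q.1 ∈ B ∧ (t : ℝ≥0∞) < q.2 ∧ q.2 ≤ T}.indicator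
          (fun q => M₁ * Z (q.1, q.2.toReal)
            + M * rate * ∫⁻ v in Set.Ioc q.2.toReal T, Z (q.1, v)) q := fun q => by
    rw [Set.indicator_apply, Set.indicator_apply, Set.indicator_apply]; split_ifs <;> simp
  have e4 := lintegral_congr (μ := P) fun ω => e3 (X ω, (x ω).1)
  refine e4.trans ?_
  rw [hκ _ ((measurable_unreportedIntegrand hZ M₁ (M * rate) T).indicator hS2),
    ← lintegral_indicator (s := {ω | X ω ∈ B}) (hX hB)]
  refine lintegral_congr fun ω => ?_
  by_cases hω : X ω ∈ B
  · rw [Set.indicator_of_mem (show ω ∈ {ω | X ω ∈ B} from hω), unreportedValue,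
      ← lintegral_indicator (measurableSet_window t T)]
    refine lintegral_congr fun u => ?_
    simp only [Set.indicator_apply, Set.mem_ofPred_eq, hω, true_and]
  · rw [Set.indicator_of_notMem (show ω ∉ {ω | X ω ∈ B} from hω)]
    simp [hω]

/-- The developments are independent of `X` and the report data, so by Fubini these can be frozen.
For each frozen report time at most `t` the claim is `setLIntegral_devSum`. -/
theorem setLIntegral_payAfter_reported (hX : Measurable X) (hx : Measurable x)
    (hσ : IsMarkedPoisson P σ Y rate T M) (hM : M ≠ ∞)
    (hD : IndepFun (fun ω => (X ω, x ω)) (fun ω j => (σ j ω, Y j ω)) P)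
    (hZ : Measurable Z) {B : Set β} (hB : MeasurableSet B) (htT : t ≤ T)
    {ι : Type*} [Fintype ι] {s : ι → ℝ≥0} (hs : ∀ l, s l ≤ t) {C : ι → Set (ℝ≥0 × ℝ≥0)}
    (hC : ∀ l, MeasurableSet (C l)) {E : Set (ι → ℝ≥0∞)} (hE : MeasurableSet E) :
    ∫⁻ ω in {ω | X ω ∈ B ∧ (x ω).1 ≤ t
          ∧ (fun l => totalCount (s l) (C l) (x ω) (fun j => (σ j ω, Y j ω))) ∈ E},
        payAfter (fun u => Z (X ω, u)) t T (x ω) (fun j => (σ j ω, Y j ω)) ∂P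
      = ∫⁻ ω in {ω | X ω ∈ B ∧ (x ω).1 ≤ t
          ∧ (fun l => totalCount (s l) (C l) (x ω) (fun j => (σ j ω, Y j ω))) ∈ E},
        (M * rate * ∫⁻ v in Set.Ioc (t : ℝ) T, Z (X ω, v)) ∂P := by
  classical
  have hDm : Measurable fun ω j => (σ j ω, Y j ω) := measurable_pi_lambda _ fun j =>
    (hσ.measurable_time j).prodMk (hσ.measurable_mark j)
  have hL : Measurable fun ω => (X ω, x ω) := hX.prodMk hx
  let A : Set ((β × ℝ≥0∞ × ℝ≥0 × ℝ≥0) × (ℕ → ℝ≥0∞ × ℝ≥0)) :=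
    {p | p.1.1 ∈ B ∧ p.1.2.1 ≤ t ∧ (fun l => totalCount (s l) (C l) p.1.2 p.2) ∈ E}
  have hA : MeasurableSet A := by
    refine (measurable_fst.fst hB).inter (MeasurableSet.inter
      (measurableSet_le measurable_fst.snd.fst measurable_const) ?_)
    exact (measurable_pi_lambda _ fun l => (measurable_totalCount (s l) (hC l)).comp
      (measurable_fst.snd.prodMk measurable_snd)) hE
  have hAω : MeasurableSet {ω | X ω ∈ B ∧ (x ω).1 ≤ t
      ∧ (fun l => totalCount (s l) (C l) (x ω) (fun j => (σ j ω, Y j ω))) ∈ E} :=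
    (hL.prodMk hDm) hA
  have key : ∀ F : (β × ℝ≥0∞ × ℝ≥0 × ℝ≥0) × (ℕ → ℝ≥0∞ × ℝ≥0) → ℝ≥0∞, Measurable F →
      ∫⁻ ω in {ω | X ω ∈ B ∧ (x ω).1 ≤ t
          ∧ (fun l => totalCount (s l) (C l) (x ω) (fun j => (σ j ω, Y j ω))) ∈ E},
        F ((X ω, x ω), fun j => (σ j ω, Y j ω)) ∂P
      = ∫⁻ ω, ∫⁻ ω', A.indicator F ((X ω, x ω), fun j => (σ j ω', Y j ω')) ∂P ∂P := by
    intro F hF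
    rw [← lintegral_indicator hAω, ← IndepFun.lintegral_comp hL hDm hD (hF.indicator hA)]
    rfl
  have hconst : Measurable fun p : (β × ℝ≥0∞ × ℝ≥0 × ℝ≥0) × (ℕ → ℝ≥0∞ × ℝ≥0) =>
      M * rate * ∫⁻ v in Set.Ioc (t : ℝ) T, Z (p.1.1, v) :=
    ((measurable_lintegral_Ioc hZ (T : ℝ)).comp
      (measurable_fst.fst.prodMk measurable_const)).const_mul _
  have k1 := key _ (measurable_payAfter hZ t T)
  have k2 := key _ hconst
  refine k1.trans (Eq.trans (lintegral_congr fun ω => ?_) k2.symm)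
  by_cases hω : X ω ∈ B ∧ (x ω).1 ≤ t
  · obtain ⟨r, hr⟩ : ∃ r : ℝ≥0, (r : ℝ≥0∞) = (x ω).1 :=
      ⟨_, ENNReal.coe_toNNReal (hω.2.trans_lt ENNReal.coe_lt_top).ne⟩
    have hxr : x ω = ((r : ℝ≥0∞), (x ω).2) := by rw [hr]
    have hrt : r ≤ t := by
      have := hω.2
      rw [← hr] at this
      exact_mod_cast this
    have hmeasH : MeasurableSet {ω' | (fun l => totalCount (s l) (C l) ((r : ℝ≥0∞), (x ω).2)
        (fun j => (σ j ω', Y j ω'))) ∈ E} :=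
      (measurable_pi_lambda _ fun l => (measurable_totalCount (s l) (hC l)).comp
        (measurable_const.prodMk hDm)) hE
    have h1 := hσ.setLIntegral_devSum hM (z := fun u => Z (X ω, u)) (hZ.comp (by fun_prop)) hrt htT
      hs hC hE (x ω).2
    rw [← lintegral_indicator hmeasH, ← lintegral_indicator hmeasH] at h1
    convert h1 using 1
    · refine lintegral_congr fun ω' => ?_
      have hpay : payAfter (fun u => Z (X ω, u)) t T (x ω) (fun j => (σ j ω', Y j ω'))
          = devSum (fun u => Z (X ω, u)) t T r (fun j => (σ j ω', Y j ω')) := by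
        rw [payAfter, if_neg (fun h => absurd h.1 (not_lt.2 hω.2)), zero_add, hr]
      simp only [Set.indicator_apply, A, Set.mem_ofPred_eq, hω, true_and, hpay, ← hxr]
    · refine lintegral_congr fun ω' => ?_
      simp only [Set.indicator_apply, A, Set.mem_ofPred_eq, hω, true_and, ← hxr]
  · have : ∀ ω', ((X ω, x ω), fun j => (σ j ω', Y j ω')) ∉ A := fun ω' h => hω ⟨h.1, h.2.1⟩
    simp only [Set.indicator_of_notMem (this _)]

/-- The key lemma of reduced-form models: on the event that the claim is not reported, conditioning
on the policy's own observations is division by the conditional probability of that event. On the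
reported part Campbell's formula gives the value directly. -/
theorem setLIntegral_payAfter (hX : Measurable X) (hx : Measurable x)
    (hσ : IsMarkedPoisson P σ Y rate T M) (hM : M ≠ ∞)
    (hD : IndepFun (fun ω => (X ω, x ω)) (fun ω j => (σ j ω, Y j ω)) P)
    (hm : IndepFun (fun ω => (X ω, (x ω).1)) (fun ω => (x ω).2.2) P)
    (hmean : ∫⁻ ω, ((x ω).2.2 : ℝ≥0∞) ∂P = M₁)
    (hκ : ∀ F : β × ℝ≥0∞ → ℝ≥0∞, Measurable F →
      ∫⁻ ω, F (X ω, (x ω).1) ∂P = ∫⁻ ω, ∫⁻ u, F (X ω, u) ∂κ (X ω) ∂P)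
    (hpos : ∀ᵐ ω ∂P, κ (X ω) (Set.Ioi (t : ℝ≥0∞)) ≠ 0)
    (hZ : Measurable Z) {B : Set β} (hB : MeasurableSet B) (htT : t ≤ T)
    {ι : Type*} [Fintype ι] {s : ι → ℝ≥0} (hs : ∀ l, s l ≤ t) {C : ι → Set (ℝ≥0 × ℝ≥0)}
    (hC : ∀ l, MeasurableSet (C l)) {E : Set (ι → ℝ≥0∞)} (hE : MeasurableSet E) :
    ∫⁻ ω in {ω | X ω ∈ B
          ∧ (fun l => totalCount (s l) (C l) (x ω) (fun j => (σ j ω, Y j ω))) ∈ E},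
        payAfter (fun u => Z (X ω, u)) t T (x ω) (fun j => (σ j ω, Y j ω)) ∂P
      = ∫⁻ ω in {ω | X ω ∈ B
          ∧ (fun l => totalCount (s l) (C l) (x ω) (fun j => (σ j ω, Y j ω))) ∈ E},
        ({ω | (x ω).1 ≤ t}.indicator (fun _ => 1) ω
            * (M * rate * ∫⁻ v in Set.Ioc (t : ℝ) T, Z (X ω, v))
          + {ω | (t : ℝ≥0∞) < (x ω).1}.indicator (fun _ => 1) ω
            * (unreportedValue κ Z M₁ (M * rate) t T (X ω) / κ (X ω) (Set.Ioi t))) ∂P := by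
  classical
  have hDm : Measurable fun ω j => (σ j ω, Y j ω) := measurable_pi_lambda _ fun j =>
    (hσ.measurable_time j).prodMk (hσ.measurable_mark j)
  set S : Set Ω := {ω | X ω ∈ B
    ∧ (fun l => totalCount (s l) (C l) (x ω) (fun j => (σ j ω, Y j ω))) ∈ E}
  set V : Ω → ℝ≥0∞ := fun ω => {ω | (x ω).1 ≤ t}.indicator (fun _ => 1) ω
            * (M * rate * ∫⁻ v in Set.Ioc (t : ℝ) T, Z (X ω, v))
          + {ω | (t : ℝ≥0∞) < (x ω).1}.indicator (fun _ => 1) ω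
            * (unreportedValue κ Z M₁ (M * rate) t T (X ω) / κ (X ω) (Set.Ioi t)) with hV
  have hS : MeasurableSet S := (hX hB).inter ((measurable_pi_lambda _ fun l =>
    (measurable_totalCount (s l) (hC l)).comp (hx.prodMk hDm)) hE)
  have hR : MeasurableSet {ω | (x ω).1 ≤ t} := measurableSet_le hx.fst measurable_const
  have hsplit : ∀ f : Ω → ℝ≥0∞, ∫⁻ ω in S, f ω ∂P
      = ∫⁻ ω in S ∩ {ω | (x ω).1 ≤ t}, f ω ∂P + ∫⁻ ω in S \ {ω | (x ω).1 ≤ t}, f ω ∂P :=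
    fun f => (lintegral_inter_add_sdiff f S hR).symm
  rw [hsplit, hsplit]
  have hSR : S ∩ {ω | (x ω).1 ≤ t} = {ω | X ω ∈ B ∧ (x ω).1 ≤ t
      ∧ (fun l => totalCount (s l) (C l) (x ω) (fun j => (σ j ω, Y j ω))) ∈ E} := by
    ext ω; simp only [S, Set.mem_inter_iff, Set.mem_ofPred_eq]; tauto
  congr 1
  · rw [hSR, setLIntegral_payAfter_reported hX hx hσ hM hD hZ hB htT hs hC hE, ← hSR]
    refine setLIntegral_congr_fun (hS.inter hR) fun ω hω => ?_
    have h1 : ω ∈ {ω | (x ω).1 ≤ t} := hω.2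
    have h2 : ω ∉ {ω | (t : ℝ≥0∞) < (x ω).1} :=
      fun h => absurd (show (t : ℝ≥0∞) < (x ω).1 from h) (not_lt.2 h1)
    change _ = {ω | (x ω).1 ≤ t}.indicator (fun _ => 1) ω * _
      + {ω | (t : ℝ≥0∞) < (x ω).1}.indicator (fun _ => 1) ω * _
    rw [Set.indicator_of_mem h1, Set.indicator_of_notMem h2, one_mul, zero_mul, add_zero]
  -- All counts vanish before the report, so the condition that they lie in `E` is either always or
  -- never satisfied there, according to whether `0 ∈ E`.
  · have hzero : ∀ ω, (t : ℝ≥0∞) < (x ω).1 →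
        (fun l => totalCount (s l) (C l) (x ω) (fun j => (σ j ω, Y j ω))) = 0 := fun ω hω =>
      funext fun l => totalCount_of_lt _ (lt_of_le_of_lt (by exact_mod_cast hs l) hω)
    have hSd : S \ {ω | (x ω).1 ≤ t}
        = if (0 : ι → ℝ≥0∞) ∈ E then {ω | X ω ∈ B ∧ (t : ℝ≥0∞) < (x ω).1} else ∅ := by
      ext ω
      simp only [S, Set.mem_sdiff, Set.mem_ofPred_eq, not_le]
      split_ifs with h0
      · constructor
        · rintro ⟨⟨h1, -⟩, h2⟩; exact ⟨h1, h2⟩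
        · rintro ⟨h1, h2⟩; exact ⟨⟨h1, by rw [hzero ω h2]; exact h0⟩, h2⟩
      · constructor
        · rintro ⟨⟨-, h1⟩, h2⟩; rw [hzero ω h2] at h1; exact h0 h1
        · rintro ⟨⟩
    rw [hSd]
    split_ifs with h0
    swap
    · simp
    rw [lintegral_payAfter_unreported hX hx hσ hM hD hm hmean hκ hZ hB]
    have hS3 : MeasurableSet {q : β × ℝ≥0∞ | q.1 ∈ B ∧ (t : ℝ≥0∞) < q.2} :=
      (measurable_fst hB).inter (measurableSet_lt measurable_const measurable_snd)
    have hq : Measurable fun b => unreportedValue κ Z M₁ (M * rate) t T b / κ b (Set.Ioi t) :=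
      (measurable_unreportedValue κ hZ M₁ (M * rate) t T).div
        (Kernel.measurable_coe κ measurableSet_Ioi)
    have e1 : ∫⁻ ω in {ω | X ω ∈ B ∧ (t : ℝ≥0∞) < (x ω).1}, V ω ∂P
        = ∫⁻ ω, {q : β × ℝ≥0∞ | q.1 ∈ B ∧ (t : ℝ≥0∞) < q.2}.indicator (fun q =>
            unreportedValue κ Z M₁ (M * rate) t T q.1 / κ q.1 (Set.Ioi t)) (X ω, (x ω).1) ∂P := by
      have hSm : MeasurableSet {ω | X ω ∈ B ∧ (t : ℝ≥0∞) < (x ω).1} :=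
        (hX hB).inter (measurableSet_lt measurable_const hx.fst)
      rw [← lintegral_indicator hSm]
      refine lintegral_congr fun ω => ?_
      by_cases hω : X ω ∈ B ∧ (t : ℝ≥0∞) < (x ω).1
      · rw [Set.indicator_of_mem (show ω ∈ {ω | X ω ∈ B ∧ (t : ℝ≥0∞) < (x ω).1} from hω),
          Set.indicator_of_mem (show (X ω, (x ω).1) ∈ {q : β × ℝ≥0∞ | q.1 ∈ B ∧ (t : ℝ≥0∞) < q.2}
            from hω)]
        simp only [hV]
        rw [Set.indicator_of_mem (show ω ∈ {ω | (t : ℝ≥0∞) < (x ω).1} from hω.2),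
          Set.indicator_of_notMem (show ω ∉ {ω | (x ω).1 ≤ t} from fun h => absurd h
              (not_le.2 hω.2)),
          one_mul, zero_mul, zero_add]
      · rw [Set.indicator_of_notMem (show ω ∉ {ω | X ω ∈ B ∧ (t : ℝ≥0∞) < (x ω).1} from hω),
          Set.indicator_of_notMem (show (X ω, (x ω).1) ∉ {q : β × ℝ≥0∞ |
            q.1 ∈ B ∧ (t : ℝ≥0∞) < q.2} from hω)]
    have hqS : Measurable ({q : β × ℝ≥0∞ | q.1 ∈ B ∧ (t : ℝ≥0∞) < q.2}.indicator fun q =>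
        unreportedValue κ Z M₁ (M * rate) t T q.1 / κ q.1 (Set.Ioi t)) :=
      (hq.comp measurable_fst).indicator hS3
    rw [e1, hκ _ hqS, ← lintegral_indicator (s := {ω | X ω ∈ B}) (hX hB)]
    refine lintegral_congr_ae ?_
    filter_upwards [hpos] with ω hω
    by_cases hωB : X ω ∈ B
    · rw [Set.indicator_of_mem (show ω ∈ {ω | X ω ∈ B} from hωB)]
      -- Averaging over the report time gives back the factor `κ (X ω) (t, ∞]`, which cancels the
      -- denominator.
      have : ∀ u : ℝ≥0∞, {q : β × ℝ≥0∞ | q.1 ∈ B ∧ (t : ℝ≥0∞) < q.2}.indicator (fun q =>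
            unreportedValue κ Z M₁ (M * rate) t T q.1 / κ q.1 (Set.Ioi t)) (X ω, u)
          = (Set.Ioi (t : ℝ≥0∞)).indicator (fun _ =>
            unreportedValue κ Z M₁ (M * rate) t T (X ω) / κ (X ω) (Set.Ioi t)) u := fun u => by
        simp only [Set.indicator_apply, Set.mem_ofPred_eq, hωB, true_and, Set.mem_Ioi]
      simp only [this]
      rw [lintegral_indicator_const measurableSet_Ioi,
        ENNReal.div_mul_cancel hω (measure_ne_top _ _)]
    · rw [Set.indicator_of_notMem (show ω ∉ {ω | X ω ∈ B} from hωB)]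
      simp [hωB]

end SinglePolicy
end NonLife
end

/-! ### Laws with a hazard rate -/

noncomputable section
namespace NonLife

/-- The cumulative hazard of the rate `m`. -/
def cumHazard (m : ℝ → ℝ) (t : ℝ) : ℝ := ∫ s in (0 : ℝ)..t, m s

/-- `k` is a law on `[0, ∞]` with hazard rate `m`. -/
structure IsHazardLaw (m : ℝ → ℝ) (k : Measure ℝ≥0∞) : Prop where
  integrable : ∀ t : ℝ≥0, IntervalIntegrable m volume 0 t
  tail : ∀ t : ℝ≥0, k (Set.Ioi t) = ENNReal.ofReal (Real.exp (-cumHazard m t))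

/-- The survival-weighted rate `exp (-Γ) m`. -/
def hazardDensity (m : ℝ → ℝ) (x : ℝ) : ℝ := Real.exp (-cumHazard m x) * m x

namespace IsHazardLaw

variable {m : ℝ → ℝ} {k : Measure ℝ≥0∞}

theorem intervalIntegrable (h : IsHazardLaw m k) {a b : ℝ} (ha : 0 ≤ a) (hb : 0 ≤ b) :
    IntervalIntegrable m volume a b := by
  lift a to ℝ≥0 using ha
  lift b to ℝ≥0 using hb
  exact (h.integrable a).symm.trans (h.integrable b)

/-- The rate is not assumed nonnegative. Monotonicity comes from the law: tails decrease, hence so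
does `exp (-Γ)`. -/
theorem cumHazard_monotoneOn (h : IsHazardLaw m k) : MonotoneOn (cumHazard m) (Set.Ici 0) := by
  intro a ha b hb hab
  lift a to ℝ≥0 using ha
  lift b to ℝ≥0 using hb
  have hsub : k (Set.Ioi (b : ℝ≥0∞)) ≤ k (Set.Ioi (a : ℝ≥0∞)) :=
    measure_mono (Set.Ioi_subset_Ioi (by exact_mod_cast hab))
  rw [h.tail, h.tail, ENNReal.ofReal_le_ofReal_iff (Real.exp_pos _).le, Real.exp_le_exp] at hsub
  linarith

theorem cumHazard_nonneg (h : IsHazardLaw m k) {x : ℝ} (hx : 0 ≤ x) : 0 ≤ cumHazard m x := by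
  have := h.cumHazard_monotoneOn (Set.mem_Ici.2 le_rfl) (Set.mem_Ici.2 hx) hx
  simpa [cumHazard] using this

theorem ae_hasDerivAt (h : IsHazardLaw m k) :
    ∀ᵐ x, 0 < x → HasDerivAt (cumHazard m) (m x) x := by
  have hk : ∀ K : ℕ, ∀ᵐ x : ℝ, x ∈ Set.uIcc (0 : ℝ) K → ∀ c ∈ Set.uIcc (0 : ℝ) K,
      HasDerivAt (fun x => ∫ t in c..x, m t) (m x) x :=
    fun K => (h.intervalIntegrable le_rfl (Nat.cast_nonneg K)).ae_hasDerivAt_integral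
  filter_upwards [ae_all_iff.2 hk] with x hx hpos
  obtain ⟨K, hK⟩ := exists_nat_ge x
  have hK0 : (0 : ℝ) ≤ K := Nat.cast_nonneg K
  exact hx K (by rw [Set.uIcc_of_le hK0]; exact ⟨hpos.le, hK⟩) 0 Set.left_mem_uIcc

/-- By Lebesgue differentiation the rate is almost everywhere the derivative of the monotone
function `Γ`. -/
theorem ae_nonneg (h : IsHazardLaw m k) : ∀ᵐ x, 0 < x → 0 ≤ m x := by
  filter_upwards [h.ae_hasDerivAt] with x hx hpos
  refine (hx hpos).hasDerivWithinAt.nonneg_of_monotoneOn (s := Set.Ioi 0) ?_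
    (h.cumHazard_monotoneOn.mono Set.Ioi_subset_Ici_self)
  exact uniqueDiffWithinAt_iff_accPt.1 (uniqueDiffOn_Ioi 0 x hpos)

/-- `Γ` is absolutely continuous as a primitive and nonnegative, and `exp (-·)` is 1-Lipschitz on
`[0, ∞)`. So `exp (-Γ)` is absolutely continuous and is recovered from its derivative `-exp (-Γ) m`.
-/
theorem integral_hazardDensity (h : IsHazardLaw m k) {a b : ℝ} (ha : 0 ≤ a) (hab : a ≤ b) :
    IntervalIntegrable (hazardDensity m) volume a b ∧
    ∫ x in a..b, hazardDensity m x = Real.exp (-cumHazard m a) - Real.exp (-cumHazard m b) := by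
  have hb := ha.trans hab
  have hac : AbsolutelyContinuousOnInterval (cumHazard m) a b :=
    ((h.intervalIntegrable le_rfl hb).absolutelyContinuousOnInterval_intervalIntegral
      (c := 0) Set.left_mem_uIcc).mono (by
        rw [Set.uIcc_of_le hab, Set.uIcc_of_le hb]; exact Set.Icc_subset_Icc_left ha)
  have hexp : AbsolutelyContinuousOnInterval (fun x => Real.exp (-cumHazard m x)) a b := by
    refine squeeze_zero' (Eventually.of_forall fun E => Finset.sum_nonneg fun _ _ => dist_nonneg) ?_
      hac
    have : ∀ᶠ E in AbsolutelyContinuousOnInterval.totalLengthFilter (X := ℝ) ⊓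
        𝓟 (AbsolutelyContinuousOnInterval.disjWithin a b),
        E ∈ AbsolutelyContinuousOnInterval.disjWithin a b :=
      mem_inf_of_right (mem_principal_self _)
    filter_upwards [this] with E hE
    refine Finset.sum_le_sum fun i hi => ?_
    have hmem := hE.1 i hi
    rw [Set.uIcc_of_le hab] at hmem
    have h1 := h.cumHazard_nonneg (ha.trans hmem.1.1)
    have h2 := h.cumHazard_nonneg (ha.trans hmem.2.1)
    generalize cumHazard m (E.2 i).1 = u at h1 ⊢
    generalize cumHazard m (E.2 i).2 = v at h2 ⊢
    wlog huv : u ≤ v generalizing u v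
    · rw [dist_comm, dist_comm u]
      exact this v h2 u h1 (not_le.1 huv).le
    rw [Real.dist_eq, Real.dist_eq, abs_of_nonneg (by
      rw [sub_nonneg, Real.exp_le_exp]; linarith), abs_of_nonpos (by linarith)]
    -- The Lipschitz bound: `e^{-u} - e^{-v} = e^{-u} (1 - e^{-(v - u)}) ≤ v - u`.
    have h3 : Real.exp (-v) = Real.exp (-u) * Real.exp (-(v - u)) := by
      rw [← Real.exp_add]; ring_nf
    have h4 := Real.add_one_le_exp (-(v - u))
    have h5 : Real.exp (-u) ≤ 1 := Real.exp_le_one_iff.2 (by linarith)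
    have h6 := Real.exp_pos (-u)
    rw [h3]
    nlinarith
  have hder : ∀ᵐ x, x ∈ Set.uIoc a b →
      deriv (fun x => Real.exp (-cumHazard m x)) x = -hazardDensity m x := by
    filter_upwards [h.ae_hasDerivAt] with x hx hmem
    rw [Set.uIoc_of_le hab] at hmem
    have := ((hx (ha.trans_lt hmem.1)).neg.exp).deriv
    simp only [Pi.neg_apply] at this
    rw [hazardDensity, ← mul_neg]
    exact this
  constructor
  · have h1 := hexp.intervalIntegrable_deriv.neg
    refine h1.congr_ae ?_
    rw [EventuallyEq, ae_restrict_iff' measurableSet_uIoc]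
    filter_upwards [hder] with x hx hmem
    rw [Pi.neg_apply, hx hmem, neg_neg]
  · have h1 := hexp.integral_deriv_eq_sub
    rw [intervalIntegral.integral_congr_ae hder, intervalIntegral.integral_neg] at h1
    linarith

theorem ae_hazardDensity_nonneg (h : IsHazardLaw m k) : ∀ᵐ x, 0 < x → 0 ≤ hazardDensity m x := by
  filter_upwards [h.ae_nonneg] with x hx hpos
  exact mul_nonneg (Real.exp_pos _).le (hx hpos)

theorem lintegral_hazardDensity (h : IsHazardLaw m k) (u : ℝ≥0) :
    ∫⁻ x in Set.Ioc (0 : ℝ) u, ENNReal.ofReal (hazardDensity m x)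
      = ENNReal.ofReal (1 - Real.exp (-cumHazard m u)) := by
  have h1 := h.integral_hazardDensity le_rfl u.coe_nonneg
  rw [intervalIntegral.integral_of_le u.coe_nonneg] at h1
  rw [← ofReal_integral_eq_lintegral_ofReal
    ((intervalIntegrable_iff_integrableOn_Ioc_of_le u.coe_nonneg).1 h1.1), h1.2]
  · simp [cumHazard]
  · rw [EventuallyLE, ae_restrict_iff' measurableSet_Ioc]
    filter_upwards [h.ae_hazardDensity_nonneg] with x hx hmem using hx hmem.1

theorem aemeasurable_hazardDensity (h : IsHazardLaw m k) :
    AEMeasurable (hazardDensity m) (volume.restrict (Set.Ioi 0)) := by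
  have hun : ⋃ K : ℕ, Set.Ioc (0 : ℝ) K = Set.Ioi 0 := by
    ext x
    simp only [Set.mem_iUnion, Set.mem_Ioc, Set.mem_Ioi]
    exact ⟨fun ⟨_, h⟩ => h.1, fun h => ⟨_, h, (exists_nat_ge x).choose_spec⟩⟩
  rw [← hun, aemeasurable_iUnion_iff]
  intro K
  have h1 := (h.integral_hazardDensity le_rfl (Nat.cast_nonneg K)).1
  exact ((intervalIntegrable_iff_integrableOn_Ioc_of_le (Nat.cast_nonneg K)).1 h1).aemeasurable

theorem measure_Iic [IsProbabilityMeasure k] (h : IsHazardLaw m k) (u : ℝ≥0) :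
    k (Set.Iic u) = ENNReal.ofReal (1 - Real.exp (-cumHazard m u)) := by
  rw [← Set.compl_Ioi, prob_compl_eq_one_sub measurableSet_Ioi, h.tail,
    ENNReal.ofReal_sub _ (Real.exp_pos _).le, ENNReal.ofReal_one]

/-- The two measures have the same distribution function. The mass at `∞` is removed first, because
`toReal` would send it to `0`. -/
theorem map_toReal [IsProbabilityMeasure k] (h : IsHazardLaw m k) :
    (k.restrict {x | x ≠ ∞}).map ENNReal.toReal
      = (volume.restrict (Set.Ioi 0)).withDensity fun x => ENNReal.ofReal (hazardDensity m x) := by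
  have hm : MeasurableSet {x : ℝ≥0∞ | x ≠ ∞} := (measurableSet_singleton ∞).compl
  refine Measure.ext_of_Iic _ _ fun u => ?_
  rw [Measure.map_apply ENNReal.measurable_toReal measurableSet_Iic,
    Measure.restrict_apply (ENNReal.measurable_toReal measurableSet_Iic),
    withDensity_apply _ measurableSet_Iic, Measure.restrict_restrict measurableSet_Iic,
    Set.inter_comm (Set.Iic u) (Set.Ioi 0), Set.Ioi_inter_Iic]
  rcases le_or_gt 0 u with hu | hu
  · lift u to ℝ≥0 using hu
    rw [h.lintegral_hazardDensity, ← h.measure_Iic]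
    congr 1
    ext x
    simp only [Set.mem_inter_iff, Set.mem_preimage, Set.mem_Iic, Set.mem_ofPred_eq]
    constructor
    · rintro ⟨h1, h2⟩
      rw [← ENNReal.coe_toReal, ENNReal.toReal_le_toReal h2 ENNReal.coe_ne_top] at h1
      exact h1
    · intro h1
      have h2 : x ≠ ∞ := (h1.trans_lt ENNReal.coe_lt_top).ne
      refine ⟨?_, h2⟩
      rw [← ENNReal.coe_toReal, ENNReal.toReal_le_toReal h2 ENNReal.coe_ne_top]
      exact h1
  · rw [Set.Ioc_eq_empty (by linarith)]
    have : ENNReal.toReal ⁻¹' Set.Iic u ∩ {x | x ≠ ∞} = ∅ := by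
      ext x
      simp only [Set.mem_inter_iff, Set.mem_preimage, Set.mem_Iic, Set.mem_empty_iff_false,
        iff_false]
      rintro ⟨h1, -⟩
      linarith [ENNReal.toReal_nonneg (a := x)]
    simp [this]

theorem setLIntegral_eq [IsProbabilityMeasure k] (h : IsHazardLaw m k) (u : ℝ≥0) {f : ℝ → ℝ≥0∞}
    (hf : Measurable f) :
    ∫⁻ x in Set.Iic (u : ℝ≥0∞), f x.toReal ∂k
      = ∫⁻ x in Set.Ioc (0 : ℝ) u, f x * ENNReal.ofReal (hazardDensity m x) := by
  have hm : MeasurableSet {x : ℝ≥0∞ | x ≠ ∞} := (measurableSet_singleton ∞).compl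
  have e : Set.Iic (u : ℝ≥0∞) = ENNReal.toReal ⁻¹' Set.Iic (u : ℝ) ∩ {x | x ≠ ∞} := by
    ext x
    simp only [Set.mem_inter_iff, Set.mem_preimage, Set.mem_Iic, Set.mem_ofPred_eq]
    constructor
    · intro h1
      have h2 : x ≠ ∞ := (h1.trans_lt ENNReal.coe_lt_top).ne
      refine ⟨?_, h2⟩
      rw [← ENNReal.coe_toReal, ENNReal.toReal_le_toReal h2 ENNReal.coe_ne_top]
      exact h1
    · rintro ⟨h1, h2⟩
      rw [← ENNReal.coe_toReal, ENNReal.toReal_le_toReal h2 ENNReal.coe_ne_top] at h1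
      exact h1
  rw [e, ← Measure.restrict_restrict (ENNReal.measurable_toReal measurableSet_Iic),
    ← setLIntegral_map measurableSet_Iic hf ENNReal.measurable_toReal, h.map_toReal,
    restrict_withDensity measurableSet_Iic, Measure.restrict_restrict measurableSet_Iic,
    Set.inter_comm (Set.Iic (u : ℝ)) (Set.Ioi 0), Set.Ioi_inter_Iic,
    lintegral_withDensity_eq_lintegral_mul₀ _ hf.aemeasurable]
  · exact lintegral_congr fun x => mul_comm _ _
  · exact (h.aemeasurable_hazardDensity.mono_measure
      (Measure.restrict_mono Set.Ioc_subset_Ioi_self le_rfl)).ennreal_ofReal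

end IsHazardLaw
end NonLife
end

/-! ### Law of the report time: density and tail of accident time plus delay -/

noncomputable section
namespace NonLife

/-- `ρ` is a law on `[0, ∞)` with distribution function `α₀ + ∫_0^x g`. -/
structure IsDelayLaw (ρ : Measure ℝ≥0) (α₀ : ℝ) (g : ℝ → ℝ) : Prop where
  nonneg : ∀ x, 0 < x → 0 ≤ g x
  integrable : IntegrableOn g (Set.Ioi 0)
  cdf : ∀ x : ℝ≥0, ρ.real (Set.Iic x) = delayCDF α₀ g x

namespace IsDelayLaw

variable {ρ : Measure ℝ≥0} {α₀ : ℝ} {g : ℝ → ℝ}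

theorem atom_nonneg (h : IsDelayLaw ρ α₀ g) : 0 ≤ α₀ := by
  have h0 := h.cdf 0
  simp only [delayCDF, NNReal.coe_zero, intervalIntegral.integral_same, add_zero] at h0
  rw [← h0]
  exact measureReal_nonneg

theorem measure_Iic [IsProbabilityMeasure ρ] (h : IsDelayLaw ρ α₀ g) (v : ℝ≥0) :
    ρ (Set.Iic v) = ENNReal.ofReal α₀ + ∫⁻ y in Set.Ioc (0 : ℝ) v, ENNReal.ofReal (g y) := by
  have hnn : 0 ≤ᵐ[volume.restrict (Set.Ioc (0 : ℝ) v)] g := by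
    rw [EventuallyLE, ae_restrict_iff' measurableSet_Ioc]
    exact ae_of_all _ fun x hx => h.nonneg x hx.1
  rw [← ofReal_integral_eq_lintegral_ofReal (h.integrable.mono_set Set.Ioc_subset_Ioi_self) hnn,
    ← ENNReal.ofReal_add h.atom_nonneg (integral_nonneg_of_ae hnn),
    ← intervalIntegral.integral_of_le v.coe_nonneg]
  rw [← ofReal_measureReal, h.cdf, delayCDF]

end IsDelayLaw

theorem measurable_delayTail {ρ : Measure ℝ≥0} (u : ℝ≥0) :
    Measurable fun x : ℝ => ρ (Set.Iic (Real.toNNReal (u - x))) := by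
  have hanti : Antitone fun x : ℝ => ρ (Set.Iic (Real.toNNReal (u - x))) := fun x y hxy =>
    measure_mono (Set.Iic_subset_Iic.2 (Real.toNNReal_le_toNNReal (by linarith)))
  exact hanti.measurable

section ReportLaw

variable {m : ℝ → ℝ} {k r : Measure ℝ≥0∞} [IsProbabilityMeasure k] {ρ : Measure ℝ≥0}
  [IsProbabilityMeasure ρ] {α₀ : ℝ} {g : ℝ → ℝ}

/-- `r` is the law of the sum of independent variables with laws `k` and `ρ`. -/
def IsSumLaw (k : Measure ℝ≥0∞) (ρ : Measure ℝ≥0) (r : Measure ℝ≥0∞) : Prop :=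
  ∀ f : ℝ≥0∞ → ℝ≥0∞, Measurable f → ∫⁻ u, f u ∂r = ∫⁻ x, ∫⁻ y, f (x + (y : ℝ≥0∞)) ∂ρ ∂k

/-- The density of the report time, for a law with hazard rate `m`. -/
def reportRate (α₀ : ℝ) (g m : ℝ → ℝ) (s : ℝ) : ℝ :=
  α₀ * Real.exp (-cumHazard m s) * m s + ∫ u in (0 : ℝ)..s, g (s - u) * hazardDensity m u

/-- Conditioning on the accident time: the sum is at most `u` when the accident happens at some `x ≤
u` and the delay is at most `u - x`. -/
theorem IsSumLaw.measure_Iic (hr : IsSumLaw k ρ r) (hk : IsHazardLaw m k) (u : ℝ≥0) :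
    r (Set.Iic u) = ∫⁻ x in Set.Ioc (0 : ℝ) u,
      ρ (Set.Iic (Real.toNNReal (u - x))) * ENNReal.ofReal (hazardDensity m x) := by
  rw [← hk.setLIntegral_eq u (measurable_delayTail u), ← lintegral_indicator_one measurableSet_Iic,
    hr _ (measurable_one.indicator measurableSet_Iic), ← lintegral_indicator measurableSet_Iic]
  refine lintegral_congr fun x => ?_
  by_cases hx : x ≤ u
  · rw [Set.indicator_of_mem (show x ∈ Set.Iic (u : ℝ≥0∞) from hx)]
    obtain ⟨y, rfl⟩ : ∃ y : ℝ≥0, (y : ℝ≥0∞) = x :=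
      ⟨_, ENNReal.coe_toNNReal (hx.trans_lt ENNReal.coe_lt_top).ne⟩
    have hyu : y ≤ u := by exact_mod_cast hx
    rw [ENNReal.coe_toReal, ← NNReal.coe_sub hyu, Real.toNNReal_coe,
      ← lintegral_indicator_one measurableSet_Iic]
    refine lintegral_congr fun z => ?_
    have : ((y : ℝ≥0∞) + z ∈ Set.Iic (u : ℝ≥0∞)) ↔ z ∈ Set.Iic (u - y) := by
      rw [Set.mem_Iic, Set.mem_Iic, le_tsub_iff_left hyu]
      exact_mod_cast Iff.rfl
    classical
    simp only [Set.indicator_apply, this, Pi.one_apply]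
  · rw [Set.indicator_of_notMem (show x ∉ Set.Iic (u : ℝ≥0∞) from hx)]
    have : ∀ z : ℝ≥0, x + (z : ℝ≥0∞) ∉ Set.Iic (u : ℝ≥0∞) := fun z hz => hx (le_self_add.trans hz)
    simp [Set.indicator_of_notMem (this _)]

theorem setLIntegral_Ioc_sub (f : ℝ → ℝ≥0∞) (x u : ℝ) :
    ∫⁻ s in Set.Ioc x u, f (s - x) = ∫⁻ y in Set.Ioc 0 (u - x), f y := by
  rw [← lintegral_indicator measurableSet_Ioc, ← lintegral_indicator measurableSet_Ioc,
    ← lintegral_sub_right_eq_self ((Set.Ioc 0 (u - x)).indicator f) x]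
  refine lintegral_congr fun s => ?_
  classical
  simp only [Set.indicator_apply, Set.mem_Ioc, sub_pos, sub_le_sub_iff_right]

/-- Writing the delay distribution as atom plus integral of `g` and exchanging the order of
integration turns the distribution function of the sum into the integral of a convolution. The
convolution is kept as a measurable `[0, ∞]`-valued function `c`, since it may be infinite at
exceptional `s`; there the Bochner integral in `reportRate` and `toReal` both take the value `0`. -/
theorem exists_reportRate_eq (hk : IsHazardLaw m k) (hρ : IsDelayLaw ρ α₀ g) (hr : IsSumLaw k ρ r) :
    ∃ c : ℝ → ℝ≥0∞, Measurable c ∧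
      (∀ s, 0 < s → reportRate α₀ g m s = α₀ * hazardDensity m s + (c s).toReal) ∧
      ∀ u : ℝ≥0, r (Set.Iic u) = ∫⁻ s in Set.Ioc (0 : ℝ) u,
        (ENNReal.ofReal (α₀ * hazardDensity m s) + c s) := by
  classical
  have hgm : AEMeasurable (fun y => ENNReal.ofReal (g y)) (volume.restrict (Set.Ioi (0 : ℝ))) :=
    hρ.integrable.aemeasurable.ennreal_ofReal
  have hfm := hk.aemeasurable_hazardDensity.ennreal_ofReal
  obtain ⟨G, hG, hGe⟩ := hgm
  obtain ⟨f, hf, hfe⟩ := hfm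
  rw [EventuallyEq, ae_restrict_iff' measurableSet_Ioi] at hGe hfe
  -- The strict inequalities keep both arguments in `(0, ∞)`, the only region where `G` and `f`
  -- represent the density of the delay and that of the accident time.
  let D : Set (ℝ × ℝ) := {q | 0 < q.2 ∧ q.2 < q.1}
  have hD : MeasurableSet D := (measurableSet_lt measurable_const measurable_snd).inter
    (measurableSet_lt measurable_snd measurable_fst)
  let Φ : ℝ × ℝ → ℝ≥0∞ := D.indicator fun q => G (q.1 - q.2) * f q.2
  have hΦ : Measurable Φ := Measurable.indicator (by fun_prop) hD
  have hsec : ∀ s : ℝ, ∫⁻ x, Φ (s, x) = ∫⁻ x in Set.Ioo 0 s, G (s - x) * f x := fun s => by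
    rw [← lintegral_indicator measurableSet_Ioo]
    rfl
  refine ⟨fun s => ∫⁻ x, Φ (s, x), hΦ.lintegral_prod_right', fun s hs => ?_, fun u => ?_⟩
  · rw [reportRate, mul_assoc, hazardDensity]
    congr 1
    have hae : ∀ᵐ x, x ∈ Set.Ioo 0 s → ENNReal.ofReal (g (s - x) * hazardDensity m x)
        = G (s - x) * f x := by
      have h1 := (quasiMeasurePreserving_sub_left_of_right_invariant
        (volume : Measure ℝ) s).ae hGe
      filter_upwards [h1, hfe] with x hx1 hx2 hmem
      rw [ENNReal.ofReal_mul (hρ.nonneg _ (sub_pos.2 hmem.2)), hx1 (sub_pos.2 hmem.2), hx2 hmem.1]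
    have hnn : ∀ᵐ x, x ∈ Set.Ioo 0 s → 0 ≤ g (s - x) * hazardDensity m x := by
      filter_upwards [hk.ae_hazardDensity_nonneg] with x hx hmem
      exact mul_nonneg (hρ.nonneg _ (sub_pos.2 hmem.2)) (hx hmem.1)
    rw [intervalIntegral.integral_of_le hs.le, integral_Ioc_eq_integral_Ioo,
      integral_eq_lintegral_of_nonneg_ae]
    · change _ = (∫⁻ x, Φ (s, x)).toReal
      rw [hsec]
      congr 1
      exact setLIntegral_congr_fun_ae measurableSet_Ioo hae
    · rwa [EventuallyLE, ae_restrict_iff' measurableSet_Ioo]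
    · have : AEMeasurable (fun x => (G (s - x) * f x).toReal) (volume.restrict (Set.Ioo 0 s)) :=
        (Measurable.ennreal_toReal (by fun_prop)).aemeasurable
      refine (this.congr ?_).aestronglyMeasurable
      rw [EventuallyEq, ae_restrict_iff' measurableSet_Ioo]
      filter_upwards [hae, hnn] with x h1 h2 hmem
      rw [← h1 hmem, ENNReal.toReal_ofReal (h2 hmem)]
  · rw [hr.measure_Iic hk]
    have hfae : AEMeasurable (fun x => ENNReal.ofReal (hazardDensity m x))
        (volume.restrict (Set.Ioc (0 : ℝ) u)) :=
      (hk.aemeasurable_hazardDensity.mono_measure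
        (Measure.restrict_mono Set.Ioc_subset_Ioi_self le_rfl)).ennreal_ofReal
    have e1 : ∀ᵐ x, x ∈ Set.Ioc (0 : ℝ) u →
        ρ (Set.Iic (Real.toNNReal (u - x))) * ENNReal.ofReal (hazardDensity m x)
          = ENNReal.ofReal (α₀ * hazardDensity m x) + ∫⁻ s in Set.Ioc (0 : ℝ) u, Φ (s, x) := by
      filter_upwards [hfe] with x hx hmem
      rw [hρ.measure_Iic, Real.coe_toNNReal _ (sub_nonneg.2 hmem.2), add_mul,
        ENNReal.ofReal_mul hρ.atom_nonneg]
      congr 1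
      have e2 : ∫⁻ y in Set.Ioc 0 ((u : ℝ) - x), ENNReal.ofReal (g y)
          = ∫⁻ y in Set.Ioc 0 ((u : ℝ) - x), G y :=
        setLIntegral_congr_fun_ae measurableSet_Ioc
          (by filter_upwards [hGe] with y hy hmem using hy hmem.1)
      rw [e2, ← setLIntegral_Ioc_sub, hx hmem.1, ← lintegral_mul_const _ (by fun_prop),
        ← lintegral_indicator measurableSet_Ioc, ← lintegral_indicator measurableSet_Ioc]
      refine lintegral_congr fun s => ?_
      simp only [Set.indicator_apply, Set.mem_Ioc, Φ, D, Set.mem_ofPred_eq, hmem.1, true_and]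
      by_cases h1 : x < s
      · by_cases h2 : s ≤ u
        · simp [h1, h2, hmem.1.trans h1]
        · simp [h2]
      · simp [h1]
    rw [setLIntegral_congr_fun_ae measurableSet_Ioc e1, lintegral_add_left',
      lintegral_add_left']
    · congr 1
      -- Tonelli on the triangle `0 < x < s ≤ u`.
      rw [lintegral_lintegral_swap (by
        exact (hΦ.comp measurable_swap).aemeasurable)]
      refine setLIntegral_congr_fun measurableSet_Ioc fun s hs => ?_
      rw [← lintegral_indicator measurableSet_Ioc]
      refine lintegral_congr fun x => ?_
      by_cases hx : x ∈ Set.Ioc (0 : ℝ) u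
      · rw [Set.indicator_of_mem hx]
      · rw [Set.indicator_of_notMem hx]
        refine (Set.indicator_of_notMem (fun hmem => hx ⟨hmem.1, hmem.2.le.trans hs.2⟩) _).symm
    all_goals
      refine AEMeasurable.congr (hfae.const_mul (ENNReal.ofReal α₀)) ?_
      exact ae_of_all _ fun x => (ENNReal.ofReal_mul hρ.atom_nonneg).symm

/-- The integral of the `[0, ∞]`-valued density is a probability, so the density is finite almost
everywhere and agrees there with the real-valued rate. -/
theorem IsSumLaw.integral_reportRate [IsFiniteMeasure r] (hr : IsSumLaw k ρ r)
    (hk : IsHazardLaw m k) (hρ : IsDelayLaw ρ α₀ g) (u : ℝ≥0) :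
    IntervalIntegrable (reportRate α₀ g m) volume 0 u ∧
      r.real (Set.Iic u) = ∫ s in (0 : ℝ)..u, reportRate α₀ g m s := by
  obtain ⟨c, hc, hrate, hcdf⟩ := exists_reportRate_eq hk hρ hr
  have hfin : ∫⁻ s in Set.Ioc (0 : ℝ) u, (ENNReal.ofReal (α₀ * hazardDensity m s) + c s) ≠ ∞ := by
    rw [← hcdf]
    exact measure_ne_top _ _
  have hfae : AEMeasurable (hazardDensity m) (volume.restrict (Set.Ioc (0 : ℝ) u)) :=
    hk.aemeasurable_hazardDensity.mono_measure
      (Measure.restrict_mono Set.Ioc_subset_Ioi_self le_rfl)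
  have hmeas : AEMeasurable (fun s => ENNReal.ofReal (α₀ * hazardDensity m s) + c s)
      (volume.restrict (Set.Ioc (0 : ℝ) u)) := (hfae.const_mul _).ennreal_ofReal.add hc.aemeasurable
  have hlt := ae_lt_top' hmeas hfin
  rw [ae_restrict_iff' measurableSet_Ioc] at hlt
  have hae : ∀ᵐ s, s ∈ Set.Ioc (0 : ℝ) u → 0 ≤ reportRate α₀ g m s ∧
      ENNReal.ofReal (reportRate α₀ g m s) = ENNReal.ofReal (α₀ * hazardDensity m s) + c s := by
    filter_upwards [hlt, hk.ae_hazardDensity_nonneg] with s h1 h2 hmem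
    have h3 : 0 ≤ α₀ * hazardDensity m s := mul_nonneg hρ.atom_nonneg (h2 hmem.1)
    have h4 : c s ≠ ∞ := (lt_of_le_of_lt le_add_self (h1 hmem)).ne
    rw [hrate s hmem.1]
    refine ⟨add_nonneg h3 ENNReal.toReal_nonneg, ?_⟩
    rw [ENNReal.ofReal_add h3 ENNReal.toReal_nonneg, ENNReal.ofReal_toReal h4]
  have hnn : 0 ≤ᵐ[volume.restrict (Set.Ioc (0 : ℝ) u)] reportRate α₀ g m := by
    rw [EventuallyLE, ae_restrict_iff' measurableSet_Ioc]
    filter_upwards [hae] with s hs hmem using (hs hmem).1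
  have hlin : ∫⁻ s in Set.Ioc (0 : ℝ) u, ENNReal.ofReal (reportRate α₀ g m s) = r (Set.Iic u) := by
    rw [hcdf]
    exact setLIntegral_congr_fun_ae measurableSet_Ioc
      (by filter_upwards [hae] with s hs hmem using (hs hmem).2)
  have hsm : AEStronglyMeasurable (reportRate α₀ g m) (volume.restrict (Set.Ioc (0 : ℝ) u)) := by
    refine AEMeasurable.aestronglyMeasurable ?_
    refine ((hfae.const_mul α₀).add hc.ennreal_toReal.aemeasurable).congr ?_
    rw [EventuallyEq, ae_restrict_iff' measurableSet_Ioc]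
    exact ae_of_all _ fun s hs => (hrate s hs.1).symm
  constructor
  · rw [intervalIntegrable_iff_integrableOn_Ioc_of_le u.coe_nonneg]
    refine ⟨hsm, ?_⟩
    rw [hasFiniteIntegral_iff_ofReal hnn, hlin]
    exact measure_lt_top _ _
  · rw [intervalIntegral.integral_of_le u.coe_nonneg, integral_eq_lintegral_of_nonneg_ae hnn hsm,
      hlin]
    rfl

/-- Subtract `r [0, u] = ∫ G(u - x) f(x) dx` from `1 = exp (-Γ_u) + ∫ f`, both integrals over `[0,
u]`. -/
theorem IsSumLaw.measureReal_Ioi [IsProbabilityMeasure r] (hr : IsSumLaw k ρ r)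
    (hk : IsHazardLaw m k) (hρ : IsDelayLaw ρ α₀ g) (u : ℝ≥0) :
    r.real (Set.Ioi u) = Real.exp (-cumHazard m u)
      + ∫ x in (0 : ℝ)..u, (1 - delayCDF α₀ g (u - x)) * hazardDensity m x := by
  have hfae : AEMeasurable (hazardDensity m) (volume.restrict (Set.Ioc (0 : ℝ) u)) :=
    hk.aemeasurable_hazardDensity.mono_measure
      (Measure.restrict_mono Set.Ioc_subset_Ioi_self le_rfl)
  have hcdf : ∀ x ∈ Set.Ioc (0 : ℝ) u,
      delayCDF α₀ g (u - x) = (ρ (Set.Iic (Real.toNNReal (u - x)))).toReal := by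
    intro x hx
    have := hρ.cdf (Real.toNNReal (u - x))
    rw [Real.coe_toNNReal _ (sub_nonneg.2 hx.2)] at this
    exact this.symm
  have hnn : 0 ≤ᵐ[volume.restrict (Set.Ioc (0 : ℝ) u)]
      fun x => delayCDF α₀ g (u - x) * hazardDensity m x := by
    rw [EventuallyLE, ae_restrict_iff' measurableSet_Ioc]
    filter_upwards [hk.ae_hazardDensity_nonneg] with x hx hmem
    rw [hcdf x hmem]
    exact mul_nonneg ENNReal.toReal_nonneg (hx hmem.1)
  have hsm : AEStronglyMeasurable (fun x => delayCDF α₀ g (u - x) * hazardDensity m x)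
      (volume.restrict (Set.Ioc (0 : ℝ) u)) := by
    refine AEMeasurable.aestronglyMeasurable ?_
    refine ((measurable_delayTail (ρ := ρ) u).ennreal_toReal.aemeasurable.mul hfae).congr ?_
    rw [EventuallyEq, ae_restrict_iff' measurableSet_Ioc]
    exact ae_of_all _ fun x hx => by rw [Pi.mul_apply, hcdf x hx]
  have hlin : ∫⁻ x in Set.Ioc (0 : ℝ) u, ENNReal.ofReal (delayCDF α₀ g (u - x) * hazardDensity m x)
      = r (Set.Iic u) := by
    rw [hr.measure_Iic hk]
    refine setLIntegral_congr_fun measurableSet_Ioc fun x hx => ?_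
    rw [hcdf x hx, ENNReal.ofReal_mul ENNReal.toReal_nonneg, ENNReal.ofReal_toReal
      (measure_ne_top _ _)]
  have hint : IntervalIntegrable (fun x => delayCDF α₀ g (u - x) * hazardDensity m x)
      volume 0 u := by
    rw [intervalIntegrable_iff_integrableOn_Ioc_of_le u.coe_nonneg]
    refine ⟨hsm, ?_⟩
    rw [hasFiniteIntegral_iff_ofReal hnn, hlin]
    exact measure_lt_top _ _
  have hval : ∫ x in (0 : ℝ)..u, delayCDF α₀ g (u - x) * hazardDensity m x =
      r.real (Set.Iic u) := by
    rw [intervalIntegral.integral_of_le u.coe_nonneg, integral_eq_lintegral_of_nonneg_ae hnn hsm,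
      hlin]
    rfl
  have h1 := hk.integral_hazardDensity le_rfl u.coe_nonneg
  have h2 : cumHazard m 0 = 0 := by simp [cumHazard]
  simp only [sub_mul, one_mul]
  rw [intervalIntegral.integral_sub h1.1 hint, h1.2, hval, h2, ← Set.compl_Iic,
    probReal_compl_eq_one_sub measurableSet_Iic, neg_zero, Real.exp_zero]
  ring

end ReportLaw

/-- A delay only postpones, so this tail is at least that of the accident time, which is an
exponential. -/
theorem IsSumLaw.measure_Ioi_pos {m : ℝ → ℝ} {k r : Measure ℝ≥0∞} {ρ : Measure ℝ≥0}
    [IsProbabilityMeasure ρ] (hr : IsSumLaw k ρ r) (hk : IsHazardLaw m k) (u : ℝ≥0) :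
    0 < r (Set.Ioi u) := by
  have h1 : k (Set.Ioi (u : ℝ≥0∞)) ≤ r (Set.Ioi u) := by
    rw [← lintegral_indicator_one measurableSet_Ioi, ← lintegral_indicator_one measurableSet_Ioi,
      hr _ (measurable_one.indicator measurableSet_Ioi)]
    refine lintegral_mono fun x => ?_
    by_cases hx : x ∈ Set.Ioi (u : ℝ≥0∞)
    · rw [Set.indicator_of_mem hx]
      have : ∀ y : ℝ≥0, x + (y : ℝ≥0∞) ∈ Set.Ioi (u : ℝ≥0∞) := fun y =>
        Set.mem_Ioi.2 (lt_of_lt_of_le (Set.mem_Ioi.1 hx) le_self_add)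
      simp [Set.indicator_of_mem (this _)]
    · rw [Set.indicator_of_notMem hx]
      exact zero_le
  refine lt_of_lt_of_le ?_ h1
  rw [hk.tail]
  exact ENNReal.ofReal_pos.2 (Real.exp_pos _)

end NonLife
end

/-! ### The sources of information and their independence -/

noncomputable section
namespace NonLife

variable {Ω : Type*} {mΩ : MeasurableSpace Ω} {n : ℕ}

namespace Portfolio

variable (C : Portfolio Ω n)

/-- The developments of policy `i`, as one random sequence. -/
def dev (i : Fin n) (ω : Ω) (j : ℕ) : ℝ≥0∞ × ℝ≥0 := (C.devTime i j ω, C.devMark i j ω)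

/-- The information of the accident time of policy `i`. -/
@[reducible] def accidentInfo (i : Fin n) : MeasurableSpace Ω :=
  MeasurableSpace.comap (C.accidentTime i) inferInstance

/-- The information of the first mark of policy `i`. -/
@[reducible] def markInfo (i : Fin n) : MeasurableSpace Ω :=
  MeasurableSpace.comap (C.firstMark i) inferInstance

/-- The information of the delay of policy `i`. -/
@[reducible] def delayInfo (i : Fin n) : MeasurableSpace Ω := MeasurableSpace.comap (C.delay i)
    inferInstance

/-- The information of the developments of policy `i`. -/
@[reducible] def devInfo (i : Fin n) : MeasurableSpace Ω := MeasurableSpace.comap (C.dev i)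
    inferInstance

/-- All the information on policy `i` apart from its accident time. -/
@[reducible] def claimInfo (i : Fin n) : MeasurableSpace Ω := C.markInfo i ⊔ C.delayInfo i ⊔
    C.devInfo i

/-- The reference information and all policies except policy `i`. -/
@[reducible] def otherInfo (𝓕 : Filtration ℝ≥0 mΩ) (i : Fin n) : MeasurableSpace Ω :=
  (sigmaAt 𝓕 ∞ ⊔ ⨆ k ∈ ({i}ᶜ : Set (Fin n)), C.accidentInfo k)
    ⊔ ⨆ k ∈ ({i}ᶜ : Set (Fin n)), C.claimInfo k

theorem measurable_dev (i : Fin n) : Measurable (C.dev i) :=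
  measurable_pi_lambda _ fun j => (C.measurable_devTime i j).prodMk (C.measurable_devMark i j)

theorem accidentInfo_le (i : Fin n) : C.accidentInfo i ≤ mΩ :=
    (C.measurable_accidentTime i).comap_le
theorem markInfo_le (i : Fin n) : C.markInfo i ≤ mΩ := (C.measurable_firstMark i).comap_le
theorem delayInfo_le (i : Fin n) : C.delayInfo i ≤ mΩ := (C.measurable_delay i).comap_le
theorem devInfo_le (i : Fin n) : C.devInfo i ≤ mΩ := (C.measurable_dev i).comap_le
theorem claimInfo_le (i : Fin n) : C.claimInfo i ≤ mΩ :=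
  sup_le (sup_le (C.markInfo_le i) (C.delayInfo_le i)) (C.devInfo_le i)

theorem measurable_eventTime (i : Fin n) (j : ℕ) : Measurable (C.eventTime i j) := by
  have h : Measurable fun ω => C.accidentTime i ω + (C.delay i ω : ℝ≥0∞) :=
    (C.measurable_accidentTime i).add (C.measurable_delay i).coe_nnreal_ennreal
  cases j with
  | zero => exact h
  | succ j => exact h.add (C.measurable_devTime i j)

/-- The accident time is the report time minus the delay, also at `∞` because the delay is finite.
The assumption on developments, stated with report times, thus covers the accident times. -/
theorem iSup_report_eq :
    ⨆ i, MeasurableSpace.comap (fun ω => (C.eventTime i 0 ω, C.delay i ω, C.firstMark i ω))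
        inferInstance = (⨆ i, C.accidentInfo i) ⊔ (⨆ i, C.markInfo i) ⊔ ⨆ i, C.delayInfo i := by
  rw [← iSup_sup_eq, ← iSup_sup_eq]
  congr 1 with i : 1
  refine le_antisymm ?_ (sup_le (sup_le ?_ ?_) ?_)
  · rw [← measurable_iff_comap_le]
    have ha : Measurable[C.accidentInfo i ⊔ C.markInfo i ⊔ C.delayInfo i] (C.accidentTime i) :=
      (comap_measurable _).mono (le_sup_left.trans le_sup_left) le_rfl
    have hb : Measurable[C.accidentInfo i ⊔ C.markInfo i ⊔ C.delayInfo i] (C.firstMark i) :=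
      (comap_measurable _).mono (le_sup_right.trans le_sup_left) le_rfl
    have hd : Measurable[C.accidentInfo i ⊔ C.markInfo i ⊔ C.delayInfo i] (C.delay i) :=
      (comap_measurable _).mono le_sup_right le_rfl
    exact (ha.add hd.coe_nnreal_ennreal).prodMk (hd.prodMk hb)
  all_goals
    refine Measurable.comap_le ?_
    have hx := comap_measurable (m := inferInstance)
        (fun ω => (C.eventTime i 0 ω, C.delay i ω, C.firstMark i ω))
  · have h := hx.fst.sub hx.snd.fst.coe_nnreal_ennreal
    have e : C.accidentTime i = fun ω => C.eventTime i 0 ω - (C.delay i ω : ℝ≥0∞) := by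
      funext ω
      exact (ENNReal.add_sub_cancel_right ENNReal.coe_ne_top).symm
    rw [e]
    exact h
  · exact hx.snd.snd
  · exact hx.snd.fst

end Portfolio

theorem sigmaAt_le (𝓕 : Filtration ℝ≥0 mΩ) (t : ℝ≥0∞) : sigmaAt 𝓕 t ≤ mΩ :=
  iSup₂_le fun s _ => 𝓕.le s

theorem le_sigmaAt_top (𝓕 : Filtration ℝ≥0 mΩ) (t : ℝ≥0) : 𝓕 t ≤ sigmaAt 𝓕 ∞ :=
  le_iSup₂_of_le t le_top le_rfl

theorem _root_.ProbabilityTheory.Indep.mono {P : Measure Ω} {A A' B B' : MeasurableSpace Ω}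
    (h : Indep A B P) (hA : A' ≤ A) (hB : B' ≤ B) : Indep A' B' P :=
  indep_of_indep_of_le_left (indep_of_indep_of_le_right h hB) hA

namespace IsReducedForm

variable {P : Measure Ω} {𝓕 : Filtration ℝ≥0 mΩ} {C : Portfolio Ω n} {μ : ℝ≥0 → Ω → ℝ}

theorem markInfo_indep (h : IsReducedForm P 𝓕 C μ) :
    Indep (⨆ i, C.markInfo i) (sigmaAt 𝓕 ∞ ⊔ ⨆ i, C.accidentInfo i) P := h.firstMark_indep

theorem delayInfo_indep (h : IsReducedForm P 𝓕 C μ) :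
    Indep (⨆ i, C.delayInfo i)
      ((sigmaAt 𝓕 ∞ ⊔ ⨆ i, C.accidentInfo i) ⊔ ⨆ i, C.markInfo i) P := by
  refine h.delay_indep.mono le_rfl ?_
  rw [sup_assoc, ← iSup_sup_eq]
  refine sup_le_sup_left (iSup_mono fun i => ?_) _
  exact (MeasurableSpace.comap_prodMk (C.accidentTime i) (C.firstMark i)).ge

theorem devInfo_indep (h : IsReducedForm P 𝓕 C μ) :
    Indep (⨆ i, C.devInfo i) (((sigmaAt 𝓕 ∞ ⊔ ⨆ i, C.accidentInfo i) ⊔ ⨆ i, C.markInfo i)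
      ⊔ ⨆ i, C.delayInfo i) P := by
  refine h.dev_indep.mono le_rfl ?_
  rw [C.iSup_report_eq, sup_assoc, sup_assoc, sup_assoc]

theorem accident_sup_le (𝓕 : Filtration ℝ≥0 mΩ) (C : Portfolio Ω n) :
    (sigmaAt 𝓕 ∞ ⊔ ⨆ i, C.accidentInfo i) ≤ mΩ :=
  sup_le (sigmaAt_le 𝓕 ∞) (iSup_le C.accidentInfo_le)

variable [IsProbabilityMeasure P]

/-- Marks, delays and developments are added one layer at a time, each layer being independent of
all earlier ones. -/
theorem claimInfo_indep (h : IsReducedForm P 𝓕 C μ) :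
    Indep (sigmaAt 𝓕 ∞ ⊔ ⨆ i, C.accidentInfo i) (⨆ i, C.claimInfo i) P := by
  have h1 := Indep.sup_right (accident_sup_le 𝓕 C) (iSup_le C.markInfo_le) (iSup_le C.delayInfo_le)
    h.markInfo_indep.symm h.delayInfo_indep.symm
  refine (Indep.sup_right (accident_sup_le 𝓕 C) (sup_le (iSup_le C.markInfo_le)
    (iSup_le C.delayInfo_le)) (iSup_le C.devInfo_le) h1 ?_).mono le_rfl ?_
  · rw [← sup_assoc]
    exact h.devInfo_indep.symm
  · exact iSup_le fun i => sup_le_sup (sup_le_sup (le_iSup _ i) (le_iSup _ i)) (le_iSup _ i)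

/-- Mutual independence across policies separates the developments of `i` from those of the others;
independence of the layer as a whole then adds everything else. Delays and marks are treated in the
same way below, with the later layers joined last. -/
theorem devInfo_indep_other (h : IsReducedForm P 𝓕 C μ) (i : Fin n) :
    Indep (C.devInfo i) ((⨆ k ∈ ({i}ᶜ : Set (Fin n)), C.devInfo k)
      ⊔ (((sigmaAt 𝓕 ∞ ⊔ ⨆ i, C.accidentInfo i) ⊔ ⨆ i, C.markInfo i)
      ⊔ ⨆ i, C.delayInfo i)) P := by
  have h0 : Indep (⨆ k ∈ ({i} : Set (Fin n)), C.devInfo k)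
      (⨆ k ∈ ({i}ᶜ : Set (Fin n)), C.devInfo k) P :=
    indep_iSup_of_disjoint C.devInfo_le h.dev_iIndep.iIndep disjoint_compl_right
  rw [iSup_singleton] at h0
  refine Indep.sup_right (C.devInfo_le i) (iSup₂_le fun k _ => C.devInfo_le k) (sup_le (sup_le
    (accident_sup_le 𝓕 C) (iSup_le C.markInfo_le)) (iSup_le C.delayInfo_le)) h0 ?_
  exact h.devInfo_indep.mono (sup_le (le_iSup _ i) (iSup₂_le fun k _ => le_iSup _ k)) le_rfl

theorem delayInfo_indep_other (h : IsReducedForm P 𝓕 C μ) (i : Fin n) :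
    Indep (C.delayInfo i) (((⨆ k ∈ ({i}ᶜ : Set (Fin n)), C.delayInfo k)
      ⊔ ((sigmaAt 𝓕 ∞ ⊔ ⨆ i, C.accidentInfo i) ⊔ ⨆ i, C.markInfo i))
      ⊔ ⨆ i, C.devInfo i) P := by
  have h0 : Indep (⨆ k ∈ ({i} : Set (Fin n)), C.delayInfo k)
      (⨆ k ∈ ({i}ᶜ : Set (Fin n)), C.delayInfo k) P :=
    indep_iSup_of_disjoint C.delayInfo_le h.delay_iIndep.iIndep disjoint_compl_right
  rw [iSup_singleton] at h0
  have h1 := Indep.sup_right (C.delayInfo_le i) (iSup₂_le fun k _ => C.delayInfo_le k)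
    (sup_le (accident_sup_le 𝓕 C) (iSup_le C.markInfo_le)) h0
    (h.delayInfo_indep.mono (sup_le (le_iSup _ i) (iSup₂_le fun k _ => le_iSup _ k)) le_rfl)
  refine Indep.sup_right (C.delayInfo_le i) (sup_le (iSup₂_le fun k _ => C.delayInfo_le k)
    (sup_le (accident_sup_le 𝓕 C) (iSup_le C.markInfo_le))) (iSup_le C.devInfo_le) h1 ?_
  refine h.devInfo_indep.symm.mono (sup_le ?_ (sup_le ?_ le_sup_left)) le_rfl
  · exact (le_iSup _ i).trans le_sup_right
  · exact (iSup₂_le fun k _ => le_iSup _ k).trans le_sup_right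

theorem markInfo_indep_other (h : IsReducedForm P 𝓕 C μ) (i : Fin n) :
    Indep (C.markInfo i) ((((⨆ k ∈ ({i}ᶜ : Set (Fin n)), C.markInfo k)
      ⊔ (sigmaAt 𝓕 ∞ ⊔ ⨆ i, C.accidentInfo i)) ⊔ ⨆ i, C.delayInfo i) ⊔ ⨆ i, C.devInfo i) P := by
  have h0 : Indep (⨆ k ∈ ({i} : Set (Fin n)), C.markInfo k)
      (⨆ k ∈ ({i}ᶜ : Set (Fin n)), C.markInfo k) P :=
    indep_iSup_of_disjoint C.markInfo_le h.firstMark_iIndep.iIndep disjoint_compl_right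
  rw [iSup_singleton] at h0
  have hB : (⨆ k ∈ ({i}ᶜ : Set (Fin n)), C.markInfo k) ≤ ⨆ i, C.markInfo i :=
    iSup₂_le fun k _ => le_iSup _ k
  have hB' : (⨆ k ∈ ({i}ᶜ : Set (Fin n)), C.markInfo k) ≤ mΩ := hB.trans (iSup_le C.markInfo_le)
  have h1 := Indep.sup_right (C.markInfo_le i) hB' (accident_sup_le 𝓕 C) h0
    (h.markInfo_indep.mono (sup_le (le_iSup _ i) hB) le_rfl)
  have h2 := Indep.sup_right (C.markInfo_le i) (sup_le hB' (accident_sup_le 𝓕 C))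
    (iSup_le C.delayInfo_le) h1 (h.delayInfo_indep.symm.mono
      (sup_le ((le_iSup _ i).trans le_sup_right)
        (sup_le (hB.trans le_sup_right) le_sup_left)) le_rfl)
  refine Indep.sup_right (C.markInfo_le i) (sup_le (sup_le hB' (accident_sup_le 𝓕 C))
    (iSup_le C.delayInfo_le)) (iSup_le C.devInfo_le) h2 ?_
  refine h.devInfo_indep.symm.mono (sup_le ?_ (sup_le (sup_le ?_ ?_) le_sup_right)) le_rfl
  · exact ((le_iSup _ i).trans le_sup_right).trans le_sup_left
  · exact (hB.trans le_sup_right).trans le_sup_left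
  · exact le_sup_left.trans le_sup_left

end IsReducedForm

namespace Portfolio

variable (C : Portfolio Ω n) (𝓕 : Filtration ℝ≥0 mΩ) (i : Fin n)

theorem otherInfo_le : C.otherInfo 𝓕 i ≤ mΩ :=
  sup_le (sup_le (sigmaAt_le _ _) (iSup₂_le fun k _ => C.accidentInfo_le k))
    (iSup₂_le fun k _ => C.claimInfo_le k)

theorem otherInfo_le_of_le {m : MeasurableSpace Ω} (h1 : sigmaAt 𝓕 ∞ ≤ m)
    (h2 : ∀ k, C.accidentInfo k ≤ m) (h3 : ∀ k ∈ ({i}ᶜ : Set (Fin n)), C.markInfo k ≤ m)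
    (h4 : ∀ k ∈ ({i}ᶜ : Set (Fin n)), C.delayInfo k ≤ m)
    (h5 : ∀ k ∈ ({i}ᶜ : Set (Fin n)), C.devInfo k ≤ m) : C.otherInfo 𝓕 i ≤ m :=
  sup_le (sup_le h1 (iSup₂_le fun k _ => h2 k))
    (iSup₂_le fun k hk => sup_le (sup_le (h3 k hk) (h4 k hk)) (h5 k hk))

end Portfolio

namespace IsReducedForm

variable {P : Measure Ω} [IsProbabilityMeasure P] {𝓕 : Filtration ℝ≥0 mΩ} {C : Portfolio Ω n}
  {μ : ℝ≥0 → Ω → ℝ}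

theorem devInfo_indep_otherInfo (h : IsReducedForm P 𝓕 C μ) (i : Fin n) :
    Indep (C.otherInfo 𝓕 i ⊔ (C.accidentInfo i ⊔ C.delayInfo i ⊔ C.markInfo i)) (C.devInfo i) P :=
        by
  refine (h.devInfo_indep_other i).symm.mono (sup_le (C.otherInfo_le_of_le 𝓕 i ?_ ?_ ?_ ?_ ?_)
    (sup_le (sup_le ?_ ?_) ?_)) le_rfl
  · exact ((le_sup_left.trans le_sup_left).trans le_sup_left).trans le_sup_right
  · exact fun k => ((((le_iSup _ k).trans le_sup_right).trans le_sup_left).trans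
      le_sup_left).trans le_sup_right
  · exact fun k _ => (((le_iSup _ k).trans le_sup_right).trans le_sup_left).trans le_sup_right
  · exact fun k _ => ((le_iSup _ k).trans le_sup_right).trans le_sup_right
  · exact fun k hk => (le_biSup _ hk).trans le_sup_left
  · exact ((((le_iSup _ i).trans le_sup_right).trans le_sup_left).trans
      le_sup_left).trans le_sup_right
  · exact ((le_iSup _ i).trans le_sup_right).trans le_sup_right
  · exact (((le_iSup _ i).trans le_sup_right).trans le_sup_left).trans le_sup_right

theorem delayInfo_indep_otherInfo (h : IsReducedForm P 𝓕 C μ) (i : Fin n) :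
    Indep (C.otherInfo 𝓕 i ⊔ C.accidentInfo i) (C.delayInfo i) P := by
  refine (h.delayInfo_indep_other i).symm.mono (sup_le (C.otherInfo_le_of_le 𝓕 i ?_ ?_ ?_ ?_ ?_)
    ?_) le_rfl
  · exact ((le_sup_left.trans le_sup_left).trans le_sup_right).trans le_sup_left
  · exact fun k => ((((le_iSup _ k).trans le_sup_right).trans le_sup_left).trans
      le_sup_right).trans le_sup_left
  · exact fun k _ => (((le_iSup _ k).trans le_sup_right).trans le_sup_right).trans le_sup_left
  · exact fun k hk => ((le_biSup _ hk).trans le_sup_left).trans le_sup_left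
  · exact fun k _ => (le_iSup _ k).trans le_sup_right
  · exact ((((le_iSup _ i).trans le_sup_right).trans le_sup_left).trans
      le_sup_right).trans le_sup_left

theorem markInfo_indep_otherInfo (h : IsReducedForm P 𝓕 C μ) (i : Fin n) :
    Indep (C.otherInfo 𝓕 i ⊔ (C.accidentInfo i ⊔ C.delayInfo i)) (C.markInfo i) P := by
  refine (h.markInfo_indep_other i).symm.mono (sup_le (C.otherInfo_le_of_le 𝓕 i ?_ ?_ ?_ ?_ ?_)
    (sup_le ?_ ?_)) le_rfl
  · exact ((le_sup_left.trans le_sup_right).trans le_sup_left).trans le_sup_left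
  · exact fun k => ((((le_iSup _ k).trans le_sup_right).trans le_sup_right).trans
      le_sup_left).trans le_sup_left
  · exact fun k hk => (((le_biSup _ hk).trans le_sup_left).trans le_sup_left).trans
      le_sup_left
  · exact fun k _ => ((le_iSup _ k).trans le_sup_right).trans le_sup_left
  · exact fun k _ => (le_iSup _ k).trans le_sup_right
  · exact ((((le_iSup _ i).trans le_sup_right).trans le_sup_right).trans
      le_sup_left).trans le_sup_left
  · exact ((le_iSup _ i).trans le_sup_right).trans le_sup_left

end IsReducedForm
end NonLife
end

/-! ### Conditional expectations in `[0, ∞]` and disintegration -/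

noncomputable section
namespace NonLife

variable {Ω : Type*} {mΩ : MeasurableSpace Ω} {P : Measure Ω}

theorem lintegral_mul_eq_of_setLIntegral_eq {m : MeasurableSpace Ω} (hm : m ≤ mΩ)
    {V W : Ω → ℝ≥0∞} (hV : AEMeasurable V P) (hW : AEMeasurable W P)
    (h : ∀ A, MeasurableSet[m] A → ∫⁻ ω in A, V ω ∂P = ∫⁻ ω in A, W ω ∂P)
    {f : Ω → ℝ≥0∞} (hf : Measurable[m] f) : ∫⁻ ω, f ω * V ω ∂P = ∫⁻ ω, f ω * W ω ∂P := by
  have hval : ∀ U : Ω → ℝ≥0∞, AEMeasurable U P →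
      ∫⁻ ω, f ω * U ω ∂P = ∫⁻ ω, f ω ∂((P.withDensity U).trim hm) := fun U hU => by
    rw [lintegral_trim hm hf, lintegral_withDensity_eq_lintegral_mul₀ hU
        (hf.mono hm le_rfl).aemeasurable]
    exact lintegral_congr fun ω => mul_comm _ _
  rw [hval V hV, hval W hW]
  congr 1
  refine @Measure.ext _ m _ _ fun A hA => ?_
  rw [trim_measurableSet_eq hm hA, trim_measurableSet_eq hm hA, withDensity_apply _ (hm _ hA),
    withDensity_apply _ (hm _ hA), h A hA]

theorem lintegral_mul_condLExp [IsProbabilityMeasure P] {m : MeasurableSpace Ω} (hm : m ≤ mΩ)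
    {V : Ω → ℝ≥0∞}
    (hV : AEMeasurable V P) {f : Ω → ℝ≥0∞} (hf : Measurable[m] f) :
    ∫⁻ ω, f ω * V ω ∂P = ∫⁻ ω, f ω * (P⁻[V|m]) ω ∂P :=
  lintegral_mul_eq_of_setLIntegral_eq hm hV (measurable_condLExp' m P V).aemeasurable
    (fun _ hA => (setLIntegral_condLExp hm P V hA).symm) hf

theorem condLExp_mul_left [IsProbabilityMeasure P] {m : MeasurableSpace Ω} (hm : m ≤ mΩ)
    {V : Ω → ℝ≥0∞}
    (hV : AEMeasurable V P) {f : Ω → ℝ≥0∞} (hf : Measurable[m] f) :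
    P⁻[fun ω => f ω * V ω|m] =ᵐ[P] fun ω => f ω * (P⁻[V|m]) ω := by
  refine (ae_eq_condLExp hm P _ (hf.mul (measurable_condLExp m P V)) fun A hA => ?_).symm
  have h := lintegral_mul_condLExp hm hV (hf.indicator hA)
  rw [← lintegral_indicator (hm _ hA), ← lintegral_indicator (hm _ hA)]
  simp only [Set.indicator_mul_left]
  refine Eq.trans (lintegral_congr fun ω => ?_) h.symm
  exact Set.indicator_mul_left A f (P⁻[V|m])

theorem condLExp_indicator_one [IsProbabilityMeasure P] (m : MeasurableSpace Ω) {S : Set Ω}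
    (hS : MeasurableSet[mΩ] S) :
    P⁻[S.indicator 1|m] =ᵐ[P] fun ω => ENNReal.ofReal (condProb P S m ω) := by
  have h := condLExp_ofReal m (μ := P) (f := S.indicator fun _ => (1 : ℝ))
    ((integrable_const 1).indicator hS) (ae_of_all _ fun ω => Set.indicator_nonneg (by simp) ω)
  have e : (fun ω => ENNReal.ofReal (S.indicator (fun _ => (1 : ℝ)) ω)) = S.indicator 1 := by
    funext ω
    classical
    by_cases hω : ω ∈ S <;> simp [hω]
  rw [e] at h
  exact h

theorem setLIntegral_indicator_one {S A : Set Ω} (hS : MeasurableSet S) :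
    ∫⁻ ω in A, S.indicator 1 ω ∂P = P (A ∩ S) := by
  rw [lintegral_indicator_one hS, Measure.restrict_apply hS, Set.inter_comm]

/-- An independent `U` only multiplies both integrals by `P u` on the sets `a ∩ u`. Information that
is independent of everything involved can thus be added to the conditioning for free. -/
theorem setLIntegral_eq_of_indep {A B U : MeasurableSpace Ω} (hB : B ≤ mΩ) (hU : U ≤ mΩ)
    (hAB : A ≤ B) (hind : Indep B U P) {V W : Ω → ℝ≥0∞} (hV : Measurable[B] V)
    (hW : Measurable[B] W) (hfin : ∫⁻ ω, V ω ∂P ≠ ∞)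
    (h : ∀ a, MeasurableSet[A] a → ∫⁻ ω in a, V ω ∂P = ∫⁻ ω in a, W ω ∂P)
    {s : Set Ω} (hs : MeasurableSet[A ⊔ U] s) :
    ∫⁻ ω in s, V ω ∂P = ∫⁻ ω in s, W ω ∂P := by
  refine setLIntegral_eq_of_generateFrom_inter (m₁ := A) (m₂ := U)
    (@MeasurableSpace.generateFrom_measurableSet _ A).symm
    (@MeasurableSpace.generateFrom_measurableSet _ U).symm (hAB.trans hB) hU
    (@MeasurableSpace.isPiSystem_measurableSet _ A)
    (@MeasurableSpace.isPiSystem_measurableSet _ U) (@MeasurableSet.univ _ A)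
    (@MeasurableSet.univ _ U) hfin ?_ hs
  intro a ha u hu
  have hval : ∀ X : Ω → ℝ≥0∞, Measurable[B] X →
      ∫⁻ ω in a ∩ u, X ω ∂P = (∫⁻ ω in a, X ω ∂P) * P u := fun X hX => by
    rw [← lintegral_indicator (hB _ (hAB _ ha)), ← lintegral_indicator_one (hU _ hu),
      ← lintegral_mul_eq_lintegral_mul_lintegral_of_independent_measurableSpace hB hU hind
        (hX.indicator (hAB _ ha)) (measurable_one.indicator hu),
      ← lintegral_indicator ((hB _ (hAB _ ha)).inter (hU _ hu))]
    refine lintegral_congr fun ω => ?_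
    by_cases h1 : ω ∈ a <;> by_cases h2 : ω ∈ u <;> simp [h1, h2]
  rw [hval V hV, hval W hW, h a ha]

theorem setLIntegral_condDistrib [IsProbabilityMeasure P] {β : Type*} [MeasurableSpace β]
    {X : Ω → β} (hX : Measurable X) {Y : Ω → ℝ≥0∞} (hY : Measurable Y) {A : Set β}
    (hA : MeasurableSet A) {s : Set ℝ≥0∞} (hs : MeasurableSet s) :
    ∫⁻ ω in X ⁻¹' A, condDistrib Y X P (X ω) s ∂P = P (X ⁻¹' A ∩ Y ⁻¹' s) := by
  have h : (P.map X ⊗ₘ condDistrib Y X P) (A ×ˢ s) = P.map (fun ω => (X ω, Y ω)) (A ×ˢ s) := by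
    rw [compProd_map_condDistrib hY.aemeasurable]
  rw [Measure.compProd_apply_prod hA hs, Measure.map_apply (hX.prodMk hY) (hA.prod hs),
    setLIntegral_map hA (Kernel.measurable_coe _ hs) hX] at h
  exact h

/-- For fixed `A` both sides of the hypothesis are finite measures in the value of `Y`, and the
tails `(s, ∞]` form a π-system generating the Borel sets of `[0, ∞]`. So a kernel with the right
tails is the conditional law. -/
theorem lintegral_comp_kernel [IsProbabilityMeasure P] {β : Type*} [MeasurableSpace β]
    {X : Ω → β} (hX : Measurable X) {Y : Ω → ℝ≥0∞} (hY : Measurable Y) (κ : Kernel β ℝ≥0∞)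
    [IsMarkovKernel κ] (h : ∀ s : ℝ≥0, ∀ A, MeasurableSet A →
      P (X ⁻¹' A ∩ {ω | (s : ℝ≥0∞) < Y ω}) = ∫⁻ ω in X ⁻¹' A, κ (X ω) (Set.Ioi s) ∂P)
    {F : β × ℝ≥0∞ → ℝ≥0∞} (hF : Measurable F) :
    ∫⁻ ω, F (X ω, Y ω) ∂P = ∫⁻ ω, ∫⁻ x, F (X ω, x) ∂κ (X ω) ∂P := by
  have hprob : IsProbabilityMeasure (P.map X) := Measure.isProbabilityMeasure_map hX.aemeasurable
  have key : P.map (fun ω => (X ω, Y ω)) = P.map X ⊗ₘ κ := by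
    refine Measure.ext_prod fun {A} {s} hA hs => ?_
    rw [Measure.map_apply (hX.prodMk hY) (hA.prod hs), Measure.compProd_apply_prod hA hs,
      setLIntegral_map hA (Kernel.measurable_coe _ hs) hX]
    have hκ : AEMeasurable (fun ω => κ (X ω)) (P.restrict (X ⁻¹' A)) :=
      (κ.measurable.comp hX).aemeasurable
    have hν : (P.restrict (X ⁻¹' A)).map Y
        = Measure.bind (P.restrict (X ⁻¹' A)) fun ω => κ (X ω) := by
      refine ext_of_generate_finite (Set.range Set.Ioi) ?_ isPiSystem_Ioi ?_ ?_
      · rw [← borel_eq_generateFrom_Ioi]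
        exact BorelSpace.measurable_eq
      · rintro _ ⟨r, rfl⟩
        rw [Measure.map_apply hY measurableSet_Ioi, Measure.bind_apply measurableSet_Ioi hκ,
          Measure.restrict_apply (hY measurableSet_Ioi)]
        rcases eq_or_ne r ∞ with rfl | hr
        · simp
        · lift r to ℝ≥0 using hr
          rw [← h r A hA, Set.inter_comm]
          rfl
      · rw [Measure.map_apply hY MeasurableSet.univ, Measure.bind_apply MeasurableSet.univ hκ]
        simp
    have h1 : (P.restrict (X ⁻¹' A)).map Y s
        = Measure.bind (P.restrict (X ⁻¹' A)) (fun ω => κ (X ω)) s := by rw [hν]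
    rw [Measure.map_apply hY hs, Measure.bind_apply hs hκ, Measure.restrict_apply (hY hs)] at h1
    rw [← h1, Set.inter_comm]
    rfl
  rw [← lintegral_map hF (hX.prodMk hY), key, Measure.lintegral_compProd hF,
    lintegral_map (Measurable.lintegral_kernel_prod_right' hF) hX]

end NonLife
end

/-! ### Survival of one policy given all the others -/

noncomputable section
namespace NonLife

variable {Ω : Type*} {mΩ : MeasurableSpace Ω} {n : ℕ}

section GenerateFrom

variable {ι : Type*} (f : ι → Ω → ℝ≥0∞) (S : Set ι)

/-- The tail events of the variables `f k`, `k ∈ S`. -/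
def tailEvents : Set (Set Ω) := piiUnionInter (fun k => Set.range fun r => {ω | r < f k ω}) S

theorem isPiSystem_tailEvents : IsPiSystem (tailEvents f S) := by
  refine isPiSystem_piiUnionInter _ (fun k => ?_) S
  rintro _ ⟨r, rfl⟩ _ ⟨r', rfl⟩ _
  exact ⟨max r r', by ext ω; simp⟩

theorem univ_mem_tailEvents : Set.univ ∈ tailEvents f S :=
  ⟨∅, by simp, fun _ => Set.univ, by simp, by simp⟩

theorem iSup_comap_eq_generateFrom_tailEvents :
    ⨆ k ∈ S, MeasurableSpace.comap (f k) inferInstance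
      = MeasurableSpace.generateFrom (tailEvents f S) := by
  have h : ∀ k, MeasurableSpace.comap (f k) inferInstance
      = MeasurableSpace.generateFrom (Set.range fun r => {ω | r < f k ω}) := fun k => by
    rw [show (inferInstance : MeasurableSpace ℝ≥0∞) = borel ℝ≥0∞ from BorelSpace.measurable_eq,
      borel_eq_generateFrom_Ioi, MeasurableSpace.comap_generateFrom, ← Set.range_comp]
    rfl
  refine le_antisymm (iSup₂_le fun k hk => ?_) ?_
  · rw [h]
    exact le_generateFrom_piiUnionInter (π := fun k => Set.range fun r => {ω | r < f k ω}) S hk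
  · refine MeasurableSpace.generateFrom_le ?_
    rintro _ ⟨t, ht, g, hg, rfl⟩
    refine t.measurableSet_biInter fun k hk => ?_
    have hle : MeasurableSpace.comap (f k) inferInstance
        ≤ ⨆ k ∈ S, MeasurableSpace.comap (f k) inferInstance :=
      le_biSup (fun k => MeasurableSpace.comap (f k) inferInstance) (ht hk)
    refine hle _ ?_
    rw [h]
    exact MeasurableSpace.measurableSet_generateFrom (hg k hk)

theorem exists_of_mem_tailEvents {f : ι → Ω → ℝ≥0∞} {S : Set ι} {s : Set Ω}
    (hs : s ∈ tailEvents f S) :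
    ∃ (t : Finset ι) (r : ι → ℝ≥0∞), ↑t ⊆ S ∧ s = {ω | ∀ k ∈ t, r k < f k ω} := by
  classical
  obtain ⟨t, ht, g, hg, rfl⟩ := hs
  choose! r hr using hg
  refine ⟨t, r, ht, ?_⟩
  ext ω
  simp only [Set.mem_iInter, Set.mem_ofPred_eq]
  refine forall₂_congr fun k hk => ?_
  rw [← hr k hk]
  rfl

end GenerateFrom

variable {P : Measure Ω} {𝓕 : Filtration ℝ≥0 mΩ} {C : Portfolio Ω n} {μ : ℝ≥0 → Ω → ℝ}

/-- The conditional probability that policy `i` has no accident until time `s`. -/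
def survival (P : Measure Ω) (𝓕 : Filtration ℝ≥0 mΩ) (C : Portfolio Ω n) (i : Fin n) (s : ℝ≥0)
    (ω : Ω) : ℝ≥0∞ :=
  ENNReal.ofReal (condProb P {ω | (s : ℝ≥0∞) < C.accidentTime i ω} (𝓕 s) ω)

theorem measurable_survival (i : Fin n) (s : ℝ≥0) : Measurable[𝓕 s] (survival P 𝓕 C i s) :=
  (stronglyMeasurable_condExp.measurable).ennreal_ofReal

theorem measurable_survival_top (i : Fin n) (s : ℝ≥0) :
    Measurable[sigmaAt 𝓕 ∞] (survival P 𝓕 C i s) :=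
  (measurable_survival i s).mono (le_sigmaAt_top 𝓕 s) le_rfl

theorem measurableSet_accident_lt (i : Fin n) (s : ℝ≥0∞) :
    MeasurableSet {ω | s < C.accidentTime i ω} :=
  measurableSet_lt measurable_const (C.measurable_accidentTime i)

theorem measurableSet_forall_accident_lt (t : Finset (Fin n)) (r : Fin n → ℝ≥0∞) :
    MeasurableSet {ω | ∀ k ∈ t, r k < C.accidentTime k ω} := by
  have : {ω | ∀ k ∈ t, r k < C.accidentTime k ω} = ⋂ k ∈ t, {ω | r k < C.accidentTime k ω} := by
    ext; simp
  rw [this]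
  exact t.measurableSet_biInter fun k _ => measurableSet_accident_lt k _

theorem condProb_nonneg (S : Set Ω) (m : MeasurableSpace Ω) : 0 ≤ᵐ[P] condProb P S m :=
  condExp_nonneg (ae_of_all _ fun ω => Set.indicator_nonneg (by simp) ω)

namespace IsReducedForm

variable [IsProbabilityMeasure P]

theorem survival_ae_eq (h : IsReducedForm P 𝓕 C μ) (i : Fin n) (s : ℝ≥0) :
    survival P 𝓕 C i s =ᵐ[P] fun ω => ENNReal.ofReal (Real.exp (-hazard μ s ω)) := by
  have hS := measurableSet_accident_lt (C := C) i s
  have e : {ω | C.accidentTime i ω ≤ s}.indicator (fun _ => (1 : ℝ))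
      = (fun _ => (1 : ℝ)) - {ω | (s : ℝ≥0∞) < C.accidentTime i ω}.indicator fun _ => (1 : ℝ) := by
    rw [← Set.indicator_compl]
    congr 1
    ext ω
    simp
  have h1 := condExp_sub (μ := P) (integrable_const (1 : ℝ))
    ((integrable_const (1 : ℝ)).indicator hS) (𝓕 s)
  rw [← e, condExp_const (𝓕.le s)] at h1
  filter_upwards [h.accident_intensity i s, h1] with ω h2 h3
  rw [survival, h2]
  simp only [condProb] at h3 ⊢
  rw [h3]
  simp

theorem survival_zero (h : IsReducedForm P 𝓕 C μ) (i : Fin n) : survival P 𝓕 C i 0 =ᵐ[P] 1 := by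
  filter_upwards [h.survival_ae_eq i 0] with ω hω
  rw [hω]
  simp [hazard]

/-- Conditional independence is used at `t = ∞`. Each factor given `𝓕_∞` then equals the one given
`𝓕 (r k)`, so the product involves the reference information only up to the thresholds. -/
theorem condLExp_accident (h : IsReducedForm P 𝓕 C μ) (r : Fin n → ℝ≥0) :
    P⁻[{ω | ∀ k, (r k : ℝ≥0∞) < C.accidentTime k ω}.indicator 1|sigmaAt 𝓕 ∞]
      =ᵐ[P] fun ω => ∏ k, survival P 𝓕 C k (r k) ω := by
  have hS : MeasurableSet {ω | ∀ k, (r k : ℝ≥0∞) < C.accidentTime k ω} := by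
    simpa using measurableSet_forall_accident_lt (C := C) Finset.univ fun k => (r k : ℝ≥0∞)
  have h1 := h.accident_condIndep ∞ r fun _ => le_top
  have h2 : ∀ᵐ ω ∂P, ∀ k, condProb P {ω | (r k : ℝ≥0∞) < C.accidentTime k ω} (sigmaAt 𝓕 ∞) ω
      = condProb P {ω | (r k : ℝ≥0∞) < C.accidentTime k ω} (𝓕 (r k)) ω :=
    ae_all_iff.2 fun k => h.accident_condProb k ∞ (r k) le_top
  have h3 : ∀ᵐ ω ∂P, ∀ k, 0 ≤ condProb P {ω | (r k : ℝ≥0∞) < C.accidentTime k ω} (𝓕 (r k)) ω :=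
    ae_all_iff.2 fun k => condProb_nonneg _ _
  filter_upwards [condLExp_indicator_one (P := P) (sigmaAt 𝓕 ∞) hS, h1, h2, h3] with ω e1 e2 e3 e4
  rw [e1, e2, ENNReal.ofReal_prod_of_nonneg fun k _ => by rw [e3]; exact e4 k]
  exact Finset.prod_congr rfl fun k _ => by rw [e3, survival]

/-- Policies outside `t` get the threshold `0`, which imposes nothing because accident times are
a.s. positive. -/
theorem condLExp_accident_finset (h : IsReducedForm P 𝓕 C μ) (t : Finset (Fin n))
    (r : Fin n → ℝ≥0) :
    P⁻[{ω | ∀ k ∈ t, (r k : ℝ≥0∞) < C.accidentTime k ω}.indicator 1|sigmaAt 𝓕 ∞]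
      =ᵐ[P] fun ω => ∏ k ∈ t, survival P 𝓕 C k (r k) ω := by
  classical
  have h0 : ∀ᵐ ω ∂P, ∀ k, 0 < C.accidentTime k ω := ae_all_iff.2 h.accident_pos
  have h1 : ∀ᵐ ω ∂P, ∀ k, survival P 𝓕 C k 0 ω = 1 := ae_all_iff.2 h.survival_zero
  have e : {ω | ∀ k ∈ t, (r k : ℝ≥0∞) < C.accidentTime k ω}.indicator (1 : Ω → ℝ≥0∞)
      =ᵐ[P] {ω | ∀ k, ((if k ∈ t then r k else 0 : ℝ≥0) : ℝ≥0∞) < C.accidentTime k ω}.indicator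
        1 := by
    filter_upwards [h0] with ω hω
    simp only [Set.indicator_apply, Set.mem_ofPred_eq]
    congr 1
    refine propext (forall_congr' fun k => ?_)
    by_cases hk : k ∈ t <;> simp [hk, hω k]
  refine (condLExp_congr_ae e).trans ((h.condLExp_accident _).trans ?_)
  filter_upwards [h1] with ω hω
  rw [← Finset.prod_subset (Finset.subset_univ t) (fun k _ hk => by simp [hk, hω k])]
  exact Finset.prod_congr rfl fun k hk => by simp [hk]

theorem lintegral_mul_accident (h : IsReducedForm P 𝓕 C μ) (t : Finset (Fin n))
    (r : Fin n → ℝ≥0) {f : Ω → ℝ≥0∞} (hf : Measurable[sigmaAt 𝓕 ∞] f) :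
    ∫⁻ ω in {ω | ∀ k ∈ t, (r k : ℝ≥0∞) < C.accidentTime k ω}, f ω ∂P
      = ∫⁻ ω, f ω * ∏ k ∈ t, survival P 𝓕 C k (r k) ω ∂P := by
  have hS := measurableSet_forall_accident_lt (C := C) t fun k => (r k : ℝ≥0∞)
  have h1 := lintegral_mul_condLExp (P := P) (sigmaAt_le 𝓕 ∞)
    (measurable_one.indicator hS).aemeasurable hf
  rw [← lintegral_indicator hS]
  refine Eq.trans (lintegral_congr fun ω => ?_) (h1.trans (lintegral_congr_ae ?_))
  · classical
    by_cases hω : ω ∈ {ω | ∀ k ∈ t, (r k : ℝ≥0∞) < C.accidentTime k ω}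
    · simp only [Set.indicator_of_mem hω, Pi.one_apply, mul_one]
    · simp only [Set.indicator_of_notMem hω, mul_zero]
  · filter_upwards [h.condLExp_accident_finset t r] with ω hω
    rw [hω]

/-- The claim data of the others are independent and drop out. On the remaining generators `D ∩ {τ_k
> r_k, k ∈ t}`, with `i ∉ t`, both sides equal the integral over `D` of the survival of `i` times
the product of the survivals over `t`. -/
theorem measure_accident_otherInfo (h : IsReducedForm P 𝓕 C μ) (i : Fin n) (s : ℝ≥0) {A : Set Ω}
    (hA : MeasurableSet[C.otherInfo 𝓕 i] A) :
    P (A ∩ {ω | (s : ℝ≥0∞) < C.accidentTime i ω}) = ∫⁻ ω in A, survival P 𝓕 C i s ω ∂P := by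
  classical
  have hS := measurableSet_accident_lt (C := C) i s
  rw [← setLIntegral_indicator_one hS]
  have hfin : ∫⁻ ω, {ω | (s : ℝ≥0∞) < C.accidentTime i ω}.indicator (1 : Ω → ℝ≥0∞) ω ∂P ≠ ∞ := by
    rw [lintegral_indicator_one hS]
    exact measure_ne_top _ _
  refine setLIntegral_eq_of_indep (accident_sup_le 𝓕 C)
    (iSup₂_le fun k _ => C.claimInfo_le k) (sup_le_sup_left (iSup₂_le fun k _ => le_iSup _ k) _)
    (h.claimInfo_indep.mono le_rfl (iSup₂_le fun k _ => le_iSup _ k)) ?_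
    ((measurable_survival_top i s).mono le_sup_left le_rfl) hfin ?_ hA
  · refine Measurable.indicator (f := fun _ => (1 : ℝ≥0∞)) measurable_const ?_
    have hle : C.accidentInfo i ≤ sigmaAt 𝓕 ∞ ⊔ ⨆ i, C.accidentInfo i :=
      (le_iSup _ i).trans le_sup_right
    exact hle _ ⟨Set.Ioi (s : ℝ≥0∞), measurableSet_Ioi, rfl⟩
  intro a ha
  refine setLIntegral_eq_of_generateFrom_inter
    (@MeasurableSpace.generateFrom_measurableSet _ (sigmaAt 𝓕 ∞)).symm
    (iSup_comap_eq_generateFrom_tailEvents C.accidentTime {i}ᶜ) (sigmaAt_le 𝓕 ∞)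
    (iSup₂_le fun k _ => C.accidentInfo_le k)
    (@MeasurableSpace.isPiSystem_measurableSet _ (sigmaAt 𝓕 ∞)) (isPiSystem_tailEvents _ _)
    (@MeasurableSet.univ _ (sigmaAt 𝓕 ∞)) (univ_mem_tailEvents _ _) hfin ?_ ha
  intro D hD B hB
  obtain ⟨t, r, ht, rfl⟩ := exists_of_mem_tailEvents hB
  by_cases hr : ∃ k ∈ t, r k = ∞
  · obtain ⟨k, hk, hrk⟩ := hr
    have : {ω | ∀ k ∈ t, r k < C.accidentTime k ω} = ∅ := by
      ext ω
      simp only [Set.mem_ofPred_eq, Set.mem_empty_iff_false, iff_false, not_forall]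
      exact ⟨k, hk, by simp [hrk]⟩
    simp [this]
  push Not at hr
  have hit : i ∉ t := fun hi => ht hi rfl
  -- Finite thresholds for `t`, together with `s` for policy `i`, so that the product formula
  -- applies both to `t` and to `insert i t`.
  let q : Fin n → ℝ≥0 := Function.update (fun k => (r k).toNNReal) i s
  have hq : ∀ k ∈ t, (q k : ℝ≥0∞) = r k := fun k hk => by
    have : k ≠ i := fun hki => hit (hki ▸ hk)
    simp only [q, Function.update_of_ne this]
    exact ENNReal.coe_toNNReal (hr k hk)
  have hqi : q i = s := by simp [q]
  have eB : {ω | ∀ k ∈ t, r k < C.accidentTime k ω}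
      = {ω | ∀ k ∈ t, (q k : ℝ≥0∞) < C.accidentTime k ω} := by
    ext ω
    exact forall₂_congr fun k hk => by rw [hq k hk]
  have eI : {ω | ∀ k ∈ insert i t, (q k : ℝ≥0∞) < C.accidentTime k ω}
      = {ω | ∀ k ∈ t, (q k : ℝ≥0∞) < C.accidentTime k ω} ∩ {ω | (s : ℝ≥0∞) < C.accidentTime i ω} :=
          by
    ext ω
    simp only [Finset.mem_insert, forall_eq_or_imp, Set.mem_ofPred_eq, Set.mem_inter_iff, hqi]
    exact and_comm
  have hDm : MeasurableSet D := sigmaAt_le 𝓕 ∞ _ hD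
  have hBm := measurableSet_forall_accident_lt (C := C) t fun k => (q k : ℝ≥0∞)
  rw [setLIntegral_indicator_one hS, eB, Set.inter_assoc, ← eI,
    ← setLIntegral_indicator_one (measurableSet_forall_accident_lt _ fun k => (q k : ℝ≥0∞))]
  have l1 := h.lintegral_mul_accident (insert i t) q (f := D.indicator 1)
    (Measurable.indicator (f := fun _ => (1 : ℝ≥0∞)) measurable_const hD)
  have l2 := h.lintegral_mul_accident t q (f := D.indicator (survival P 𝓕 C i s))
    ((measurable_survival_top i s).indicator hD)
  rw [setLIntegral_indicator_one (measurableSet_forall_accident_lt _ fun k => (q k : ℝ≥0∞)),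
    Set.inter_comm, ← setLIntegral_indicator_one hDm, l1, ← Measure.restrict_restrict hDm,
    ← lintegral_indicator hDm, l2]
  refine lintegral_congr fun ω => ?_
  rw [Finset.prod_insert hit, hqi]
  by_cases hω : ω ∈ D <;> simp [hω]

end IsReducedForm
end NonLife
end

/-! ### The conditional law of the accident times -/

noncomputable section
namespace NonLife

variable {Ω : Type*} {mΩ : MeasurableSpace Ω} {n : ℕ} {P : Measure Ω} {𝓕 : Filtration ℝ≥0 mΩ}
  {C : Portfolio Ω n} {μ : ℝ≥0 → Ω → ℝ}

theorem exists_kernel_measure_inter [IsProbabilityMeasure P] {β : Type*} [MeasurableSpace β]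
    {X : Ω → β} (hX : Measurable X) {Y : Ω → ℝ≥0∞} (hY : Measurable Y) :
    ∃ κ : Kernel β ℝ≥0∞, IsMarkovKernel κ ∧ ∀ A, MeasurableSet A → ∀ s, MeasurableSet s →
      ∫⁻ ω in X ⁻¹' A, κ (X ω) s ∂P = P (X ⁻¹' A ∩ Y ⁻¹' s) :=
  ⟨condDistrib Y X P, inferInstance, fun _ hA _ hs => setLIntegral_condDistrib hX hY hA hs⟩

/-- Tails of a law are right-continuous and `Γ` is continuous, so the tail formula extends from a
dense set of times. This allows a single exceptional null set for all times. -/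
theorem isHazardLaw_of_dense {m : ℝ → ℝ} {k : Measure ℝ≥0∞} [IsFiniteMeasure k]
    (hm : ∀ t : ℝ≥0, IntervalIntegrable m volume 0 t) {S : Set ℝ≥0} (hS : Dense S)
    (h : ∀ s ∈ S, k (Set.Ioi (s : ℝ≥0∞)) = ENNReal.ofReal (Real.exp (-cumHazard m s))) :
    IsHazardLaw m k := by
  refine ⟨hm, fun t => ?_⟩
  obtain ⟨u, hu, hut, hlim⟩ := hS.exists_seq_strictAnti_tendsto t
  have h1 : Tendsto (fun j => k (Set.Ioi (u j : ℝ≥0∞))) atTop (𝓝 (k (Set.Ioi (t : ℝ≥0∞)))) := by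
    have e : Set.Ioi (t : ℝ≥0∞) = ⋃ j, Set.Ioi (u j : ℝ≥0∞) := by
      ext x
      simp only [Set.mem_Ioi, Set.mem_iUnion]
      refine ⟨fun hx => ?_, fun ⟨j, hj⟩ => lt_trans (by exact_mod_cast (hut j).1) hj⟩
      have hc : Tendsto (fun j => (u j : ℝ≥0∞)) atTop (𝓝 t) := ENNReal.tendsto_coe.2 hlim
      exact (hc.eventually (gt_mem_nhds hx)).exists
    rw [e]
    refine tendsto_measure_iUnion_atTop fun i j hij => Set.Ioi_subset_Ioi ?_
    exact_mod_cast hu.antitone hij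
  have hcont : ContinuousWithinAt (cumHazard m) (Set.Icc 0 (t + 1)) t := by
    have := intervalIntegral.continuousOn_primitive_interval (μ := volume) (f := m) (a := 0)
      (b := ((t + 1 : ℝ≥0) : ℝ)) (by
        have := hm (t + 1)
        rw [intervalIntegrable_iff_integrableOn_Icc_of_le (t + 1).coe_nonneg] at this
        rwa [Set.uIcc_of_le (t + 1).coe_nonneg])
    rw [Set.uIcc_of_le (t + 1).coe_nonneg] at this
    push_cast at this
    exact this t ⟨t.coe_nonneg, by simp⟩
  have h2 : Tendsto (fun j => ENNReal.ofReal (Real.exp (-cumHazard m (u j)))) atTop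
      (𝓝 (ENNReal.ofReal (Real.exp (-cumHazard m t)))) := by
    have hlim' : Tendsto (fun j => (u j : ℝ)) atTop (𝓝[Set.Icc 0 (t + 1)] (t : ℝ)) := by
      refine tendsto_nhdsWithin_iff.2 ⟨(NNReal.tendsto_coe.2 hlim), ?_⟩
      have hlt : ∀ᶠ j in atTop, u j < t + 1 := hlim.eventually (gt_mem_nhds (by simp))
      filter_upwards [hlt] with j hj
      exact ⟨(u j).coe_nonneg, by exact_mod_cast hj.le⟩
    exact (ENNReal.continuous_ofReal.tendsto _).comp
      ((Real.continuous_exp.tendsto _).comp (hcont.tendsto.comp hlim').neg)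
  refine tendsto_nhds_unique h1 (h2.congr fun j => ?_)
  exact (h _ (hut j).2).symm

/-- A kernel on `(Ω, m₁)`, as a kernel on `(Ω, m₂)`. -/
def kernelOfLE {m₁ m₂ : MeasurableSpace Ω} (hle : m₁ ≤ m₂)
    (κ : @Kernel Ω ℝ≥0∞ m₁ inferInstance) : @Kernel Ω ℝ≥0∞ m₂ inferInstance :=
  @Kernel.comap Ω ℝ≥0∞ m₁ _ Ω m₂ κ id (measurable_id'' hle)

theorem isMarkovKernel_kernelOfLE {m₁ m₂ : MeasurableSpace Ω} (hle : m₁ ≤ m₂)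
    (κ : @Kernel Ω ℝ≥0∞ m₁ inferInstance) [@IsMarkovKernel Ω ℝ≥0∞ m₁ inferInstance κ] :
    @IsMarkovKernel Ω ℝ≥0∞ m₂ inferInstance (kernelOfLE hle κ) :=
  @Kernel.IsMarkovKernel.comap Ω ℝ≥0∞ m₁ _ Ω m₂ id κ _ (measurable_id'' hle)

/-- `κ` is a conditional law of the accident times given the whole reference information. -/
structure IsAccidentKernel (P : Measure Ω) (𝓕 : Filtration ℝ≥0 mΩ) (μ : ℝ≥0 → Ω → ℝ)
    (κ : @Kernel Ω ℝ≥0∞ (sigmaAt 𝓕 ∞) inferInstance) : Prop where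
  isMarkov : @IsMarkovKernel Ω ℝ≥0∞ (sigmaAt 𝓕 ∞) inferInstance κ
  tail : ∀ s : ℝ≥0, (fun ω => κ ω (Set.Ioi s))
    =ᵐ[P] fun ω => ENNReal.ofReal (Real.exp (-hazard μ s ω))

/-- A regular conditional law given `𝓕_∞` for one policy. Its tails `exp (-Γ)` are common to all
policies, so the same kernel serves every one of them. -/
theorem IsReducedForm.exists_isAccidentKernel [IsProbabilityMeasure P] (h : IsReducedForm P 𝓕 C μ)
    (i : Fin n) : ∃ κ, IsAccidentKernel P 𝓕 μ κ := by
  obtain ⟨κ, hκ, hκA⟩ := @exists_kernel_measure_inter Ω mΩ P _ Ω (sigmaAt 𝓕 ∞) id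
    (measurable_id'' (sigmaAt_le 𝓕 ∞)) _ (C.measurable_accidentTime i)
  refine ⟨κ, hκ, fun s => ?_⟩
  have hS := measurableSet_accident_lt (C := C) i s
  have h1 : (fun ω => κ ω (Set.Ioi (s : ℝ≥0∞)))
      =ᵐ[P] P⁻[{ω | (s : ℝ≥0∞) < C.accidentTime i ω}.indicator 1|sigmaAt 𝓕 ∞] := by
    refine ae_eq_condLExp (sigmaAt_le 𝓕 ∞) P _ (Kernel.measurable_coe _ measurableSet_Ioi)
      fun A hA => ?_
    rw [setLIntegral_indicator_one hS]
    exact hκA A hA _ measurableSet_Ioi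
  have h2 := h.condLExp_accident_finset {i} fun _ => s
  simp only [Finset.mem_singleton, forall_eq, Finset.prod_singleton] at h2
  exact h1.trans (h2.trans (h.survival_ae_eq i s))

namespace IsAccidentKernel

variable {κ : @Kernel Ω ℝ≥0∞ (sigmaAt 𝓕 ∞) inferInstance}

theorem ae_isHazardLaw (hκ : IsAccidentKernel P 𝓕 μ κ)
    (hμ : ∀ᵐ ω ∂P, ∀ t : ℝ≥0, IntervalIntegrable (fun s : ℝ => μ s.toNNReal ω) volume 0 t) :
    ∀ᵐ ω ∂P, IsHazardLaw (fun s => μ s.toNNReal ω) (κ ω) := by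
  have := hκ.isMarkov
  obtain ⟨S, hSc, hSd⟩ := TopologicalSpace.exists_countable_dense ℝ≥0
  have h1 : ∀ᵐ ω ∂P, ∀ s ∈ S, κ ω (Set.Ioi (s : ℝ≥0∞))
      = ENNReal.ofReal (Real.exp (-hazard μ s ω)) := (ae_ball_iff hSc).2 fun s _ => hκ.tail s
  filter_upwards [h1, hμ] with ω h1 h2
  exact isHazardLaw_of_dense h2 hSd h1

theorem lintegral_comp [IsProbabilityMeasure P] (hκ : IsAccidentKernel P 𝓕 μ κ)
    (h : IsReducedForm P 𝓕 C μ) (i : Fin n) (hle : sigmaAt 𝓕 ∞ ≤ C.otherInfo 𝓕 i)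
    (F : Ω × ℝ≥0∞ → ℝ≥0∞)
    (hF : @Measurable _ _ (@Prod.instMeasurableSpace _ _ (C.otherInfo 𝓕 i) _) _ F) :
    ∫⁻ ω, F (ω, C.accidentTime i ω) ∂P = ∫⁻ ω, ∫⁻ x, F (ω, x)
      ∂(kernelOfLE hle κ) ω ∂P := by
  have := hκ.isMarkov
  refine @lintegral_comp_kernel Ω mΩ P _ Ω (C.otherInfo 𝓕 i) id
    (measurable_id'' (C.otherInfo_le 𝓕 i)) _ (C.measurable_accidentTime i) _
    (isMarkovKernel_kernelOfLE hle κ) ?_ F hF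
  intro s A hA
  refine (h.measure_accident_otherInfo i s hA).trans (setLIntegral_congr_fun_ae ?_ ?_)
  · exact C.otherInfo_le 𝓕 i _ hA
  · filter_upwards [h.survival_ae_eq i s, hκ.tail s] with ω h1 h2 _
    rw [h1, ← h2]
    rfl

end IsAccidentKernel

theorem Portfolio.sigmaAt_top_le_otherInfo (C : Portfolio Ω n) (𝓕 : Filtration ℝ≥0 mΩ) (i : Fin n) :
    sigmaAt 𝓕 ∞ ≤ C.otherInfo 𝓕 i := le_sup_left.trans le_sup_left

theorem HasDelayLaw.isDelayLaw {α₀ : ℝ} {g : ℝ → ℝ} (h : HasDelayLaw P C α₀ g) (i : Fin n) :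
    IsDelayLaw (P.map (C.delay i)) α₀ g := by
  refine ⟨h.density_nonneg, h.density_integrable, fun x => ?_⟩
  rw [← h.cdf_eq i x, map_measureReal_apply (C.measurable_delay i) measurableSet_Iic]
  rfl

theorem HasDelayLaw.map_delay_eq [IsProbabilityMeasure P] {α₀ : ℝ} {g : ℝ → ℝ}
    (h : HasDelayLaw P C α₀ g) (i i' : Fin n) : P.map (C.delay i) = P.map (C.delay i') := by
  have hp : ∀ i, IsProbabilityMeasure (P.map (C.delay i)) := fun i =>
    Measure.isProbabilityMeasure_map (C.measurable_delay i).aemeasurable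
  have := hp i
  have := hp i'
  refine Measure.ext_of_Iic _ _ fun x => ?_
  rw [← ENNReal.toReal_eq_toReal_iff' (measure_ne_top _ _) (measure_ne_top _ _)]
  exact ((h.isDelayLaw i).cdf x).trans ((h.isDelayLaw i').cdf x).symm

theorem lintegral_coe_of_integral_eq {X : Ω → ℝ≥0} {m : ℝ} (hX : Integrable (fun ω => (X ω : ℝ)) P)
    (hm : ∫ ω, (X ω : ℝ) ∂P = m) : ∫⁻ ω, (X ω : ℝ≥0∞) ∂P = ENNReal.ofReal m := by
  rw [← hm, ofReal_integral_eq_lintegral_ofReal hX (ae_of_all _ fun ω => (X ω).coe_nonneg)]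
  simp

theorem IsCompoundPoissonDev.isMarkedPoisson {T rate : ℝ≥0} {m : ℝ} (h : IsReducedForm P 𝓕 C μ)
    (hdev : IsCompoundPoissonDev P C rate T m) (i : Fin n) :
    IsMarkedPoisson P (C.devTime i) (C.devMark i) rate T (ENNReal.ofReal m) where
  measurable_time := C.measurable_devTime i
  measurable_mark := C.measurable_devMark i
  mono := h.dev_mono i
  tendsto := h.dev_tendsto i
  poisson := hdev.poisson i
  mark_iIndep := hdev.iIndep i
  indep := hdev.indep i
  mean j := lintegral_coe_of_integral_eq (hdev.integrable i j) (hdev.mean i j)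

end NonLife
end

/-! ### Immersion: past events carry no information about the future of the reference filtration -/

noncomputable section
namespace NonLife

variable {Ω : Type*} {mΩ : MeasurableSpace Ω} {n : ℕ} {P : Measure Ω} {𝓕 : Filtration ℝ≥0 mΩ}
  {C : Portfolio Ω n} {μ : ℝ≥0 → Ω → ℝ}

namespace Portfolio

variable (C : Portfolio Ω n)

/-- The accident time of policy `i` if it is at most `t`, and `∞` otherwise. -/
def pastAccident (t : ℝ≥0) (i : Fin n) (ω : Ω) : ℝ≥0∞ :=
  open Classical in if C.accidentTime i ω ≤ t then C.accidentTime i ω else ∞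

/-- The accidents until time `t`, and all further information on the claims. -/
@[reducible] def pastInfo (t : ℝ≥0) : MeasurableSpace Ω :=
  (⨆ i, MeasurableSpace.comap (C.pastAccident t i) inferInstance) ⊔ ⨆ i, C.claimInfo i

theorem lt_pastAccident_iff (t : ℝ≥0) (i : Fin n) (ω : Ω) {r : ℝ≥0∞} (hr : r ≠ ∞) :
    r < C.pastAccident t i ω ↔ min r t < C.accidentTime i ω := by
  unfold pastAccident
  split_ifs with h
  · refine ⟨fun h1 => (min_le_left _ _).trans_lt h1, fun h1 => ?_⟩
    rcases min_lt_iff.1 h1 with h2 | h2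
    · exact h2
    · exact absurd h (not_le.2 h2)
  · exact ⟨fun _ => (min_le_right _ _).trans_lt (not_le.1 h), fun _ => hr.lt_top⟩

theorem measurable_pastAccident (t : ℝ≥0) (i : Fin n) :
    Measurable[C.accidentInfo i] (C.pastAccident t i) := by
  classical
  have h : Measurable fun x : ℝ≥0∞ => if x ≤ t then x else ∞ :=
    Measurable.ite measurableSet_Iic measurable_id measurable_const
  have h1 := h.comp (comap_measurable (C.accidentTime i))
  convert h1 using 1
  funext ω
  simp only [pastAccident, Function.comp]

theorem pastInfo_le (t : ℝ≥0) : C.pastInfo t ≤ mΩ :=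
  sup_le (iSup_le fun i => ((C.measurable_pastAccident t i).mono (C.accidentInfo_le i)
    le_rfl).comap_le) (iSup_le C.claimInfo_le)

/-- An event up to `s ≤ t` needs an accident up to `t`, so moving later accidents to `∞` changes no
count. -/
theorem markedCount_eq (i : Fin n) {s t : ℝ≥0} (hst : s ≤ t) (B : Set (ℝ≥0 × ℝ≥0)) (ω : Ω) :
    C.markedCount i s B ω = totalCount s B
      (C.pastAccident t i ω + C.delay i ω, C.delay i ω, C.firstMark i ω) (C.dev i ω) := by
  classical
  have hle : ∀ x : ℝ≥0∞, C.pastAccident t i ω + x ≤ s ↔ C.accidentTime i ω + x ≤ s := by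
    intro x
    unfold pastAccident
    split_ifs with h
    · rfl
    · have h1 : ¬ C.accidentTime i ω + x ≤ s := fun h2 =>
        h ((le_self_add.trans h2).trans (by exact_mod_cast hst))
      simp [h1]
  rw [markedCount, tsum_eq_zero_add' ENNReal.summable, totalCount]
  simp only [Set.indicator_apply, Set.mem_ofPred_eq, hle, add_assoc, eventTime, mark, dev,
    Pi.one_apply]

theorem markedCount_eq_totalCount (i : Fin n) (s : ℝ≥0) (B : Set (ℝ≥0 × ℝ≥0)) (ω : Ω) :
    C.markedCount i s B ω = totalCount s B
      (C.eventTime i 0 ω, C.delay i ω, C.firstMark i ω) (C.dev i ω) := by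
  classical
  rw [markedCount, tsum_eq_zero_add' ENNReal.summable, totalCount]
  simp only [Set.indicator_apply, Set.mem_ofPred_eq, eventTime, mark, dev, Pi.one_apply]

theorem internalInfo_le_pastInfo (t : ℝ≥0) : C.internalInfo t ≤ C.pastInfo t := by
  refine iSup_le fun i => iSup_le fun s => iSup_le fun hs => iSup_le fun B => iSup_le fun hB => ?_
  refine Measurable.comap_le ?_
  have hclaim : C.claimInfo i ≤ C.pastInfo t := (le_iSup _ i).trans le_sup_right
  have h0 : Measurable[C.pastInfo t] (C.pastAccident t i) :=
    (comap_measurable _).mono ((le_iSup (fun i => MeasurableSpace.comap (C.pastAccident t i)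
      inferInstance) i).trans le_sup_left) le_rfl
  have h1 : Measurable[C.pastInfo t] (C.firstMark i) :=
    (comap_measurable _).mono ((le_sup_left.trans le_sup_left).trans hclaim) le_rfl
  have h2 : Measurable[C.pastInfo t] (C.delay i) :=
    (comap_measurable _).mono ((le_sup_right.trans le_sup_left).trans hclaim) le_rfl
  have h3 : Measurable[C.pastInfo t] (C.dev i) :=
    (comap_measurable _).mono (le_sup_right.trans hclaim) le_rfl
  have e : C.markedCount i s B = fun ω => totalCount s B
      (C.pastAccident t i ω + C.delay i ω, C.delay i ω, C.firstMark i ω) (C.dev i ω) :=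
    funext fun ω => C.markedCount_eq i hs B ω
  rw [e]
  exact (measurable_totalCount s hB).comp
    (((h0.add h2.coe_nnreal_ennreal).prodMk (h2.prodMk h1)).prodMk h3)

theorem globalInfo_le_sup_pastInfo (𝓕 : Filtration ℝ≥0 mΩ) (t : ℝ≥0) :
    C.globalInfo 𝓕 t ≤ 𝓕 t ⊔ C.pastInfo t := sup_le_sup_left (C.internalInfo_le_pastInfo t) _

theorem globalInfo_le (𝓕 : Filtration ℝ≥0 mΩ) (t : ℝ≥0) : C.globalInfo 𝓕 t ≤ mΩ :=
  (C.globalInfo_le_sup_pastInfo 𝓕 t).trans (sup_le (𝓕.le t) (C.pastInfo_le t))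

/-- A claim is reported by `t` exactly when its total count up to `t` is nonzero. -/
theorem measurableSet_report_le (𝓕 : Filtration ℝ≥0 mΩ) (t : ℝ≥0) (i : Fin n) :
    MeasurableSet[C.globalInfo 𝓕 t] {ω | C.eventTime i 0 ω ≤ t} := by
  have hle : MeasurableSpace.comap (C.markedCount i t Set.univ) inferInstance
      ≤ C.globalInfo 𝓕 t := by
    refine le_trans (le_iSup_of_le i (le_iSup_of_le t ?_)) le_sup_right
    rw [iSup_pos le_rfl]
    exact le_iSup_of_le Set.univ (le_iSup_of_le MeasurableSet.univ le_rfl)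
  have e : {ω | C.eventTime i 0 ω ≤ t} = C.markedCount i t Set.univ ⁻¹' {0}ᶜ := by
    ext ω
    rw [Set.mem_preimage, Set.mem_compl_singleton_iff, C.markedCount_eq_totalCount]
    refine ⟨fun h1 => ?_, fun h1 => ?_⟩
    · have : (1 : ℝ≥0∞) ≤ totalCount t Set.univ
          (C.eventTime i 0 ω, C.delay i ω, C.firstMark i ω) (C.dev i ω) := by
        refine le_trans ?_ le_self_add
        rw [Set.indicator_of_mem]
        · rfl
        · exact ⟨h1, Set.mem_univ _⟩
      exact (zero_lt_one.trans_le this).ne'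
    · by_contra h2
      exact h1 (totalCount_of_lt _ (not_le.1 h2))
  rw [e]
  exact hle _ ⟨_, (measurableSet_singleton 0).compl, rfl⟩

end Portfolio

variable [IsProbabilityMeasure P]

theorem lintegral_condLExp_mul {m : MeasurableSpace Ω} (hm : m ≤ mΩ) {V W : Ω → ℝ≥0∞}
    (hV : AEMeasurable V P) (hW : AEMeasurable W P) :
    ∫⁻ ω, (P⁻[V|m]) ω * W ω ∂P = ∫⁻ ω, V ω * (P⁻[W|m]) ω ∂P := by
  rw [lintegral_mul_condLExp hm hW (measurable_condLExp m P V)]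
  simp only [mul_comm (V _)]
  rw [lintegral_mul_condLExp hm hV (measurable_condLExp m P W)]
  simp only [mul_comm]

namespace IsReducedForm

/-- Claim data drop out by independence. Past accident events are of the form `{τ_k > q_k}` with
`q_k ≤ t`, so given `𝓕_∞` their probability is a product of `𝓕 t`-measurable survivals, against
which `Y` and its `𝓕 t`-conditional expectation have the same integral. -/
theorem setLIntegral_condLExp_pastInfo (h : IsReducedForm P 𝓕 C μ) (t : ℝ≥0) {Y : Ω → ℝ≥0∞}
    (hY : Measurable[sigmaAt 𝓕 ∞] Y) (hfin : ∫⁻ ω, Y ω ∂P ≠ ∞) {A : Set Ω}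
    (hA : MeasurableSet[𝓕 t ⊔ C.pastInfo t] A) :
    ∫⁻ ω in A, Y ω ∂P = ∫⁻ ω in A, (P⁻[Y|𝓕 t]) ω ∂P := by
  classical
  have hYm : Measurable Y := hY.mono (sigmaAt_le 𝓕 ∞) le_rfl
  have hYt := measurable_condLExp (𝓕 t) P Y
  rw [← sup_assoc] at hA
  refine setLIntegral_eq_of_indep (accident_sup_le 𝓕 C) (iSup_le C.claimInfo_le)
    (sup_le_sup (le_sigmaAt_top 𝓕 t) (iSup_mono fun i => (C.measurable_pastAccident t i).comap_le))
    h.claimInfo_indep (hY.mono le_sup_left le_rfl)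
    (hYt.mono ((le_sigmaAt_top 𝓕 t).trans le_sup_left) le_rfl) hfin ?_ hA
  intro a ha
  have hgen := iSup_comap_eq_generateFrom_tailEvents (C.pastAccident t) Set.univ
  simp only [Set.mem_univ, iSup_pos] at hgen
  refine setLIntegral_eq_of_generateFrom_inter
    (@MeasurableSpace.generateFrom_measurableSet _ (𝓕 t)).symm hgen (𝓕.le t)
    (iSup_le fun i => ((C.measurable_pastAccident t i).mono (C.accidentInfo_le i)
      le_rfl).comap_le)
    (@MeasurableSpace.isPiSystem_measurableSet _ (𝓕 t)) (isPiSystem_tailEvents _ _)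
    (@MeasurableSet.univ _ (𝓕 t)) (univ_mem_tailEvents _ _) hfin ?_ ha
  intro D hD B hB
  obtain ⟨T, r, hT, rfl⟩ := exists_of_mem_tailEvents hB
  by_cases hr : ∃ k ∈ T, r k = ∞
  · obtain ⟨k, hk, hrk⟩ := hr
    have : {ω | ∀ k ∈ T, r k < C.pastAccident t k ω} = ∅ := by
      ext ω
      simp only [Set.mem_ofPred_eq, Set.mem_empty_iff_false, iff_false, not_forall]
      exact ⟨k, hk, by simp [hrk]⟩
    simp [this]
  push Not at hr
  let q : Fin n → ℝ≥0 := fun k => min (r k).toNNReal t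
  have eB : {ω | ∀ k ∈ T, r k < C.pastAccident t k ω}
      = {ω | ∀ k ∈ T, (q k : ℝ≥0∞) < C.accidentTime k ω} := by
    ext ω
    refine forall₂_congr fun k hk => ?_
    rw [C.lt_pastAccident_iff t k ω (hr k hk)]
    simp only [q]
    rw [ENNReal.coe_min, ENNReal.coe_toNNReal (hr k hk)]
  -- The truncation of the thresholds at `t` is what makes the survivals `𝓕 t`-measurable.
  have hq : ∀ k, Measurable[𝓕 t] (survival P 𝓕 C k (q k)) := fun k =>
    (measurable_survival k (q k)).mono (𝓕.mono (min_le_right _ _)) le_rfl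
  have hDm : MeasurableSet D := 𝓕.le t _ hD
  rw [eB, ← Measure.restrict_restrict hDm, ← lintegral_indicator hDm, ← lintegral_indicator hDm,
    h.lintegral_mul_accident T q (hY.indicator (le_sigmaAt_top 𝓕 t _ hD)),
    h.lintegral_mul_accident T q ((hYt.indicator hD).mono (le_sigmaAt_top 𝓕 t) le_rfl)]
  have hf : Measurable[𝓕 t] (D.indicator fun ω => ∏ k ∈ T, survival P 𝓕 C k (q k) ω) :=
    (Finset.measurable_fun_prod T fun k _ => hq k).indicator hD
  have := lintegral_mul_condLExp (P := P) (𝓕.le t) hYm.aemeasurable hf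
  refine Eq.trans (lintegral_congr fun ω => ?_) (this.trans (lintegral_congr fun ω => ?_))
  all_goals
    by_cases hω : ω ∈ D
    · simp only [Set.indicator_of_mem hω, mul_comm]
    · simp only [Set.indicator_of_notMem hω, zero_mul]

/-- Dual to the preceding lemma: conditional expectation is self-adjoint, so the conditioning on `𝓕
t` can be moved from `D` to `A`. -/
theorem condLExp_sigmaAt_top_of_pastInfo (h : IsReducedForm P 𝓕 C μ) (t : ℝ≥0) {A : Set Ω}
    (hA : MeasurableSet[𝓕 t ⊔ C.pastInfo t] A) :
    P⁻[A.indicator 1|𝓕 t] =ᵐ[P] P⁻[A.indicator 1|sigmaAt 𝓕 ∞] := by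
  have hAm : MeasurableSet A := sup_le (𝓕.le t) (C.pastInfo_le t) _ hA
  have hA1 : Measurable (A.indicator (1 : Ω → ℝ≥0∞)) := measurable_one.indicator hAm
  refine ae_eq_condLExp (sigmaAt_le 𝓕 ∞) P _
    ((measurable_condLExp _ P _).mono (le_sigmaAt_top 𝓕 t) le_rfl) fun D hD => ?_
  have hDm : MeasurableSet D := sigmaAt_le 𝓕 ∞ _ hD
  have hD1 : Measurable[sigmaAt 𝓕 ∞] (D.indicator (1 : Ω → ℝ≥0∞)) :=
    Measurable.indicator (f := fun _ => (1 : ℝ≥0∞)) measurable_const hD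
  have hmul : ∀ (S : Set Ω) (hS : MeasurableSet S) (f : Ω → ℝ≥0∞),
      ∫⁻ ω in S, f ω ∂P = ∫⁻ ω, S.indicator 1 ω * f ω ∂P := fun S hS f => by
    rw [← lintegral_indicator hS]
    refine lintegral_congr fun ω => ?_
    by_cases hω : ω ∈ S <;> simp [hω]
  have hfin : ∫⁻ ω, D.indicator (1 : Ω → ℝ≥0∞) ω ∂P ≠ ∞ := by
    rw [lintegral_indicator_one hDm]
    exact measure_ne_top _ _
  have h1 := h.setLIntegral_condLExp_pastInfo t hD1 hfin hA
  rw [hmul D hDm, ← lintegral_condLExp_mul (𝓕.le t) (measurable_one.indicator hDm).aemeasurable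
    hA1.aemeasurable, hmul D hDm]
  rw [hmul A hAm, hmul A hAm] at h1
  simp only [mul_comm] at h1 ⊢
  exact h1.symm

end IsReducedForm
end NonLife
end

/-! ### One policy of the portfolio, given all other information -/

noncomputable section
namespace NonLife

variable {Ω : Type*} {mΩ : MeasurableSpace Ω} {n : ℕ} {P : Measure Ω} {𝓕 : Filtration ℝ≥0 mΩ}
  {C : Portfolio Ω n} {μ : ℝ≥0 → Ω → ℝ}

/-- The law of the sum of independent variables with laws `k` and `ρ`. -/
def sumLaw (k : Measure ℝ≥0∞) (ρ : Measure ℝ≥0) : Measure ℝ≥0∞ :=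
  (k.prod ρ).map fun q => q.1 + (q.2 : ℝ≥0∞)

theorem isSumLaw_sumLaw (k : Measure ℝ≥0∞) (ρ : Measure ℝ≥0) [SFinite ρ] :
    IsSumLaw k ρ (sumLaw k ρ) := fun f hf => by
  have hadd : Measurable fun q : ℝ≥0∞ × ℝ≥0 => q.1 + (q.2 : ℝ≥0∞) := by fun_prop
  have hfa : Measurable fun q : ℝ≥0∞ × ℝ≥0 => f (q.1 + (q.2 : ℝ≥0∞)) := hf.comp hadd
  rw [sumLaw, lintegral_map hf hadd, lintegral_prod _ hfa.aemeasurable]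

instance (k : Measure ℝ≥0∞) [IsProbabilityMeasure k] (ρ : Measure ℝ≥0) [IsProbabilityMeasure ρ] :
    IsProbabilityMeasure (sumLaw k ρ) :=
  Measure.isProbabilityMeasure_map (by fun_prop)

theorem reportKernel_apply {β : Type*} [MeasurableSpace β] (κ : Kernel β ℝ≥0∞) [IsSFiniteKernel κ]
    (ρ : Measure ℝ≥0) [SFinite ρ] (b : β) : reportKernel κ ρ b = sumLaw (κ b) ρ := by
  rw [reportKernel, Kernel.map_apply _ (by fun_prop), Kernel.prod_apply, Kernel.const_apply, sumLaw]

/-- The value of the payments of a claim not yet reported at time `t`, on the event that it is not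
reported, when `r` is the law of the report time. -/
def claimValue (r : Measure ℝ≥0∞) (z : ℝ → ℝ≥0∞) (M₁ c : ℝ≥0∞) (t T : ℝ≥0) : ℝ≥0∞ :=
  ∫⁻ u in {u : ℝ≥0∞ | (t : ℝ≥0∞) < u ∧ u ≤ T},
    (M₁ * z u.toReal + c * ∫⁻ v in Set.Ioc u.toReal T, z v) ∂r

theorem claimValue_le {r : Measure ℝ≥0∞} {z : ℝ → ℝ≥0∞} {M₁ c b : ℝ≥0∞} {t T : ℝ≥0}
    (hz : ∀ u ∈ Set.Icc (0 : ℝ) T, z u ≤ b) :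
    claimValue r z M₁ c t T ≤ (M₁ * b + c * (b * T)) * r (Set.Ioi t) := by
  have h1 : ∀ u ∈ {u : ℝ≥0∞ | (t : ℝ≥0∞) < u ∧ u ≤ T},
      M₁ * z u.toReal + c * ∫⁻ v in Set.Ioc u.toReal T, z v ≤ M₁ * b + c * (b * T) := by
    intro u hu
    have h0 : u.toReal ≤ T := by
      rw [← ENNReal.coe_toReal]
      exact ENNReal.toReal_mono ENNReal.coe_ne_top hu.2
    gcongr
    · exact hz _ ⟨ENNReal.toReal_nonneg, h0⟩
    · calc ∫⁻ v in Set.Ioc u.toReal T, z v ≤ ∫⁻ _ in Set.Ioc u.toReal T, b :=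
            setLIntegral_mono measurable_const fun v hv =>
              hz v ⟨ENNReal.toReal_nonneg.trans hv.1.le, hv.2⟩
        _ = b * ENNReal.ofReal (T - u.toReal) := by rw [setLIntegral_const, Real.volume_Ioc]
        _ ≤ b * T := by
            gcongr
            rw [← ENNReal.ofReal_coe_nnreal]
            exact ENNReal.ofReal_le_ofReal (by linarith [ENNReal.toReal_nonneg (a := u)])
  calc claimValue r z M₁ c t T
      ≤ ∫⁻ _ in {u : ℝ≥0∞ | (t : ℝ≥0∞) < u ∧ u ≤ T}, (M₁ * b + c * (b * T)) ∂r :=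
        setLIntegral_mono measurable_const h1
    _ = (M₁ * b + c * (b * T)) * r {u : ℝ≥0∞ | (t : ℝ≥0∞) < u ∧ u ≤ T} := setLIntegral_const _ _
    _ ≤ _ := by
      gcongr
      exact fun u hu => hu.1

theorem _root_.ProbabilityTheory.IndepFun.of_measurable {α β : Type*} [MeasurableSpace α]
    [MeasurableSpace β] {X : Ω → α} {Y : Ω → β} {m₁ m₂ : MeasurableSpace Ω} (h : Indep m₁ m₂ P)
    (hX : Measurable[m₁] X) (hY : Measurable[m₂] Y) : IndepFun X Y P := by
  rw [IndepFun_iff_Indep]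
  exact h.mono hX.comap_le hY.comap_le

theorem isPiSystem_piiUnionInter_measurableSet {ι : Type*} (m : ι → MeasurableSpace Ω) (S : Set ι) :
    IsPiSystem (piiUnionInter (fun i => {s | MeasurableSet[m i] s}) S) :=
  isPiSystem_piiUnionInter _ (fun i => @MeasurableSpace.isPiSystem_measurableSet _ (m i)) S

namespace Portfolio

variable (C : Portfolio Ω n)

/-- Report time, delay and first payment of policy `i`. -/
def report (i : Fin n) (ω : Ω) : ℝ≥0∞ × ℝ≥0 × ℝ≥0 :=
  (C.eventTime i 0 ω, C.delay i ω, C.firstMark i ω)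

theorem measurable_report (i : Fin n) : Measurable (C.report i) :=
  (C.measurable_eventTime i 0).prodMk ((C.measurable_delay i).prodMk (C.measurable_firstMark i))

/-- The internal information on policy `i` at time `t`. -/
@[reducible] def policyInfo (t : ℝ≥0) (i : Fin n) : MeasurableSpace Ω :=
  ⨆ p ∈ (Set.univ : Set {p : ℝ≥0 × Set (ℝ≥0 × ℝ≥0) // p.1 ≤ t ∧ MeasurableSet p.2}),
    MeasurableSpace.comap (C.markedCount i p.1.1 p.1.2) inferInstance

theorem measurable_markedCount (i : Fin n) (s : ℝ≥0) {B : Set (ℝ≥0 × ℝ≥0)} (hB : MeasurableSet B) :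
    Measurable (C.markedCount i s B) := by
  rw [funext (C.markedCount_eq_totalCount i s B)]
  exact (measurable_totalCount s hB).comp ((C.measurable_report i).prodMk (C.measurable_dev i))

theorem policyInfo_le (t : ℝ≥0) (i : Fin n) : C.policyInfo t i ≤ mΩ :=
  iSup₂_le fun p _ => (C.measurable_markedCount i p.1.1 p.2.2).comap_le

/-- It suffices to test candidate values on sets `D ∩ {counts ∈ E}`, with `D` from the other
information and finitely many counts of policy `i`, the form treated by the single-policy valuation.
-/
theorem globalInfo_le_sup_policyInfo (𝓕 : Filtration ℝ≥0 mΩ) (t : ℝ≥0) (i : Fin n) :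
    C.globalInfo 𝓕 t ≤ C.otherInfo 𝓕 i ⊔ C.policyInfo t i := by
  refine sup_le (((le_sigmaAt_top 𝓕 t).trans (C.sigmaAt_top_le_otherInfo 𝓕 i)).trans le_sup_left)
    (iSup_le fun k => iSup_le fun s => iSup_le fun hs => iSup_le fun B => iSup_le fun hB => ?_)
  by_cases hk : k = i
  · subst hk
    exact le_trans (le_iSup₂_of_le (ι := {p : ℝ≥0 × Set (ℝ≥0 × ℝ≥0) // p.1 ≤ t ∧ MeasurableSet p.2})
      ⟨(s, B), hs, hB⟩ (Set.mem_univ _) le_rfl) le_sup_right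
  · refine le_trans (Measurable.comap_le ?_) (le_sup_left (a := C.otherInfo 𝓕 i))
    have hk' : k ∈ ({i}ᶜ : Set (Fin n)) := hk
    have hclaim : C.claimInfo k ≤ C.otherInfo 𝓕 i := (le_biSup _ hk').trans le_sup_right
    have h0 : Measurable[C.otherInfo 𝓕 i] (C.accidentTime k) :=
      (comap_measurable _).mono (((le_biSup C.accidentInfo hk').trans le_sup_right).trans
        le_sup_left) le_rfl
    have h1 : Measurable[C.otherInfo 𝓕 i] (C.firstMark k) :=
      (comap_measurable _).mono ((le_sup_left.trans le_sup_left).trans hclaim) le_rfl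
    have h2 : Measurable[C.otherInfo 𝓕 i] (C.delay k) :=
      (comap_measurable _).mono ((le_sup_right.trans le_sup_left).trans hclaim) le_rfl
    have h3 : Measurable[C.otherInfo 𝓕 i] (C.dev k) :=
      (comap_measurable _).mono (le_sup_right.trans hclaim) le_rfl
    rw [funext (C.markedCount_eq_totalCount k s B)]
    exact (measurable_totalCount s hB).comp
      (((h0.add h2.coe_nnreal_ennreal).prodMk (h2.prodMk h1)).prodMk h3)

/-- The events that finitely many of the counts of policy `i` until time `t` take given values. -/
def policyEvents (t : ℝ≥0) (i : Fin n) : Set (Set Ω) :=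
  piiUnionInter (fun p : {p : ℝ≥0 × Set (ℝ≥0 × ℝ≥0) // p.1 ≤ t ∧ MeasurableSet p.2} =>
    {s | MeasurableSet[MeasurableSpace.comap (C.markedCount i p.1.1 p.1.2) inferInstance] s})
    Set.univ

theorem policyInfo_eq_generateFrom (t : ℝ≥0) (i : Fin n) :
    C.policyInfo t i = MeasurableSpace.generateFrom (C.policyEvents t i) :=
  (generateFrom_piiUnionInter_measurableSet _ _).symm

theorem isPiSystem_policyEvents (t : ℝ≥0) (i : Fin n) : IsPiSystem (C.policyEvents t i) :=
  isPiSystem_piiUnionInter_measurableSet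
    (fun p : {p : ℝ≥0 × Set (ℝ≥0 × ℝ≥0) // p.1 ≤ t ∧ MeasurableSet p.2} =>
      MeasurableSpace.comap (C.markedCount i p.1.1 p.1.2) inferInstance) Set.univ

theorem univ_mem_policyEvents (t : ℝ≥0) (i : Fin n) : Set.univ ∈ C.policyEvents t i :=
  ⟨∅, by simp, fun _ => Set.univ, by simp, by simp⟩

theorem exists_of_mem_policyEvents {t : ℝ≥0} {i : Fin n} {A : Set Ω} (hA : A ∈ C.policyEvents t i) :
    ∃ (F : Finset {p : ℝ≥0 × Set (ℝ≥0 × ℝ≥0) // p.1 ≤ t ∧ MeasurableSet p.2})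
      (E : Set (F → ℝ≥0∞)), MeasurableSet E ∧
      A = {ω | (fun l : F => C.markedCount i l.1.1.1 l.1.1.2 ω) ∈ E} := by
  obtain ⟨F, -, f, hf, rfl⟩ := hA
  choose! E hE hEf using hf
  refine ⟨F, Set.pi Set.univ fun l : F => E l, MeasurableSet.univ_pi fun l => hE l l.2, ?_⟩
  ext ω
  simp only [Set.mem_iInter, Set.mem_ofPred_eq, Set.mem_pi, Set.mem_univ, forall_true_left]
  refine ⟨fun h1 l => ?_, fun h1 p hp => ?_⟩
  · have h2 := h1 l l.2
    rwa [← hEf l l.2] at h2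
  · rw [← hEf p hp]
    exact h1 ⟨p, hp⟩

end Portfolio

section

variable {κ : @Kernel Ω ℝ≥0∞ (sigmaAt 𝓕 ∞) inferInstance}
  {ρ : Measure ℝ≥0}

/-- `κ` and `ρ` are the conditional law of the accident times and the law of the delays. -/
structure IsReportModel (P : Measure Ω) (𝓕 : Filtration ℝ≥0 mΩ) (C : Portfolio Ω n)
    (μ : ℝ≥0 → Ω → ℝ) (κ : @Kernel Ω ℝ≥0∞ (sigmaAt 𝓕 ∞) inferInstance) (ρ : Measure ℝ≥0) :
    Prop where
  reduced : IsReducedForm P 𝓕 C μ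
  accident : IsAccidentKernel P 𝓕 μ κ
  delay : ∀ i, P.map (C.delay i) = ρ
  prob : IsProbabilityMeasure ρ

namespace IsReportModel

/-- The report time has the same conditional law given `otherInfo` as given `𝓕_∞`: the other
policies do not matter. -/
theorem lintegral_comp [IsProbabilityMeasure P] (h : IsReportModel P 𝓕 C μ κ ρ) (i : Fin n)
    (F : Ω × ℝ≥0∞ → ℝ≥0∞)
    (hF : @Measurable _ _ (@Prod.instMeasurableSpace _ _ (C.otherInfo 𝓕 i) _) _ F) :
    ∫⁻ ω, F (ω, C.eventTime i 0 ω) ∂P = ∫⁻ ω, ∫⁻ u, F (ω, u) ∂(sumLaw (κ ω) ρ) ∂P := by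
  have := h.accident.isMarkov
  have hle := C.sigmaAt_top_le_otherInfo 𝓕 i
  have hκ' := isMarkovKernel_kernelOfLE hle κ
  have hρ := h.prob
  have hid : Measurable[C.otherInfo 𝓕 i ⊔ C.accidentInfo i, C.otherInfo 𝓕 i] (id : Ω → Ω) :=
    measurable_id'' le_sup_left
  have hacc : Measurable[C.otherInfo 𝓕 i ⊔ C.accidentInfo i] (C.accidentTime i) :=
    (comap_measurable _).mono le_sup_right le_rfl
  have hind : @IndepFun _ _ _ _ (@Prod.instMeasurableSpace _ _ (C.otherInfo 𝓕 i) _) _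
      (fun ω => (id ω, C.accidentTime i ω)) (C.delay i) P :=
    @IndepFun.of_measurable _ _ P _ _ (@Prod.instMeasurableSpace _ _ (C.otherInfo 𝓕 i) _) _ _ _ _ _
      (h.reduced.delayInfo_indep_otherInfo i)
      (@Measurable.prodMk _ _ _ _ (C.otherInfo 𝓕 i) _ _ _ hid hacc) (comap_measurable _)
  have h1 := @lintegral_comp_reportKernel Ω mΩ P _ Ω (C.otherInfo 𝓕 i) id
    (measurable_id'' (C.otherInfo_le 𝓕 i)) _ (C.measurable_accidentTime i) _ (C.measurable_delay i)
    (kernelOfLE hle κ) hκ' (h.accident.lintegral_comp h.reduced i hle) hind F hF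
  refine h1.trans (lintegral_congr fun ω => ?_)
  rw [h.delay i, @reportKernel_apply _ (C.otherInfo 𝓕 i)]
  rfl

theorem ae_eq_condLExp [IsProbabilityMeasure P] (h : IsReportModel P 𝓕 C μ κ ρ) (i : Fin n)
    {s : Set ℝ≥0∞}
    (hs : MeasurableSet s) : (fun ω => sumLaw (κ ω) ρ s)
      =ᵐ[P] P⁻[{ω | C.eventTime i 0 ω ∈ s}.indicator 1|sigmaAt 𝓕 ∞] := by
  have := h.accident.isMarkov
  have hρ := h.prob
  have hm : Measurable[sigmaAt 𝓕 ∞] fun ω => sumLaw (κ ω) ρ s := by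
    have := @Kernel.measurable_coe _ _ (sigmaAt 𝓕 ∞) _ (@reportKernel _ (sigmaAt 𝓕 ∞) κ ρ) s hs
    simpa only [@reportKernel_apply _ (sigmaAt 𝓕 ∞)] using this
  refine MeasureTheory.ae_eq_condLExp (sigmaAt_le 𝓕 ∞) P _ hm fun D hD => ?_
  have hD' : MeasurableSet[C.otherInfo 𝓕 i] D := C.sigmaAt_top_le_otherInfo 𝓕 i _ hD
  have hF : @MeasurableSet _ (@Prod.instMeasurableSpace _ _ (C.otherInfo 𝓕 i) _) (D ×ˢ s) :=
    @MeasurableSet.prod _ _ (C.otherInfo 𝓕 i) _ _ _ hD' hs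
  have h1 := h.lintegral_comp i ((D ×ˢ s).indicator fun _ => 1)
    (Measurable.indicator measurable_const hF)
  have hDm : MeasurableSet D := sigmaAt_le 𝓕 ∞ _ hD
  rw [← lintegral_indicator hDm, ← lintegral_indicator hDm]
  refine Eq.trans (lintegral_congr fun ω => ?_) (h1.symm.trans (lintegral_congr fun ω => ?_))
  · by_cases hω : ω ∈ D
    · rw [Set.indicator_of_mem hω, ← lintegral_indicator_one hs]
      refine lintegral_congr fun u => ?_
      by_cases hu : u ∈ s <;> simp [hω, hu]
    · rw [Set.indicator_of_notMem hω]
      simp [hω]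
  · by_cases hω : ω ∈ D <;> by_cases hu : C.eventTime i 0 ω ∈ s <;> simp [hω, hu]

theorem ae_pos (h : IsReportModel P 𝓕 C μ κ ρ) :
    ∀ᵐ ω ∂P, ∀ t : ℝ≥0, sumLaw (κ ω) ρ (Set.Ioi (t : ℝ≥0∞)) ≠ 0 := by
  have := h.accident.isMarkov
  have hρ := h.prob
  filter_upwards [h.accident.ae_isHazardLaw h.reduced.intensity_integrable] with ω hω t
  exact ((isSumLaw_sumLaw _ ρ).measure_Ioi_pos hω t).ne'

end IsReportModel

/-- The developments are marked Poisson processes and the first marks have a common mean. -/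
structure IsClaimModel (P : Measure Ω) (C : Portfolio Ω n) (rate T : ℝ≥0) (M M₁ : ℝ≥0∞) :
    Prop where
  dev : ∀ i, IsMarkedPoisson P (C.devTime i) (C.devMark i) rate T M
  dev_ne_top : M ≠ ∞
  mark : ∀ i, ∫⁻ ω, (C.firstMark i ω : ℝ≥0∞) ∂P = M₁
  mark_ne_top : M₁ ≠ ∞

/-- Payments of policy `i` in `(t, T]`, when a unit paid at time `u` has the value `z u`. -/
def Portfolio.policyPayment (C : Portfolio Ω n) (Z : Ω × ℝ → ℝ≥0∞) (t T : ℝ≥0) (i : Fin n) (ω : Ω) :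
    ℝ≥0∞ :=
  payAfter (fun u => Z (ω, u)) t T (C.report i ω) (C.dev i ω)

/-- The value of the payments of a reported claim after time `t`. -/
def reportedValue (Z : Ω × ℝ → ℝ≥0∞) (c : ℝ≥0∞) (t T : ℝ≥0) (ω : Ω) : ℝ≥0∞ :=
  c * ∫⁻ v in Set.Ioc (t : ℝ) T, Z (ω, v)

/-- The value of the payments of a claim not reported at time `t`, conditional on this event. -/
def pendingValue (κ : Ω → Measure ℝ≥0∞) (ρ : Measure ℝ≥0) (Z : Ω × ℝ → ℝ≥0∞) (M₁ c : ℝ≥0∞)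
    (t T : ℝ≥0) (ω : Ω) : ℝ≥0∞ :=
  claimValue (sumLaw (κ ω) ρ) (fun u => Z (ω, u)) M₁ c t T / sumLaw (κ ω) ρ (Set.Ioi t)

/-- The value of the payments of policy `i` after time `t`, given all other information. -/
def Portfolio.policyValue (C : Portfolio Ω n) (κ : Ω → Measure ℝ≥0∞) (ρ : Measure ℝ≥0)
    (Z : Ω × ℝ → ℝ≥0∞) (M₁ c : ℝ≥0∞) (t T : ℝ≥0) (i : Fin n) (ω : Ω) : ℝ≥0∞ :=
  {ω | C.eventTime i 0 ω ≤ t}.indicator (fun _ => 1) ω * reportedValue Z c t T ω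
    + {ω | (t : ℝ≥0∞) < C.eventTime i 0 ω}.indicator (fun _ => 1) ω
      * pendingValue κ ρ Z M₁ c t T ω

theorem measurable_prod_mono {m₁ m₂ : MeasurableSpace Ω} (hle : m₁ ≤ m₂) {Z : Ω × ℝ → ℝ≥0∞}
    (hZ : @Measurable _ _ (@Prod.instMeasurableSpace _ _ m₁ _) _ Z) :
    @Measurable _ _ (@Prod.instMeasurableSpace _ _ m₂ _) _ Z :=
  hZ.mono (sup_le_sup_right (MeasurableSpace.comap_mono hle) _) le_rfl

namespace IsReportModel

theorem indepFun_report_dev [IsProbabilityMeasure P] (h : IsReportModel P 𝓕 C μ κ ρ) (i : Fin n) :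
    @IndepFun _ _ _ _ (@Prod.instMeasurableSpace _ _ (C.otherInfo 𝓕 i) _) _
      (fun ω => (id ω, C.report i ω)) (C.dev i) P := by
  have i1 : Measurable[C.otherInfo 𝓕 i ⊔ (C.accidentInfo i ⊔ C.delayInfo i ⊔ C.markInfo i),
    C.otherInfo 𝓕 i] (id : Ω → Ω) := measurable_id'' le_sup_left
  have i2 : Measurable[C.otherInfo 𝓕 i ⊔ (C.accidentInfo i ⊔ C.delayInfo i ⊔ C.markInfo i)]
      (C.accidentTime i) :=
    (comap_measurable _).mono ((le_sup_left.trans le_sup_left).trans le_sup_right) le_rfl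
  have i3 : Measurable[C.otherInfo 𝓕 i ⊔ (C.accidentInfo i ⊔ C.delayInfo i ⊔ C.markInfo i)]
      (C.delay i) :=
    (comap_measurable _).mono ((le_sup_right.trans le_sup_left).trans le_sup_right) le_rfl
  have i4 : Measurable[C.otherInfo 𝓕 i ⊔ (C.accidentInfo i ⊔ C.delayInfo i ⊔ C.markInfo i)]
      (C.firstMark i) :=
    (comap_measurable _).mono (le_sup_right.trans le_sup_right) le_rfl
  have i5 : Measurable[C.otherInfo 𝓕 i ⊔ (C.accidentInfo i ⊔ C.delayInfo i ⊔ C.markInfo i)]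
      (C.report i) :=
    (i2.add i3.coe_nnreal_ennreal).prodMk (i3.prodMk i4)
  exact @IndepFun.of_measurable _ _ P _ _ (@Prod.instMeasurableSpace _ _ (C.otherInfo 𝓕 i) _) _ _ _
    _ _ (h.reduced.devInfo_indep_otherInfo i)
    (@Measurable.prodMk _ _ _ _ (C.otherInfo 𝓕 i) _ _ _ i1 i5) (comap_measurable _)

theorem indepFun_report_mark [IsProbabilityMeasure P] (h : IsReportModel P 𝓕 C μ κ ρ) (i : Fin n) :
    @IndepFun _ _ _ _ (@Prod.instMeasurableSpace _ _ (C.otherInfo 𝓕 i) _) _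
      (fun ω => (id ω, (C.report i ω).1)) (fun ω => (C.report i ω).2.2) P := by
  have j1 : Measurable[C.otherInfo 𝓕 i ⊔ (C.accidentInfo i ⊔ C.delayInfo i),
    C.otherInfo 𝓕 i] (id : Ω → Ω) := measurable_id'' le_sup_left
  have j2 : Measurable[C.otherInfo 𝓕 i ⊔ (C.accidentInfo i ⊔ C.delayInfo i)] (C.accidentTime i) :=
    (comap_measurable _).mono (le_sup_left.trans le_sup_right) le_rfl
  have j3 : Measurable[C.otherInfo 𝓕 i ⊔ (C.accidentInfo i ⊔ C.delayInfo i)] (C.delay i) :=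
    (comap_measurable _).mono (le_sup_right.trans le_sup_right) le_rfl
  have j4 : Measurable[C.otherInfo 𝓕 i ⊔ (C.accidentInfo i ⊔ C.delayInfo i)]
      fun ω => (C.report i ω).1 := j2.add j3.coe_nnreal_ennreal
  exact @IndepFun.of_measurable _ _ P _ _ (@Prod.instMeasurableSpace _ _ (C.otherInfo 𝓕 i) _) _ _ _
    _ _ (h.reduced.markInfo_indep_otherInfo i)
    (@Measurable.prodMk _ _ _ _ (C.otherInfo 𝓕 i) _ _ _ j1 j4) (comap_measurable _)

variable {rate T : ℝ≥0} {M M₁ : ℝ≥0∞} {Z : Ω × ℝ → ℝ≥0∞} {t : ℝ≥0}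

theorem setLIntegral_policyPayment_count [IsProbabilityMeasure P] (h : IsReportModel P 𝓕 C μ κ ρ)
    (hc : IsClaimModel P C rate T M M₁)
    (hZ : @Measurable _ _ (@Prod.instMeasurableSpace _ _ (sigmaAt 𝓕 ∞) _) _ Z) (htT : t ≤ T)
    (i : Fin n) {D : Set Ω} (hD : MeasurableSet[C.otherInfo 𝓕 i] D) {ι : Type*} [Fintype ι]
    {s : ι → ℝ≥0} (hs : ∀ l, s l ≤ t) {B : ι → Set (ℝ≥0 × ℝ≥0)} (hB : ∀ l, MeasurableSet (B l))
    {E : Set (ι → ℝ≥0∞)} (hE : MeasurableSet E) :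
    ∫⁻ ω in D ∩ {ω | (fun l => C.markedCount i (s l) (B l) ω) ∈ E},
        C.policyPayment Z t T i ω ∂P
      = ∫⁻ ω in D ∩ {ω | (fun l => C.markedCount i (s l) (B l) ω) ∈ E},
        C.policyValue (fun ω => κ ω) ρ Z M₁ (M * rate) t T i ω ∂P := by
  have := h.accident.isMarkov
  have hle := C.sigmaAt_top_le_otherInfo 𝓕 i
  have hκ' := isMarkovKernel_kernelOfLE hle κ
  have hρ := h.prob
  have hid : Measurable[mΩ, C.otherInfo 𝓕 i] (id : Ω → Ω) := measurable_id'' (C.otherInfo_le 𝓕 i)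
  have hk : ∀ ω, @reportKernel Ω (C.otherInfo 𝓕 i) (kernelOfLE hle κ) ρ ω = sumLaw (κ ω) ρ :=
    fun ω => @reportKernel_apply _ (C.otherInfo 𝓕 i) _ _ ρ _ ω
  -- The outside information is the identity map into `Ω` equipped with the σ-algebra `otherInfo`.
  have key := @setLIntegral_payAfter Ω mΩ P _ Ω (C.otherInfo 𝓕 i) id (C.report i) (C.devTime i)
      (C.devMark i) rate T
    M M₁ (@reportKernel Ω (C.otherInfo 𝓕 i) (kernelOfLE hle κ) ρ)
    (@instIsMarkovKernelReport Ω (C.otherInfo 𝓕 i) _ _ ρ _) Z t hid (C.measurable_report i)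
    (hc.dev i) hc.dev_ne_top (h.indepFun_report_dev i) (h.indepFun_report_mark i) (hc.mark i)
    (fun F hF => by
      simp only [hk]
      exact h.lintegral_comp i F hF)
    (by
      simp only [hk]
      filter_upwards [h.ae_pos] with ω hω using hω t)
    (measurable_prod_mono hle hZ) D hD htT ι _ s hs B hB E hE
  simp only [hk, unreportedValue] at key
  have e : D ∩ {ω | (fun l => C.markedCount i (s l) (B l) ω) ∈ E}
      = {ω | id ω ∈ D ∧ (fun l => totalCount (s l) (B l) (C.report i ω)
          (fun j => (C.devTime i j ω, C.devMark i j ω))) ∈ E} := by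
    ext ω
    simp only [C.markedCount_eq_totalCount]
    rfl
  rw [e]
  exact key

end IsReportModel
end
end NonLife
end

/-! ### Conditional expectation of a policy's payment given the global information -/

noncomputable section
namespace NonLife

variable {Ω : Type*} {mΩ : MeasurableSpace Ω} {n : ℕ} {P : Measure Ω} {𝓕 : Filtration ℝ≥0 mΩ}
  {C : Portfolio Ω n} {μ : ℝ≥0 → Ω → ℝ} {κ : @Kernel Ω ℝ≥0∞ (sigmaAt 𝓕 ∞) inferInstance}
  {ρ : Measure ℝ≥0} {rate T : ℝ≥0} {M M₁ : ℝ≥0∞} {Z : Ω × ℝ → ℝ≥0∞} {t : ℝ≥0}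

theorem measurable_policyPayment (C : Portfolio Ω n) (hZ : Measurable Z) (t T : ℝ≥0) (i : Fin n) :
    Measurable (C.policyPayment Z t T i) :=
  (measurable_payAfter hZ t T).comp
    ((measurable_id.prodMk (C.measurable_report i)).prodMk (C.measurable_dev i))

theorem measurable_reportedValue (hZ : Measurable Z) (c : ℝ≥0∞) (t T : ℝ≥0) :
    Measurable (reportedValue Z c t T) :=
  ((measurable_lintegral_Ioc hZ (T : ℝ)).comp (measurable_id.prodMk measurable_const)).const_mul c

theorem measurable_claimValue (κ : Kernel Ω ℝ≥0∞) [IsMarkovKernel κ] (ρ : Measure ℝ≥0)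
    [IsProbabilityMeasure ρ] (hZ : Measurable Z) (M₁ c : ℝ≥0∞) (t T : ℝ≥0) :
    Measurable fun ω => claimValue (sumLaw (κ ω) ρ) (fun u => Z (ω, u)) M₁ c t T := by
  have h := measurable_unreportedValue (reportKernel κ ρ) hZ M₁ c t T
  have e : unreportedValue (reportKernel κ ρ) Z M₁ c t T
      = fun ω => claimValue (sumLaw (κ ω) ρ) (fun u => Z (ω, u)) M₁ c t T := by
    funext ω
    rw [unreportedValue, reportKernel_apply]
    rfl
  rwa [e] at h

theorem measurable_sumLaw (κ : Kernel Ω ℝ≥0∞) [IsMarkovKernel κ] (ρ : Measure ℝ≥0)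
    [IsProbabilityMeasure ρ] {s : Set ℝ≥0∞} (hs : MeasurableSet s) :
    Measurable fun ω => sumLaw (κ ω) ρ s := by
  have := Kernel.measurable_coe (reportKernel κ ρ) hs
  simpa only [reportKernel_apply] using this

theorem measurable_pendingValue (κ : Kernel Ω ℝ≥0∞) [IsMarkovKernel κ] (ρ : Measure ℝ≥0)
    [IsProbabilityMeasure ρ] (hZ : Measurable Z) (M₁ c : ℝ≥0∞) (t T : ℝ≥0) :
    Measurable (pendingValue (fun ω => κ ω) ρ Z M₁ c t T) :=
  (measurable_claimValue κ ρ hZ M₁ c t T).div (measurable_sumLaw κ ρ measurableSet_Ioi)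

theorem reportedValue_le {ω : Ω} {b : ℝ≥0∞} (hz : ∀ u ∈ Set.Icc (0 : ℝ) T, Z (ω, u) ≤ b)
    (c : ℝ≥0∞) (t : ℝ≥0) : reportedValue Z c t T ω ≤ c * (b * T) := by
  unfold reportedValue
  gcongr
  calc ∫⁻ v in Set.Ioc (t : ℝ) T, Z (ω, v) ≤ ∫⁻ _ in Set.Ioc (t : ℝ) T, b :=
        setLIntegral_mono measurable_const fun v hv => hz v ⟨t.coe_nonneg.trans hv.1.le, hv.2⟩
    _ = b * ENNReal.ofReal (T - t) := by rw [setLIntegral_const, Real.volume_Ioc]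
    _ ≤ b * T := by
        gcongr
        rw [← ENNReal.ofReal_coe_nnreal]
        exact ENNReal.ofReal_le_ofReal (by linarith [t.coe_nonneg])

theorem pendingValue_le {κ : Ω → Measure ℝ≥0∞} {ω : Ω} {b : ℝ≥0∞}
    (hz : ∀ u ∈ Set.Icc (0 : ℝ) T, Z (ω, u) ≤ b) (M₁ c : ℝ≥0∞) (t : ℝ≥0) :
    pendingValue κ ρ Z M₁ c t T ω ≤ M₁ * b + c * (b * T) :=
  ENNReal.div_le_of_le_mul (claimValue_le hz)

theorem policyValue_le {κ : Ω → Measure ℝ≥0∞} {ω : Ω} {b : ℝ≥0∞}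
    (hz : ∀ u ∈ Set.Icc (0 : ℝ) T, Z (ω, u) ≤ b) (M₁ c : ℝ≥0∞) (t : ℝ≥0) (i : Fin n) :
    C.policyValue κ ρ Z M₁ c t T i ω ≤ (M₁ + c * T + c * T) * b := by
  have h1 : ∀ s : Set Ω, s.indicator (fun _ => (1 : ℝ≥0∞)) ω ≤ 1 := fun s =>
    Set.indicator_le_self' (fun _ _ => zero_le_one) ω
  calc C.policyValue κ ρ Z M₁ c t T i ω
      ≤ 1 * (c * (b * T)) + 1 * (M₁ * b + c * (b * T)) :=
        add_le_add (mul_le_mul' (h1 _) (reportedValue_le hz c t))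
          (mul_le_mul' (h1 _) (pendingValue_le hz M₁ c t))
    _ = (M₁ + c * T + c * T) * b := by ring

namespace IsReportModel

variable [IsProbabilityMeasure P]

/-- The count formula without any conditioning equates the expected payment with that of the policy
value, which is at most a constant times the dominating variable. -/
theorem lintegral_policyPayment_ne_top (h : IsReportModel P 𝓕 C μ κ ρ)
    (hc : IsClaimModel P C rate T M M₁)
    (hZ : @Measurable _ _ (@Prod.instMeasurableSpace _ _ (sigmaAt 𝓕 ∞) _) _ Z) (htT : t ≤ T)
    {b : Ω → ℝ≥0∞} (hb : ∫⁻ ω, b ω ∂P ≠ ∞)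
    (hZb : ∀ᵐ ω ∂P, ∀ u ∈ Set.Icc (0 : ℝ) T, Z (ω, u) ≤ b ω) (i : Fin n) :
    ∫⁻ ω, C.policyPayment Z t T i ω ∂P ≠ ∞ := by
  have h1 := h.setLIntegral_policyPayment_count hc hZ htT i
    (@MeasurableSet.univ _ (C.otherInfo 𝓕 i)) (ι := Empty) (s := fun _ => 0)
    (B := fun _ => Set.univ) (by simp) (by simp) (E := Set.univ) MeasurableSet.univ
  simp only [Set.mem_univ, Set.ofPred_true, Set.inter_univ, Measure.restrict_univ] at h1
  have hK : M₁ + M * rate * T + M * rate * T ≠ ∞ := by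
    have := hc.mark_ne_top
    have := hc.dev_ne_top
    finiteness
  rw [h1]
  refine ne_top_of_le_ne_top ?_ (lintegral_mono_ae (hZb.mono fun ω hω =>
    policyValue_le hω M₁ (M * rate) t i))
  rw [lintegral_const_mul' _ _ hK]
  exact ENNReal.mul_ne_top hK hb

theorem setLIntegral_policyPayment (h : IsReportModel P 𝓕 C μ κ ρ)
    (hc : IsClaimModel P C rate T M M₁)
    (hZ : @Measurable _ _ (@Prod.instMeasurableSpace _ _ (sigmaAt 𝓕 ∞) _) _ Z) (htT : t ≤ T)
    {b : Ω → ℝ≥0∞} (hb : ∫⁻ ω, b ω ∂P ≠ ∞)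
    (hZb : ∀ᵐ ω ∂P, ∀ u ∈ Set.Icc (0 : ℝ) T, Z (ω, u) ≤ b ω) (i : Fin n) {A : Set Ω}
    (hA : MeasurableSet[C.globalInfo 𝓕 t] A) :
    ∫⁻ ω in A, C.policyPayment Z t T i ω ∂P
      = ∫⁻ ω in A, C.policyValue (fun ω => κ ω) ρ Z M₁ (M * rate) t T i ω ∂P := by
  have h0 := h.lintegral_policyPayment_ne_top hc hZ htT hb hZb i
  refine setLIntegral_eq_of_generateFrom_inter
    (@MeasurableSpace.generateFrom_measurableSet _ (C.otherInfo 𝓕 i)).symm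
    (C.policyInfo_eq_generateFrom t i) (C.otherInfo_le 𝓕 i) (C.policyInfo_le t i)
    (@MeasurableSpace.isPiSystem_measurableSet _ (C.otherInfo 𝓕 i))
    (C.isPiSystem_policyEvents t i) (@MeasurableSet.univ _ (C.otherInfo 𝓕 i))
    (C.univ_mem_policyEvents t i) h0 ?_ (C.globalInfo_le_sup_policyInfo 𝓕 t i _ hA)
  intro D hD A hA
  obtain ⟨F, E, hE, rfl⟩ := C.exists_of_mem_policyEvents hA
  exact h.setLIntegral_policyPayment_count hc hZ htT i hD (fun l => l.1.2.1) (fun l => l.1.2.2) hE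

/-- The policy value still depends on `𝓕_∞`. It splits along the `globalInfo` event that the claim
is reported, and on each part immersion replaces the `𝓕_∞`-measurable factor by its conditional
expectation given `𝓕 t`. -/
theorem condLExp_policyPayment (h : IsReportModel P 𝓕 C μ κ ρ)
    (hc : IsClaimModel P C rate T M M₁)
    (hZ : @Measurable _ _ (@Prod.instMeasurableSpace _ _ (sigmaAt 𝓕 ∞) _) _ Z) (htT : t ≤ T)
    {b : Ω → ℝ≥0∞} (hb : ∫⁻ ω, b ω ∂P ≠ ∞)
    (hZb : ∀ᵐ ω ∂P, ∀ u ∈ Set.Icc (0 : ℝ) T, Z (ω, u) ≤ b ω) (i : Fin n) :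
    P⁻[C.policyPayment Z t T i|C.globalInfo 𝓕 t] =ᵐ[P] fun ω =>
      {ω | C.eventTime i 0 ω ≤ t}.indicator (fun _ => 1) ω
          * (P⁻[reportedValue Z (M * rate) t T|𝓕 t]) ω
        + {ω | (t : ℝ≥0∞) < C.eventTime i 0 ω}.indicator (fun _ => 1) ω
          * (P⁻[pendingValue (fun ω => κ ω) ρ Z M₁ (M * rate) t T|𝓕 t]) ω := by
  have hmk := h.accident.isMarkov
  have hρ := h.prob
  have hR : Measurable[sigmaAt 𝓕 ∞] (reportedValue Z (M * rate) t T) :=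
    @measurable_reportedValue Ω (sigmaAt 𝓕 ∞) Z hZ _ t T
  have hN : Measurable[sigmaAt 𝓕 ∞] (pendingValue (fun ω => κ ω) ρ Z M₁ (M * rate) t T) :=
    @measurable_pendingValue Ω (sigmaAt 𝓕 ∞) Z κ _ ρ _ hZ _ _ t T
  have hle := sigmaAt_le 𝓕 ∞
  have hMt := hc.dev_ne_top
  have hM1 := hc.mark_ne_top
  have hRf : ∫⁻ ω, reportedValue Z (M * rate) t T ω ∂P ≠ ∞ := by
    refine ne_top_of_le_ne_top ?_ (lintegral_mono_ae (hZb.mono fun ω hω =>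
      (reportedValue_le hω (M * rate) t).trans_eq
        (show _ = (M * rate * T) * b ω by ring)))
    rw [lintegral_const_mul' _ _ (by finiteness)]
    exact ENNReal.mul_ne_top (by finiteness) hb
  have hNf : ∫⁻ ω, pendingValue (fun ω => κ ω) ρ Z M₁ (M * rate) t T ω ∂P ≠ ∞ := by
    refine ne_top_of_le_ne_top ?_ (lintegral_mono_ae (hZb.mono fun ω hω =>
      (pendingValue_le hω M₁ (M * rate) t).trans_eq
        (show _ = (M₁ + M * rate * T) * b ω by ring)))
    rw [lintegral_const_mul' _ _ (by finiteness)]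
    exact ENNReal.mul_ne_top (by finiteness) hb
  have hS := C.measurableSet_report_le 𝓕 t i
  have hS' : MeasurableSet[C.globalInfo 𝓕 t] {ω | (t : ℝ≥0∞) < C.eventTime i 0 ω} := by
    have : {ω | (t : ℝ≥0∞) < C.eventTime i 0 ω} = {ω | C.eventTime i 0 ω ≤ t}ᶜ := by
      ext ω
      simp
    rw [this]
    exact @MeasurableSet.compl _ _ (C.globalInfo 𝓕 t) hS
  have hGle := C.globalInfo_le 𝓕 t
  have m1 := (measurable_condLExp (𝓕 t) P (reportedValue Z (M * rate) t T)).mono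
    (le_sup_left : _ ≤ C.globalInfo 𝓕 t) le_rfl
  have m2 := (measurable_condLExp (𝓕 t) P
    (pendingValue (fun ω => κ ω) ρ Z M₁ (M * rate) t T)).mono
    (le_sup_left : _ ≤ C.globalInfo 𝓕 t) le_rfl
  have hone : ∀ {S : Set Ω}, MeasurableSet[C.globalInfo 𝓕 t] S →
      Measurable[C.globalInfo 𝓕 t] (S.indicator fun _ => (1 : ℝ≥0∞)) := fun hS =>
    Measurable.indicator measurable_const hS
  have hmul : ∀ {A S : Set Ω}, MeasurableSet S → ∀ f : Ω → ℝ≥0∞,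
      ∫⁻ ω in A, S.indicator (fun _ => 1) ω * f ω ∂P = ∫⁻ ω in A ∩ S, f ω ∂P := by
    intro A S hS f
    rw [Set.inter_comm, ← Measure.restrict_restrict hS, ← lintegral_indicator hS]
    refine lintegral_congr fun ω => ?_
    by_cases hω : ω ∈ S <;> simp [hω]
  refine (MeasureTheory.ae_eq_condLExp hGle P _ (((hone hS).mul m1).add ((hone hS').mul m2))
    fun A hA => ?_).symm
  rw [h.setLIntegral_policyPayment hc hZ htT hb hZb i hA]
  have hpast := C.globalInfo_le_sup_pastInfo 𝓕 t
  unfold Portfolio.policyValue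
  have a1 : Measurable fun ω => {ω | C.eventTime i 0 ω ≤ t}.indicator (fun _ => 1) ω
      * (P⁻[reportedValue Z (M * rate) t T|𝓕 t]) ω := ((hone hS).mul m1).mono hGle le_rfl
  have a2 : Measurable fun ω => {ω | C.eventTime i 0 ω ≤ t}.indicator (fun _ => 1) ω
      * reportedValue Z (M * rate) t T ω :=
    ((hone hS).mono hGle le_rfl).mul (hR.mono hle le_rfl)
  refine (lintegral_add_left a1 (fun ω =>
    {ω | (t : ℝ≥0∞) < C.eventTime i 0 ω}.indicator (fun _ => 1) ω
      * (P⁻[pendingValue (fun ω => κ ω) ρ Z M₁ (M * rate) t T|𝓕 t]) ω)).trans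
          (Eq.trans ?_ (lintegral_add_left a2 _).symm)
  rw [hmul (hGle _ hS), hmul (hGle _ hS'), hmul (hGle _ hS), hmul (hGle _ hS'),
    h.reduced.setLIntegral_condLExp_pastInfo t hR hRf
      (hpast _ (@MeasurableSet.inter _ (C.globalInfo 𝓕 t) _ _ hA hS)),
    h.reduced.setLIntegral_condLExp_pastInfo t hN hNf
      (hpast _ (@MeasurableSet.inter _ (C.globalInfo 𝓕 t) _ _ hA hS'))]

/-- Not being reported at `t` is a past event, so its probability given `𝓕_∞` is already known at
`t`. -/
theorem sumLaw_ae_eq_condLExp (h : IsReportModel P 𝓕 C μ κ ρ) (i : Fin n) (t : ℝ≥0) :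
    (fun ω => sumLaw (κ ω) ρ (Set.Ioi t))
      =ᵐ[P] P⁻[{ω | (t : ℝ≥0∞) < C.eventTime i 0 ω}.indicator 1|𝓕 t] := by
  have hS' : MeasurableSet[C.globalInfo 𝓕 t] {ω | (t : ℝ≥0∞) < C.eventTime i 0 ω} := by
    have : {ω | (t : ℝ≥0∞) < C.eventTime i 0 ω} = {ω | C.eventTime i 0 ω ≤ t}ᶜ := by
      ext ω
      simp
    rw [this]
    exact @MeasurableSet.compl _ _ (C.globalInfo 𝓕 t) (C.measurableSet_report_le 𝓕 t i)
  exact (h.ae_eq_condLExp i measurableSet_Ioi).trans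
    (h.reduced.condLExp_sigmaAt_top_of_pastInfo t (C.globalInfo_le_sup_pastInfo 𝓕 t _ hS')).symm

theorem condLExp_pendingValue (h : IsReportModel P 𝓕 C μ κ ρ) (i : Fin n)
    (hZ : @Measurable _ _ (@Prod.instMeasurableSpace _ _ (sigmaAt 𝓕 ∞) _) _ Z) (M₁ c : ℝ≥0∞)
    (t T : ℝ≥0) : P⁻[pendingValue (fun ω => κ ω) ρ Z M₁ c t T|𝓕 t] =ᵐ[P] fun ω =>
      (P⁻[fun ω => claimValue (sumLaw (κ ω) ρ) (fun u => Z (ω, u)) M₁ c t T|𝓕 t]) ω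
        / sumLaw (κ ω) ρ (Set.Ioi t) := by
  have hmk := h.accident.isMarkov
  have hρ := h.prob
  have hd := h.sumLaw_ae_eq_condLExp i t
  have hN : Measurable[sigmaAt 𝓕 ∞] fun ω =>
      claimValue (sumLaw (κ ω) ρ) (fun u => Z (ω, u)) M₁ c t T :=
    @measurable_claimValue Ω (sigmaAt 𝓕 ∞) Z κ _ ρ _ hZ _ _ t T
  have e : pendingValue (fun ω => κ ω) ρ Z M₁ c t T =ᵐ[P] fun ω =>
      ((P⁻[{ω | (t : ℝ≥0∞) < C.eventTime i 0 ω}.indicator 1|𝓕 t]) ω)⁻¹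
        * claimValue (sumLaw (κ ω) ρ) (fun u => Z (ω, u)) M₁ c t T := by
    filter_upwards [hd] with ω hω
    rw [pendingValue, hω, div_eq_mul_inv, mul_comm]
  refine (condLExp_congr_ae e).trans ((condLExp_mul_left (𝓕.le t)
    (hN.mono (sigmaAt_le 𝓕 ∞) le_rfl).aemeasurable (measurable_condLExp _ P _).inv).trans ?_)
  filter_upwards [hd] with ω hω
  rw [hω, div_eq_mul_inv, mul_comm]
  rfl

end IsReportModel
end NonLife
end

/-! ### Back to real-valued integrals and distribution functions -/

noncomputable section
namespace NonLife

/-- The distribution function of a finite measure on the line. -/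
def distFun (ν : Measure ℝ) [IsFiniteMeasure ν] : StieltjesFunction ℝ where
  toFun u := ν.real (Set.Iic u)
  mono' _ _ h := measureReal_mono (Set.Iic_subset_Iic.2 h)
  right_continuous' x := by
    rw [← continuousWithinAt_Ioi_iff_Ici]
    have h := tendsto_measure_biInter_gt (μ := ν) (s := Set.Iic) (a := x)
      (fun r _ => measurableSet_Iic.nullMeasurableSet) (fun i j _ hij => Set.Iic_subset_Iic.2 hij)
      ⟨x + 1, by simp, measure_ne_top _ _⟩
    have e : ⋂ r > x, Set.Iic r = Set.Iic x := by
      ext y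
      simp only [Set.mem_iInter, Set.mem_Iic]
      exact ⟨fun hy => le_of_forall_gt_imp_ge_of_dense hy, fun hy r hr => hy.trans (le_of_lt hr)⟩
    rw [e] at h
    exact (ENNReal.tendsto_toReal (measure_ne_top _ _)).comp h

theorem distFun_measure (ν : Measure ℝ) [IsFiniteMeasure ν] : (distFun ν).measure = ν := by
  refine (Measure.ext_of_Ioc' ν _ (fun a b _ => measure_ne_top _ _) fun a b hab => ?_).symm
  rw [StieltjesFunction.measure_Ioc, ← Set.Iic_sdiff_Iic,
    measure_sdiff (Set.Iic_subset_Iic.2 hab.le) measurableSet_Iic.nullMeasurableSet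
      (measure_ne_top _ _)]
  change _ = ENNReal.ofReal (ν.real (Set.Iic b) - ν.real (Set.Iic a))
  rw [ENNReal.ofReal_sub _ measureReal_nonneg, ofReal_measureReal, ofReal_measureReal]

/-- The part on the line of a law on `[0, ∞]`. -/
def finitePart (r : Measure ℝ≥0∞) : Measure ℝ := (r.restrict (Set.Iio ∞)).map ENNReal.toReal

instance (r : Measure ℝ≥0∞) [IsFiniteMeasure r] : IsFiniteMeasure (finitePart r) :=
  inferInstanceAs (IsFiniteMeasure ((r.restrict (Set.Iio ∞)).map ENNReal.toReal))

theorem finitePart_Iic (r : Measure ℝ≥0∞) (u : ℝ≥0) :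
    finitePart r (Set.Iic (u : ℝ)) = r (Set.Iic (u : ℝ≥0∞)) := by
  rw [finitePart, Measure.map_apply ENNReal.measurable_toReal measurableSet_Iic,
    Measure.restrict_apply (ENNReal.measurable_toReal measurableSet_Iic)]
  congr 1
  ext x
  simp only [Set.mem_inter_iff, Set.mem_preimage, Set.mem_Iic, Set.mem_Iio]
  refine ⟨fun ⟨h1, h2⟩ => ?_, fun h => ?_⟩
  · lift x to ℝ≥0 using h2.ne
    exact_mod_cast h1
  · have h2 := h.trans_lt ENNReal.coe_lt_top
    lift x to ℝ≥0 using h2.ne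
    exact ⟨by exact_mod_cast h, h2⟩

theorem setLIntegral_finitePart (r : Measure ℝ≥0∞) {f : ℝ → ℝ≥0∞} (hf : Measurable f) (t T : ℝ≥0) :
    ∫⁻ u in Set.Ioc (t : ℝ) T, f u ∂finitePart r
      = ∫⁻ u in {u : ℝ≥0∞ | (t : ℝ≥0∞) < u ∧ u ≤ T}, f u.toReal ∂r := by
  rw [finitePart, setLIntegral_map measurableSet_Ioc hf ENNReal.measurable_toReal,
    Measure.restrict_restrict (ENNReal.measurable_toReal measurableSet_Ioc)]
  congr 2
  ext x
  simp only [Set.mem_inter_iff, Set.mem_preimage, Set.mem_Ioc, Set.mem_Iio, Set.mem_ofPred_eq]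
  refine ⟨fun ⟨h1, h2⟩ => ?_, fun h => ?_⟩
  · lift x to ℝ≥0 using h2.ne
    exact_mod_cast h1
  · have h2 := h.2.trans_lt ENNReal.coe_lt_top
    lift x to ℝ≥0 using h2.ne
    exact ⟨by exact_mod_cast h, h2⟩

/-- Every integrand is continuous in time and nonnegative, so Lebesgue and Bochner integrals
correspond; the window `(t, T]` excludes the atom at `∞`. -/
theorem toReal_claimValue (r : Measure ℝ≥0∞) {z : ℝ → ℝ} (hz : Continuous z)
    (hz0 : ∀ u, 0 ≤ z u) {m₁ c : ℝ} (hm₁ : 0 ≤ m₁) (hc : 0 ≤ c) (t T : ℝ≥0) :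
    (claimValue r (fun u => ENNReal.ofReal (z u)) (ENNReal.ofReal m₁) (ENNReal.ofReal c) t T).toReal
      = ∫ u in Set.Ioc (t : ℝ) T, (m₁ * z u + c * ∫ v in u..(T : ℝ), z v) ∂finitePart r := by
  have hcont : Continuous fun u => m₁ * z u + c * ∫ v in u..(T : ℝ), z v := by
    have : Continuous fun u => ∫ v in u..(T : ℝ), z v := by
      have h1 := intervalIntegral.continuous_primitive (μ := volume)
        (fun a b => hz.intervalIntegrable a b) (T : ℝ)
      refine h1.neg.congr fun u => ?_
      exact (intervalIntegral.integral_symm _ _).symm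
    fun_prop
  have hin : ∀ u ≤ (T : ℝ), ∫⁻ v in Set.Ioc u T, ENNReal.ofReal (z v)
      = ENNReal.ofReal (∫ v in u..(T : ℝ), z v) := fun u hu => by
    rw [intervalIntegral.integral_of_le hu, ofReal_integral_eq_lintegral_ofReal
      ((hz.integrableOn_Icc).mono_set Set.Ioc_subset_Icc_self) (ae_of_all _ hz0)]
  have hnn : ∀ u ≤ (T : ℝ), 0 ≤ ∫ v in u..(T : ℝ), z v := fun u hu =>
    intervalIntegral.integral_nonneg hu fun v _ => hz0 v
  rw [integral_eq_lintegral_of_nonneg_ae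
    ((ae_restrict_iff' measurableSet_Ioc).2 (ae_of_all _ fun u hu =>
      add_nonneg (mul_nonneg hm₁ (hz0 u)) (mul_nonneg hc (hnn u hu.2))))
    hcont.aestronglyMeasurable,
    setLIntegral_finitePart r (f := fun u => ENNReal.ofReal (m₁ * z u + c * ∫ v in u..(T : ℝ), z v))
      (hcont.measurable.ennreal_ofReal)]
  congr 1
  refine setLIntegral_congr_fun (measurableSet_window t T) fun u hu => ?_
  have huT : u.toReal ≤ T := by
    rw [← ENNReal.coe_toReal]
    exact ENNReal.toReal_mono ENNReal.coe_ne_top hu.2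
  rw [hin _ huT, ENNReal.ofReal_add (mul_nonneg hm₁ (hz0 _)) (mul_nonneg hc (hnn _ huT)),
    ENNReal.ofReal_mul hm₁, ENNReal.ofReal_mul hc]

theorem toReal_reportedValue {Ω : Type*} {z : Ω → ℝ → ℝ} (hz : ∀ ω, Continuous (z ω))
    (hz0 : ∀ ω u, 0 ≤ z ω u) {c : ℝ} (hc : 0 ≤ c) {t T : ℝ≥0} (htT : t ≤ T) (ω : Ω) :
    (reportedValue (fun q : Ω × ℝ => ENNReal.ofReal (z q.1 q.2)) (ENNReal.ofReal c) t T ω).toReal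
      = c * ∫ v in (t : ℝ)..T, z ω v := by
  have htT' : (t : ℝ) ≤ T := by exact_mod_cast htT
  rw [reportedValue, ENNReal.toReal_mul, ENNReal.toReal_ofReal hc,
    intervalIntegral.integral_of_le htT', ← ofReal_integral_eq_lintegral_ofReal
      (((hz ω).integrableOn_Icc).mono_set Set.Ioc_subset_Icc_self) (ae_of_all _ (hz0 ω)),
    ENNReal.toReal_ofReal (integral_nonneg (hz0 ω))]

end NonLife
end

/-! ### The benchmarked index and the cumulative payment -/

noncomputable section
namespace NonLife

variable {Ω : Type*} {mΩ : MeasurableSpace Ω} {n d : ℕ} {P : Measure Ω} {𝓕 : Filtration ℝ≥0 mΩ}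
  {C : Portfolio Ω n} {μ : ℝ≥0 → Ω → ℝ} {I Sstar : ℝ≥0 → Ω → ℝ} {S : Fin d → ℝ≥0 → Ω → ℝ}
  {T : ℝ≥0}

theorem distFun_finitePart_apply (r : Measure ℝ≥0∞) [IsFiniteMeasure r] (u : ℝ≥0) :
    distFun (finitePart r) u = r.real (Set.Iic (u : ℝ≥0∞)) := by
  change (finitePart r).real (Set.Iic (u : ℝ)) = _
  rw [Measure.real, finitePart_Iic, Measure.real]

theorem IsReportModel.sumLaw_Iic_ae_eq_condProb [IsProbabilityMeasure P]
    {κ : @Kernel Ω ℝ≥0∞ (sigmaAt 𝓕 ∞) inferInstance} {ρ : Measure ℝ≥0}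
    (h : IsReportModel P 𝓕 C μ κ ρ) (i : Fin n) (u : ℝ≥0) :
    (fun ω => (sumLaw (κ ω) ρ).real (Set.Iic (u : ℝ≥0∞)))
      =ᵐ[P] condProb P {ω | C.eventTime i 0 ω ≤ u} (𝓕 u) := by
  have hS := C.measurableSet_report_le 𝓕 u i
  filter_upwards [h.ae_eq_condLExp i (s := Set.Iic (u : ℝ≥0∞)) measurableSet_Iic,
    h.reduced.condLExp_sigmaAt_top_of_pastInfo u (C.globalInfo_le_sup_pastInfo 𝓕 u _ hS),
    condLExp_indicator_one (P := P) (𝓕 u) (C.globalInfo_le 𝓕 u _ hS),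
    condProb_nonneg (P := P) {ω | C.eventTime i 0 ω ≤ u} (𝓕 u)] with ω h1 h2 h3 h4
  rw [Measure.real, h1]
  change ((P⁻[{ω | C.eventTime i 0 ω ≤ u}.indicator 1|sigmaAt 𝓕 ∞]) ω).toReal = _
  rw [← h2, h3, ENNReal.toReal_ofReal h4]

/-- The benchmarked index, stopped at time `T`, as a process on the real line. -/
def realIndex (I Sstar : ℝ≥0 → Ω → ℝ) (T : ℝ≥0) (ω : Ω) (u : ℝ) : ℝ :=
  I (min u.toNNReal T) ω / Sstar (min u.toNNReal T) ω

theorem realIndex_coe {u : ℝ≥0} (hu : u ≤ T) (ω : Ω) :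
    realIndex I Sstar T ω u = I u ω / Sstar u ω := by
  rw [realIndex, Real.toNNReal_coe, min_eq_left hu]

namespace IsMarket

theorem continuous_realIndex (h : IsMarket P 𝓕 I Sstar S T) (ω : Ω) :
    Continuous (realIndex I Sstar T ω) := by
  have hm : Continuous fun u : ℝ => min u.toNNReal T := continuous_real_toNNReal.min
      continuous_const
  have hT : ∀ u : ℝ, min u.toNNReal T ∈ Set.Iic T := fun u => Set.mem_Iic.2 (min_le_right _ _)
  refine Continuous.div ((h.index_continuous ω).comp_continuous hm hT)
    ((h.benchmark_continuous ω).comp_continuous hm hT) fun u => (h.benchmark_pos ω _ (hT u)).ne'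

theorem realIndex_nonneg (h : IsMarket P 𝓕 I Sstar S T) (ω : Ω) (u : ℝ) :
    0 ≤ realIndex I Sstar T ω u :=
  div_nonneg (h.index_nonneg ω _ (min_le_right _ _)) (h.benchmark_pos ω _ (min_le_right _ _)).le

theorem measurable_realIndex (h : IsMarket P 𝓕 I Sstar S T) (u : ℝ) :
    Measurable[𝓕 (min u.toNNReal T)] fun ω => realIndex I Sstar T ω u :=
  (h.index_adapted _ (min_le_right _ _)).div (h.benchmark_adapted _ (min_le_right _ _))

/-- Stopping at `T` makes the paths continuous on the whole line; continuity in time and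
measurability at each time give joint measurability. -/
theorem measurable_uncurry_realIndex (h : IsMarket P 𝓕 I Sstar S T) :
    @Measurable _ _ (@Prod.instMeasurableSpace _ _ (sigmaAt 𝓕 ∞) _) _
      fun q : Ω × ℝ => realIndex I Sstar T q.1 q.2 := by
  have h1 := @measurable_uncurry_of_continuous_of_measurable Ω ℝ ℝ _ _ _ _ _ _ _ _ _
    (sigmaAt 𝓕 ∞) (fun u ω => realIndex I Sstar T ω u) h.continuous_realIndex
    fun u => (h.measurable_realIndex u).mono (le_sigmaAt_top 𝓕 _) le_rfl
  exact h1.comp (@measurable_swap _ _ (sigmaAt 𝓕 ∞) _)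

end IsMarket

theorem realIndex_le {B : Ω → ℝ} {ω : Ω} (hB : ∀ u ≤ T, I u ω / Sstar u ω ≤ B ω) (u : ℝ) :
    realIndex I Sstar T ω u ≤ B ω := hB _ (min_le_right _ _)

theorem payAfter_eq_tsum (C : Portfolio Ω n) (i : Fin n) (z : ℝ → ℝ≥0∞) (t T : ℝ≥0) (ω : Ω) :
    payAfter z t T (C.report i ω) (C.dev i ω) = ∑' j,
      {ω | (t : ℝ≥0∞) < C.eventTime i j ω ∧ C.eventTime i j ω ≤ T}.indicator
        (fun ω => ((C.mark i j ω).2 : ℝ≥0∞) * z (C.eventTime i j ω).toReal) ω := by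
  rw [tsum_eq_zero_add' ENNReal.summable, payAfter, devSum]
  simp only [Set.indicator_apply]
  rfl

theorem payment_sub_payment (C : Portfolio Ω n)
    (hI : ∀ ω u, 0 ≤ realIndex I Sstar T ω u) {t : ℝ≥0} (htT : t ≤ T) {ω : Ω}
    (hω : ∀ i, Tendsto (fun j => C.devTime i j ω) atTop (𝓝 ∞)) :
    C.payment I Sstar T ω - C.payment I Sstar t ω = ∑ i, (C.policyPayment
      (fun q => ENNReal.ofReal (realIndex I Sstar T q.1 q.2)) t T i ω).toReal := by
  have htT' : (t : ℝ≥0∞) ≤ T := by exact_mod_cast htT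
  unfold Portfolio.payment
  rw [← Finset.sum_sub_distrib]
  refine Finset.sum_congr rfl fun i _ => ?_
  have hsum : ∀ s ≤ T, Summable fun j => {ω | C.eventTime i j ω ≤ s}.indicator
      (fun ω => I (C.eventTime i j ω).toNNReal ω / Sstar (C.eventTime i j ω).toNNReal ω
        * ((C.mark i j ω).2 : ℝ)) ω := by
    intro s hs
    -- On this path only finitely many events occur up to `T`, so the real series are finite sums
    -- and can be subtracted term by term.
    have hev : ∀ᶠ j in atTop, (T : ℝ≥0∞) < C.devTime i j ω :=
      (hω i).eventually (lt_mem_nhds ENNReal.coe_lt_top)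
    obtain ⟨N, hN⟩ := eventually_atTop.1 hev
    refine summable_of_ne_finset_zero (s := Finset.range (N + 1)) fun j hj => ?_
    obtain ⟨k, rfl⟩ : ∃ k, j = k + 1 := ⟨j - 1, by simp at hj; omega⟩
    refine Set.indicator_of_notMem (fun hmem => ?_) _
    have h1 : C.eventTime i (k + 1) ω ≤ s := hmem
    have h2 : C.devTime i k ω ≤ C.eventTime i (k + 1) ω := le_add_self
    have h3 := hN k (by simp at hj; omega)
    exact absurd (h2.trans h1) (not_le.2 (lt_of_le_of_lt (by exact_mod_cast hs) h3))
  rw [← (hsum T le_rfl).tsum_sub (hsum t htT), Portfolio.policyPayment, payAfter_eq_tsum,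
    ENNReal.tsum_toReal_eq]
  · refine tsum_congr fun j => ?_
    by_cases hT : C.eventTime i j ω ≤ T
    · have hne : C.eventTime i j ω ≠ ∞ := (hT.trans_lt ENNReal.coe_lt_top).ne
      have hz : realIndex I Sstar T ω (C.eventTime i j ω).toReal
          = I (C.eventTime i j ω).toNNReal ω / Sstar (C.eventTime i j ω).toNNReal ω := by
        rw [← ENNReal.coe_toNNReal_eq_toReal]
        refine realIndex_coe ?_ ω
        simpa using ENNReal.toNNReal_mono ENNReal.coe_ne_top hT
      by_cases ht : C.eventTime i j ω ≤ t
      · rw [Set.indicator_of_mem (show ω ∈ {ω | C.eventTime i j ω ≤ T} from hT),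
          Set.indicator_of_mem (show ω ∈ {ω | C.eventTime i j ω ≤ t} from ht),
          Set.indicator_of_notMem (fun hmem => absurd hmem.1 (not_lt.2 ht)), sub_self,
          ENNReal.toReal_zero]
      · rw [Set.indicator_of_mem (show ω ∈ {ω | C.eventTime i j ω ≤ T} from hT),
          Set.indicator_of_notMem (show ω ∉ {ω | C.eventTime i j ω ≤ t} from ht),
          Set.indicator_of_mem (show ω ∈ {ω | (t : ℝ≥0∞) < C.eventTime i j ω
            ∧ C.eventTime i j ω ≤ T} from ⟨not_le.1 ht, hT⟩), ENNReal.toReal_mul,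
          ENNReal.toReal_ofReal (hI _ _), hz, sub_zero, ENNReal.coe_toReal, mul_comm]
    · rw [Set.indicator_of_notMem (show ω ∉ {ω | C.eventTime i j ω ≤ T} from hT),
        Set.indicator_of_notMem (show ω ∉ {ω | C.eventTime i j ω ≤ t} from
          fun h => hT (le_trans h htT')),
        Set.indicator_of_notMem (fun hmem => hT hmem.2), sub_self, ENNReal.toReal_zero]
  · intro j
    refine ne_top_of_le_ne_top ?_ (Set.indicator_le_self' (fun _ _ => zero_le) ω)
    exact ENNReal.mul_ne_top ENNReal.coe_ne_top ENNReal.ofReal_ne_top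

theorem sum_ite_report (C : Portfolio Ω n) (t : ℝ≥0) (ω : Ω) (a b : ℝ) :
    (∑ i, ({ω | C.eventTime i 0 ω ≤ t}.indicator (fun _ => a) ω
        + {ω | (t : ℝ≥0∞) < C.eventTime i 0 ω}.indicator (fun _ => b) ω))
      = C.reported t ω * a + (n - C.reported t ω) * b := by
  have h : ∀ i, {ω | C.eventTime i 0 ω ≤ t}.indicator (fun _ => a) ω
        + {ω | (t : ℝ≥0∞) < C.eventTime i 0 ω}.indicator (fun _ => b) ω
      = {ω | C.eventTime i 0 ω ≤ t}.indicator (fun _ => (1 : ℝ)) ω * (a - b) + b := by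
    intro i
    by_cases hi : C.eventTime i 0 ω ≤ t
    · rw [Set.indicator_of_mem (show ω ∈ {ω | C.eventTime i 0 ω ≤ t} from hi),
        Set.indicator_of_mem (show ω ∈ {ω | C.eventTime i 0 ω ≤ t} from hi),
        Set.indicator_of_notMem (show ω ∉ {ω | (t : ℝ≥0∞) < C.eventTime i 0 ω} from not_lt.2 hi)]
      ring
    · rw [Set.indicator_of_notMem (show ω ∉ {ω | C.eventTime i 0 ω ≤ t} from hi),
        Set.indicator_of_notMem (show ω ∉ {ω | C.eventTime i 0 ω ≤ t} from hi),
        Set.indicator_of_mem (show ω ∈ {ω | (t : ℝ≥0∞) < C.eventTime i 0 ω} from not_le.1 hi)]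
      ring
  simp only [h]
  rw [Finset.sum_add_distrib, ← Finset.sum_mul, Portfolio.reported]
  simp
  ring

end NonLife
end

/-! ### The pricing formula before the index is priced -/

noncomputable section
namespace NonLife

variable {Ω : Type*} {mΩ : MeasurableSpace Ω} {n d : ℕ} {P : Measure Ω} {𝓕 : Filtration ℝ≥0 mΩ}
  {C : Portfolio Ω n} {μ : ℝ≥0 → Ω → ℝ} {I Sstar : ℝ≥0 → Ω → ℝ} {S : Fin d → ℝ≥0 → Ω → ℝ}
  {T t rate : ℝ≥0} {m m₁ c : ℝ} {κ : @Kernel Ω ℝ≥0∞ (sigmaAt 𝓕 ∞) inferInstance} {ρ : Measure ℝ≥0}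
  {B : Ω → ℝ}

theorem realIndex_of_le {u : ℝ} (hu : u ≤ T) (ω : Ω) :
    realIndex I Sstar T ω u = I u.toNNReal ω / Sstar u.toNNReal ω := by
  rw [realIndex, min_eq_left (Real.toNNReal_le_iff_le_coe.2 hu)]

theorem integral_realIndex {u : ℝ} (hu : u ≤ T) (ω : Ω) :
    ∫ v in u..(T : ℝ), realIndex I Sstar T ω v
      = ∫ v in u..(T : ℝ), I v.toNNReal ω / Sstar v.toNNReal ω :=
  intervalIntegral.integral_congr fun v hv => realIndex_of_le (by
    rw [Set.uIcc_of_le hu] at hv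
    exact hv.2) ω

/-- The benchmarked index as an extended nonnegative process. -/
def indexValue (I Sstar : ℝ≥0 → Ω → ℝ) (T : ℝ≥0) (q : Ω × ℝ) : ℝ≥0∞ :=
  ENNReal.ofReal (realIndex I Sstar T q.1 q.2)

theorem IsMarket.measurable_indexValue (hM : IsMarket P 𝓕 I Sstar S T) :
    @Measurable _ _ (@Prod.instMeasurableSpace _ _ (sigmaAt 𝓕 ∞) _) _ (indexValue I Sstar T) :=
  hM.measurable_uncurry_realIndex.ennreal_ofReal

theorem indexValue_le (hB : ∀ᵐ ω ∂P, ∀ u ≤ T, I u ω / Sstar u ω ≤ B ω) :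
    ∀ᵐ ω ∂P, ∀ u ∈ Set.Icc (0 : ℝ) T, indexValue I Sstar T (ω, u) ≤ ENNReal.ofReal (B ω) :=
  hB.mono fun _ hω u _ => ENNReal.ofReal_le_ofReal (realIndex_le hω u)

theorem ofReal_mul_rate (m : ℝ) (rate : ℝ≥0) :
    ENNReal.ofReal m * rate = ENNReal.ofReal (rate * m) := by
  rw [mul_comm, ENNReal.ofReal_mul rate.coe_nonneg, ENNReal.ofReal_coe_nnreal]

theorem toReal_condLExp_reportedValue (hM : IsMarket P 𝓕 I Sstar S T) (hBi : Integrable B P)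
    (hB : ∀ᵐ ω ∂P, ∀ u ≤ T, I u ω / Sstar u ω ≤ B ω) (hc : 0 ≤ c) (htT : t ≤ T) :
    (fun ω => (P⁻[reportedValue (indexValue I Sstar T) (ENNReal.ofReal c) t T|𝓕 t] ω).toReal)
      =ᵐ[P] fun ω => c
        * (P[fun ω => ∫ u in (t : ℝ)..T, I u.toNNReal ω / Sstar u.toNNReal ω|𝓕 t]) ω := by
  have hm := measurable_reportedValue (measurable_prod_mono (sigmaAt_le 𝓕 ∞)
    hM.measurable_indexValue) (ENNReal.ofReal c) t T
  have hfin : ∫⁻ ω, reportedValue (indexValue I Sstar T) (ENNReal.ofReal c) t T ω ∂P ≠ ∞ := by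
    refine ne_top_of_le_ne_top ?_ (lintegral_mono_ae ((indexValue_le hB).mono fun ω hω =>
      (reportedValue_le hω (ENNReal.ofReal c) t).trans_eq
        (show _ = (ENNReal.ofReal c * T) * ENNReal.ofReal (B ω) by ring)))
    rw [lintegral_const_mul' _ _ (by finiteness)]
    exact ENNReal.mul_ne_top (by finiteness) hBi.lintegral_lt_top.ne
  refine (toReal_condLExp (𝓕 t) hm.aemeasurable hfin).trans ?_
  have htT' : (t : ℝ) ≤ T := by exact_mod_cast htT
  have e : (fun ω => (reportedValue (indexValue I Sstar T) (ENNReal.ofReal c) t T ω).toReal)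
      = c • fun ω => ∫ u in (t : ℝ)..T, I u.toNNReal ω / Sstar u.toNNReal ω := by
    funext ω
    rw [Pi.smul_apply, smul_eq_mul, ← integral_realIndex htT']
    exact toReal_reportedValue hM.continuous_realIndex hM.realIndex_nonneg hc htT ω
  rw [e]
  exact condExp_smul c _ _

theorem toReal_condLExp_claimValue (h : IsReportModel P 𝓕 C μ κ ρ)
    (hM : IsMarket P 𝓕 I Sstar S T) (hBi : Integrable B P)
    (hB : ∀ᵐ ω ∂P, ∀ u ≤ T, I u ω / Sstar u ω ≤ B ω) (hm₁ : 0 ≤ m₁) (hc : 0 ≤ c) (t : ℝ≥0)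
    {p : Ω → StieltjesFunction ℝ} (hp : ∀ ω, (p ω).measure = finitePart (sumLaw (κ ω) ρ)) :
    (fun ω => (P⁻[fun ω => claimValue (sumLaw (κ ω) ρ) (fun u => indexValue I Sstar T (ω, u))
        (ENNReal.ofReal m₁) (ENNReal.ofReal c) t T|𝓕 t] ω).toReal)
      =ᵐ[P] unreportedNumerator P 𝓕 p m₁ c (fun u ω => I u ω / Sstar u ω) T t := by
  have hmk := h.accident.isMarkov
  have hρ := h.prob
  have hm : Measurable[sigmaAt 𝓕 ∞] fun ω => claimValue (sumLaw (κ ω) ρ)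
      (fun u => indexValue I Sstar T (ω, u)) (ENNReal.ofReal m₁) (ENNReal.ofReal c) t T :=
    @measurable_claimValue Ω (sigmaAt 𝓕 ∞) _ κ _ ρ _ hM.measurable_indexValue _ _ t T
  have hfin : ∫⁻ ω, claimValue (sumLaw (κ ω) ρ) (fun u => indexValue I Sstar T (ω, u))
      (ENNReal.ofReal m₁) (ENNReal.ofReal c) t T ∂P ≠ ∞ := by
    refine ne_top_of_le_ne_top ?_ (lintegral_mono_ae ((indexValue_le hB).mono fun ω hω =>
      ((claimValue_le hω).trans (mul_le_of_le_one_right' prob_le_one)).trans_eq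
        (show _ = (ENNReal.ofReal m₁ + ENNReal.ofReal c * T) * ENNReal.ofReal (B ω) by ring)))
    rw [lintegral_const_mul' _ _ (by finiteness)]
    exact ENNReal.mul_ne_top (by finiteness) hBi.lintegral_lt_top.ne
  refine (toReal_condLExp (𝓕 t) (hm.mono (sigmaAt_le 𝓕 ∞) le_rfl).aemeasurable hfin).trans ?_
  refine condExp_congr_ae (ae_of_all _ fun ω => ?_)
  change _ = ∫ u in Set.Ioc (t : ℝ) T, (m₁ * (I u.toNNReal ω / Sstar u.toNNReal ω)
    + c * ∫ v in u..(T : ℝ), I v.toNNReal ω / Sstar v.toNNReal ω) ∂(p ω).measure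
  rw [hp]
  refine (toReal_claimValue _ (hM.continuous_realIndex ω) (hM.realIndex_nonneg ω) hm₁ hc t T).trans
    (setIntegral_congr_fun measurableSet_Ioc fun u hu => ?_)
  rw [realIndex_of_le hu.2, integral_realIndex hu.2]

theorem integrable_toReal_policyPayment [IsProbabilityMeasure P] (h : IsReportModel P 𝓕 C μ κ ρ)
    {M M₁ : ℝ≥0∞}
    (hc : IsClaimModel P C rate T M M₁) (hM : IsMarket P 𝓕 I Sstar S T) (hBi : Integrable B P)
    (hB : ∀ᵐ ω ∂P, ∀ u ≤ T, I u ω / Sstar u ω ≤ B ω) (htT : t ≤ T) (i : Fin n) :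
    Integrable (fun ω => (C.policyPayment (indexValue I Sstar T) t T i ω).toReal) P :=
  integrable_toReal_of_lintegral_ne_top (measurable_policyPayment C
      (measurable_prod_mono (sigmaAt_le 𝓕 ∞) hM.measurable_indexValue) t T i).aemeasurable
    (h.lintegral_policyPayment_ne_top hc hM.measurable_indexValue htT hBi.lintegral_lt_top.ne
      (indexValue_le hB) i)

theorem payment_sub_payment_ae_eq (h : IsReducedForm P 𝓕 C μ) (hM : IsMarket P 𝓕 I Sstar S T)
    (htT : t ≤ T) : (fun ω => C.payment I Sstar T ω - C.payment I Sstar t ω)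
      =ᵐ[P] ∑ i, fun ω => (C.policyPayment (indexValue I Sstar T) t T i ω).toReal := by
  filter_upwards [ae_all_iff.2 h.dev_tendsto] with ω hω
  rw [Finset.sum_apply]
  exact payment_sub_payment C hM.realIndex_nonneg htT hω

theorem integrable_payment_sub_payment [IsProbabilityMeasure P] (h : IsReportModel P 𝓕 C μ κ ρ)
    {M M₁ : ℝ≥0∞}
    (hc : IsClaimModel P C rate T M M₁) (hM : IsMarket P 𝓕 I Sstar S T) (hBi : Integrable B P)
    (hB : ∀ᵐ ω ∂P, ∀ u ≤ T, I u ω / Sstar u ω ≤ B ω) (htT : t ≤ T) :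
    Integrable (fun ω => C.payment I Sstar T ω - C.payment I Sstar t ω) P :=
  (integrable_finsetSum' _ fun i _ =>
    integrable_toReal_policyPayment h hc hM hBi hB htT i).congr
    (payment_sub_payment_ae_eq h.reduced hM htT).symm

/-- Sum of the policy formulas. The two conditional values do not depend on the policy, so only the
number of reported claims remains. -/
theorem condExp_payment_sub_payment [IsProbabilityMeasure P] (h : IsReportModel P 𝓕 C μ κ ρ)
    (hm : 0 ≤ m) (hm₁ : 0 ≤ m₁)
    (hc : IsClaimModel P C rate T (ENNReal.ofReal m) (ENNReal.ofReal m₁))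
    (hM : IsMarket P 𝓕 I Sstar S T) (hBi : Integrable B P)
    (hB : ∀ᵐ ω ∂P, ∀ u ≤ T, I u ω / Sstar u ω ≤ B ω) (htT : t ≤ T)
    {p : Ω → StieltjesFunction ℝ} (hp : ∀ ω, (p ω).measure = finitePart (sumLaw (κ ω) ρ)) :
    P[fun ω => C.payment I Sstar T ω - C.payment I Sstar t ω|C.globalInfo 𝓕 t] =ᵐ[P] fun ω =>
      C.reported t ω * (rate * m
          * (P[fun ω => ∫ u in (t : ℝ)..T, I u.toNNReal ω / Sstar u.toNNReal ω|𝓕 t]) ω)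
        + (n - C.reported t ω) * (unreportedNumerator P 𝓕 p m₁ (rate * m)
            (fun u ω => I u ω / Sstar u ω) T t ω
              / (sumLaw (κ ω) ρ).real (Set.Ioi (t : ℝ≥0∞))) := by
  have hcr : 0 ≤ rate * m := mul_nonneg rate.coe_nonneg hm
  have hZ := hM.measurable_indexValue
  have hi : ∀ i, P[fun ω => (C.policyPayment (indexValue I Sstar T) t T i ω).toReal|
      C.globalInfo 𝓕 t] =ᵐ[P] fun ω => (P⁻[C.policyPayment (indexValue I Sstar T) t T i|
        C.globalInfo 𝓕 t] ω).toReal := fun i =>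
    (toReal_condLExp _ (measurable_policyPayment C (measurable_prod_mono (sigmaAt_le 𝓕 ∞) hZ)
      t T i).aemeasurable (h.lintegral_policyPayment_ne_top hc hZ htT hBi.lintegral_lt_top.ne
        (indexValue_le hB) i)).symm
  have hpay := fun i => h.condLExp_policyPayment hc hZ htT hBi.lintegral_lt_top.ne
    (indexValue_le hB) i
  have hpend := fun i => h.condLExp_pendingValue i hZ (ENNReal.ofReal m₁)
    (ENNReal.ofReal m * rate) t T
  rw [ofReal_mul_rate m] at hpay hpend
  refine (condExp_congr_ae (payment_sub_payment_ae_eq h.reduced hM htT)).trans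
    ((condExp_finsetSum (fun i _ => integrable_toReal_policyPayment h hc hM hBi hB htT i) _).trans
        ?_)
  filter_upwards [ae_all_iff.2 hi, ae_all_iff.2 hpay, ae_all_iff.2 hpend,
    toReal_condLExp_reportedValue hM hBi hB hcr htT,
    toReal_condLExp_claimValue h hM hBi hB hm₁ hcr t hp] with ω h1 h2 h3 h4 h5
  rw [Finset.sum_apply, ← sum_ite_report]
  refine Finset.sum_congr rfl fun i _ => ?_
  rw [h1 i, h2 i, h3 i, ← h4, ← h5]
  by_cases hle : C.eventTime i 0 ω ≤ t
  · rw [Set.indicator_of_mem (show ω ∈ {ω | C.eventTime i 0 ω ≤ t} from hle),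
      Set.indicator_of_mem (show ω ∈ {ω | C.eventTime i 0 ω ≤ t} from hle),
      Set.indicator_of_notMem (show ω ∉ {ω | (t : ℝ≥0∞) < C.eventTime i 0 ω} from not_lt.2 hle),
      Set.indicator_of_notMem (show ω ∉ {ω | (t : ℝ≥0∞) < C.eventTime i 0 ω} from not_lt.2 hle),
      one_mul, zero_mul, add_zero, add_zero]
  · rw [Set.indicator_of_mem (show ω ∈ {ω | (t : ℝ≥0∞) < C.eventTime i 0 ω} from not_le.1 hle),
      Set.indicator_of_mem (show ω ∈ {ω | (t : ℝ≥0∞) < C.eventTime i 0 ω} from not_le.1 hle),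
      Set.indicator_of_notMem (show ω ∉ {ω | C.eventTime i 0 ω ≤ t} from hle),
      Set.indicator_of_notMem (show ω ∉ {ω | C.eventTime i 0 ω ≤ t} from hle),
      one_mul, zero_mul, zero_add, zero_add, ENNReal.toReal_div]
    rfl

end NonLife
end

/-! ### The traded index: from local martingale to martingale -/

noncomputable section
namespace NonLife

variable {Ω : Type*} {mΩ : MeasurableSpace Ω} {n d : ℕ} {P : Measure Ω} {𝓕 : Filtration ℝ≥0 mΩ}
  {I Sstar : ℝ≥0 → Ω → ℝ} {S : Fin d → ℝ≥0 → Ω → ℝ} {T t : ℝ≥0} {B : Ω → ℝ}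

/-- A dominated local martingale is a martingale. -/
theorem IsLocalMartingaleUpTo.condExp_ae_eq [IsFiniteMeasure P] {X : ℝ≥0 → Ω → ℝ}
    (hX : IsLocalMartingaleUpTo P 𝓕 X T) (hXm : ∀ t ≤ T, Measurable[𝓕 t] (X t))
    (hBi : Integrable B P) (hB : ∀ᵐ ω ∂P, ∀ u ≤ T, ‖X u ω‖ ≤ B ω) {s u : ℝ≥0} (hsu : s ≤ u)
    (huT : u ≤ T) : P[X u|𝓕 s] =ᵐ[P] X s := by
  obtain ⟨τ, hτ, hmart⟩ := hX
  -- A stopped value is either `0` or a value of `X` at a time at most `T`, hence bounded by `B`.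
  -- Dominated convergence for conditional expectations then passes to the limit in the localizing
  -- sequence.
  have hbd : ∀ (k : ℕ) (v : ℝ≥0), ∀ᵐ ω ∂P, norm (stoppedProcess
      (fun i => {ω | ⊥ < τ k ω}.indicator (X (min i T))) (τ k) v ω) ≤ B ω := fun k v => by
    filter_upwards [hB] with ω hω
    exact (norm_indicator_le_norm_self _ _).trans (hω _ (min_le_right _ _))
  have hlim : ∀ v ≤ T, ∀ᵐ ω ∂P, Tendsto (fun k => stoppedProcess
      (fun i => {ω | ⊥ < τ k ω}.indicator (X (min i T))) (τ k) v ω) atTop (𝓝 (X v ω)) :=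
    fun v hv => by
      filter_upwards [hτ.tendsto_top] with ω hω
      refine tendsto_const_nhds.congr' ?_
      filter_upwards [hω.eventually (lt_mem_nhds (WithTop.coe_lt_top v))] with k hk
      rw [stoppedProcess_eq_of_le hk.le, min_eq_left hv,
        Set.indicator_of_mem (show ω ∈ {ω | ⊥ < τ k ω} from bot_le.trans_lt hk)]
  have hXs : Integrable (X s) P :=
    hBi.mono' ((hXm s (hsu.trans huT)).mono (𝓕.le s) le_rfl).aestronglyMeasurable
      (hB.mono fun ω hω => hω s (hsu.trans huT))
  refine (tendsto_condExp_unique _ _ _ _ (fun k => (hmart k).integrable u)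
    (fun k => (hmart k).integrable s) (hlim u huT) (hlim s (hsu.trans huT)) B hBi B hBi
    (fun k => hbd k u) (fun k => hbd k s) fun k => ((hmart k).condExp_ae_eq hsu).trans ?_).trans
    (condExp_of_stronglyMeasurable (𝓕.le s) (hXm s (hsu.trans huT)).stronglyMeasurable
        hXs).eventuallyEq
  rw [condExp_of_stronglyMeasurable (𝓕.le s) ((hmart k).stronglyAdapted s) ((hmart k).integrable s)]

/-- The conditional expectation of the time integral of a dominated martingale. -/
theorem condExp_intervalIntegral [IsProbabilityMeasure P] {z : Ω → ℝ → ℝ}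
    (hz : Measurable (Function.uncurry z)) (hzt : Measurable[𝓕 t] fun ω => z ω t)
    (hBi : Integrable B P) (hB : ∀ᵐ ω ∂P, ∀ u, ‖z ω u‖ ≤ B ω)
    (htT : t ≤ T) (hmart : ∀ u : ℝ≥0, t ≤ u → u ≤ T → P[fun ω => z ω u|𝓕 t] =ᵐ[P] fun ω => z ω t) :
    P[fun ω => ∫ u in (t : ℝ)..T, z ω u|𝓕 t] =ᵐ[P] fun ω => (T - t) * z ω t := by
  have htT' : (t : ℝ) ≤ T := by exact_mod_cast htT
  have hzi : ∀ u, Integrable (fun ω => z ω u) P := fun u =>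
    hBi.mono' (hz.comp measurable_prodMk_right).aestronglyMeasurable (hB.mono fun ω hω => hω u)
  have hint : Integrable (Function.uncurry z) (P.prod (volume.restrict (Set.Ioc (t : ℝ) T))) := by
    refine (hBi.comp_fst _).mono' hz.aestronglyMeasurable ?_
    filter_upwards [Measure.quasiMeasurePreserving_fst.ae hB] with q hq using hq q.2
  simp only [intervalIntegral.integral_of_le htT']
  refine (ae_eq_condExp_of_forall_setIntegral_eq (𝓕.le t) hint.integral_prod_left
    (fun A _ _ => ((hzi t).const_mul _).integrableOn) (fun A hA _ => ?_)
    (hzt.const_mul _).stronglyMeasurable.aestronglyMeasurable).symm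
  have hint' : Integrable (Function.uncurry z)
      ((P.restrict A).prod (volume.restrict (Set.Ioc (t : ℝ) T))) :=
    hint.mono_measure (Measure.prod_mono Measure.restrict_le_self le_rfl)
  simp only [Function.uncurry_apply_pair]
  rw [integral_integral_swap hint', integral_const_mul]
  -- After Fubini the martingale property makes the inner integral over `A ∈ 𝓕 t` constant in `u`,
  -- whence the factor `T - t`.
  have hconst : ∀ u ∈ Set.Ioc (t : ℝ) T, ∫ ω in A, z ω u ∂P = ∫ ω in A, z ω t ∂P := by
    intro u hu
    lift u to ℝ≥0 using t.coe_nonneg.trans hu.1.le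
    rw [← setIntegral_condExp (𝓕.le t) (hzi u) hA]
    exact integral_congr_ae (ae_restrict_of_ae (hmart u (by exact_mod_cast hu.1.le)
      (by exact_mod_cast hu.2)))
  rw [setIntegral_congr_fun measurableSet_Ioc hconst, setIntegral_const, Real.volume_real_Ioc_of_le
      htT',
    smul_eq_mul]

theorem IsMarket.condExp_integral_index [IsProbabilityMeasure P] (hM : IsMarket P 𝓕 I Sstar S T)
    (hBi : Integrable B P) (hB : ∀ᵐ ω ∂P, ∀ u ≤ T, I u ω / Sstar u ω ≤ B ω)
    (hS : ∃ k, ∀ᵐ ω ∂P, ∀ u ≤ T, S k u ω = I u ω) (htT : t ≤ T) :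
    P[fun ω => ∫ u in (t : ℝ)..T, I u.toNNReal ω / Sstar u.toNNReal ω|𝓕 t]
      =ᵐ[P] fun ω => (T - t) * (I t ω / Sstar t ω) := by
  obtain ⟨k, hk⟩ := hS
  have hmart : ∀ u : ℝ≥0, t ≤ u → u ≤ T → P[fun ω => realIndex I Sstar T ω u|𝓕 t]
      =ᵐ[P] fun ω => realIndex I Sstar T ω t := fun u htu huT => by
    have hbd : ∀ᵐ ω ∂P, ∀ u ≤ T, ‖S k u ω / Sstar u ω‖ ≤ B ω := by
      filter_upwards [hk, hB] with ω h1 h2 v hv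
      rw [h1 v hv, Real.norm_of_nonneg (div_nonneg (hM.index_nonneg ω v hv)
        (hM.benchmark_pos ω v hv).le)]
      exact h2 v hv
    have he : ∀ v ≤ T, (fun ω => realIndex I Sstar T ω v)
        =ᵐ[P] fun ω => S k v ω / Sstar v ω := fun v hv => by
      filter_upwards [hk] with ω h1
      rw [realIndex_coe hv, h1 v hv]
    exact (condExp_congr_ae (he u huT)).trans (((hM.benchmarked_local k).condExp_ae_eq
      (fun v hv => (hM.asset_adapted k v hv).div (hM.benchmark_adapted v hv)) hBi hbd htu
      huT).trans (he t htT).symm)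
  have hzt : Measurable[𝓕 t] fun ω => realIndex I Sstar T ω t := by
    have := hM.measurable_realIndex t
    rwa [Real.toNNReal_coe, min_eq_left htT] at this
  have hz : Measurable (Function.uncurry (realIndex I Sstar T)) :=
    hM.measurable_uncurry_realIndex.mono
      (sup_le_sup_right (MeasurableSpace.comap_mono (sigmaAt_le 𝓕 ∞)) _) le_rfl
  have h := condExp_intervalIntegral hz hzt hBi (hB.mono fun ω hω u => by
    rw [Real.norm_of_nonneg (hM.realIndex_nonneg ω u)]
    exact realIndex_le hω u) htT hmart
  simpa only [integral_realIndex (show (t : ℝ) ≤ T by exact_mod_cast htT), realIndex_coe htT] using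
      h

end NonLife
end

/-! ### The main theorem -/

theorem mainTheorem9 {Ω : Type*} {mΩ : MeasurableSpace Ω} (P : Measure Ω) [IsProbabilityMeasure P]
    (𝓕 : Filtration ℝ≥0 mΩ) {n d : ℕ} (hn : 0 < n) (C : NonLife.Portfolio Ω n)
    (μ : ℝ≥0 → Ω → ℝ) (hC : NonLife.IsReducedForm P 𝓕 C μ)
    (α₀ : ℝ) (g : ℝ → ℝ) (hG : NonLife.HasDelayLaw P C α₀ g)
    (T rate : ℝ≥0) (m : ℝ) (hdev : NonLife.IsCompoundPoissonDev P C rate T m)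
    (m₁ : ℝ) (hX : ∀ i, Integrable (fun ω => (C.firstMark i ω : ℝ)) P)
    (hm₁ : ∀ i, ∫ ω, (C.firstMark i ω : ℝ) ∂P = m₁)
    (I Sstar : ℝ≥0 → Ω → ℝ) (S : Fin d → ℝ≥0 → Ω → ℝ)
    (hM : NonLife.IsMarket P 𝓕 I Sstar S T)
    (hdom : ∃ B : Ω → ℝ, Integrable B P ∧ ∀ᵐ ω ∂P, ∀ u ≤ T, I u ω / Sstar u ω ≤ B ω) :
    ∃ p : Ω → StieltjesFunction ℝ,
      -- `p` is the conditional distribution function of the first reporting times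
      (∀ (i : Fin n) (u : ℝ≥0), (fun ω => p ω u)
        =ᵐ[P] NonLife.condProb P {ω | C.eventTime i 0 ω ≤ u} (𝓕 u)) ∧
      (∀ᵐ ω ∂P, ∀ u : ℝ≥0,
        IntervalIntegrable (fun s => NonLife.reportDensity α₀ g μ s ω) volume 0 u ∧
        p ω u = ∫ s in (0 : ℝ)..u, NonLife.reportDensity α₀ g μ s ω) ∧
      ∀ t ≤ T,
        Integrable (fun ω => C.payment I Sstar T ω - C.payment I Sstar t ω) P ∧
        (∀ᵐ ω ∂P, 0 < NonLife.notReported α₀ g μ t ω) ∧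
        -- the value before the index is priced
        P[fun ω => C.payment I Sstar T ω - C.payment I Sstar t ω | C.globalInfo 𝓕 t]
          =ᵐ[P] (fun ω =>
            rate * m * C.reported t ω
              * (P[fun ω => ∫ u in (t : ℝ)..T, I u.toNNReal ω / Sstar u.toNNReal ω | 𝓕 t]) ω
            + (n - C.reported t ω)
              * (NonLife.unreportedNumerator P 𝓕 p m₁ (rate * m)
                  (fun u ω => I u ω / Sstar u ω) T t ω / NonLife.notReported α₀ g μ t ω)) ∧
        -- the value when one real unit, with nominal price `I`, is a primary asset
        ((∃ k, ∀ᵐ ω ∂P, ∀ u ≤ T, S k u ω = I u ω) →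
          P[fun ω => C.payment I Sstar T ω - C.payment I Sstar t ω | C.globalInfo 𝓕 t]
            =ᵐ[P] (fun ω =>
              rate * m * C.reported t ω * (T - t) * (I t ω / Sstar t ω)
              + (n - C.reported t ω)
                * (NonLife.unreportedNumerator P 𝓕 p m₁ (rate * m)
                    (fun u ω => I u ω / Sstar u ω) T t ω / NonLife.notReported α₀ g μ t ω)) ∧
          ∀ᵐ ω ∂P, I t ω ≠ 0 →
            C.realWorldPrice P 𝓕 I Sstar T t ω * (I t ω / Sstar t ω) =
              rate * m * C.reported t ω * (T - t) * (I t ω / Sstar t ω)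
              + (n - C.reported t ω)
                * (NonLife.unreportedNumerator P 𝓕 p m₁ (rate * m)
                    (fun u ω => I u ω / Sstar u ω) T t ω / NonLife.notReported α₀ g μ t ω)) := by
  obtain ⟨B, hBi, hB⟩ := hdom
  -- A reference policy: it supplies the conditional accident law, the delay law and the signs of
  -- the means used for all policies.
  have i₀ : Fin n := ⟨0, hn⟩
  obtain ⟨κ, hκ⟩ := hC.exists_isAccidentKernel i₀
  have hmk := hκ.isMarkov
  have hρ : IsProbabilityMeasure (P.map (C.delay i₀)) :=
    Measure.isProbabilityMeasure_map (C.measurable_delay i₀).aemeasurable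
  have h : NonLife.IsReportModel P 𝓕 C μ κ (P.map (C.delay i₀)) :=
    ⟨hC, hκ, fun i => hG.map_delay_eq i i₀, hρ⟩
  have hlaw := hκ.ae_isHazardLaw hC.intensity_integrable
  have hsum := fun ω => NonLife.isSumLaw_sumLaw (κ ω) (P.map (C.delay i₀))
  have hdelay := hG.isDelayLaw i₀
  have hc : NonLife.IsClaimModel P C rate T (ENNReal.ofReal m) (ENNReal.ofReal m₁) :=
    ⟨hdev.isMarkedPoisson hC, ENNReal.ofReal_ne_top,
      fun i => NonLife.lintegral_coe_of_integral_eq (hX i) (hm₁ i), ENNReal.ofReal_ne_top⟩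
  -- Means of nonnegative payments, so `ENNReal.ofReal` in `hc` loses nothing.
  have hm0 : 0 ≤ m := hdev.mean i₀ 0 ▸ integral_nonneg fun ω => NNReal.coe_nonneg _
  have hm₁0 : 0 ≤ m₁ := hm₁ i₀ ▸ integral_nonneg fun ω => NNReal.coe_nonneg _
  -- The version is the distribution function of the report-time law given `𝓕_∞`. Its paths are
  -- automatically monotone and right-continuous, and by immersion its value at `u` is the
  -- conditional probability given `𝓕 u`.
  refine ⟨fun ω => NonLife.distFun (NonLife.finitePart (NonLife.sumLaw (κ ω) (P.map (C.delay i₀)))),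
    fun i u => ?_, ?_, fun t htT => ?_⟩
  · simp only [NonLife.distFun_finitePart_apply]
    exact h.sumLaw_Iic_ae_eq_condProb i u
  · filter_upwards [hlaw] with ω hω u
    rw [NonLife.distFun_finitePart_apply]
    exact (hsum ω).integral_reportRate hω hdelay u
  have hnot : ∀ᵐ ω ∂P, NonLife.notReported α₀ g μ t ω
      = (NonLife.sumLaw (κ ω) (P.map (C.delay i₀))).real (Set.Ioi (t : ℝ≥0∞)) :=
    hlaw.mono fun ω hω => ((hsum ω).measureReal_Ioi hω hdelay t).symm
  have hval := NonLife.condExp_payment_sub_payment h hm0 hm₁0 hc hM hBi hB htT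
    (fun ω => NonLife.distFun_measure
      (NonLife.finitePart (NonLife.sumLaw (κ ω) (P.map (C.delay i₀)))))
  refine ⟨NonLife.integrable_payment_sub_payment h hc hM hBi hB htT, ?_, ?_, fun hS => ?_⟩
  · filter_upwards [hnot, hlaw] with ω h1 h2
    rw [h1]
    exact ENNReal.toReal_pos ((hsum ω).measure_Ioi_pos h2 t).ne' (measure_ne_top _ _)
  · filter_upwards [hval, hnot] with ω h1 h2
    rw [h1, h2]
    ring
  have hbond : P[fun ω => C.payment I Sstar T ω - C.payment I Sstar t ω | C.globalInfo 𝓕 t]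
      =ᵐ[P] (fun ω =>
        rate * m * C.reported t ω * (T - t) * (I t ω / Sstar t ω)
        + (n - C.reported t ω)
          * (NonLife.unreportedNumerator P 𝓕 (fun ω => NonLife.distFun
              (NonLife.finitePart (NonLife.sumLaw (κ ω) (P.map (C.delay i₀))))) m₁ (rate * m)
              (fun u ω => I u ω / Sstar u ω) T t ω / NonLife.notReported α₀ g μ t ω)) := by
    filter_upwards [hval, hnot, hM.condExp_integral_index hBi hB hS htT] with ω h1 h2 h3
    rw [h1, h2, h3]
    ring
  refine ⟨hbond, ?_⟩
  filter_upwards [hbond] with ω h1 hI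
  have hpos := (hM.benchmark_pos ω t htT).ne'
  rw [← h1, NonLife.Portfolio.realWorldPrice]
  field_simp
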